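/- **Notation.** $^\dagger$ is the conjugate transpose, $F(s)^H=F(-s^*)^\dagger$ for a rational matrix function $F$; $M>0$ ($M\ge0$) means that $M$ is Hermitian positive (semi)definite, $M<N$ means $N-M>0$; $\bar{\mathbf R}=\mathbf R\cup\{\pm\infty\}$ and $F(i\infty)=\lim_{\omega\to\pm\infty}F(i\omega)$. A rational matrix function is called stable if it is analytic in a half-plane $\mathrm{Re}\,s>-\tau$ for some $\tau>0$. **Channel.** Let $A,\ B=[B_1\ B_2],\ C=\begin{bmatrix}C_1\\C_2\end{bmatrix},\ D$ be complex matrices, where $B_1$ and $B_2$ have $n$ and $n_w$ columns, $C_1$ and $C_2$ have $n_y$ and $n_d$ rows, $n_y+n_d=n+n_w$, such that $$A+A^\dagger+BB^\dagger=0,\qquad B=-C^\dagger D,\qquad D^\dagger D=DD^\dagger=I,$$ and $(A,B,C,D)$ is a minimal realization of $G(s)=D+C(sI-A)^{-1}B=\begin{bmatrix}G_{11}&G_{12}\\G_{21}&G_{22}\end{bmatrix}(s)$, with $G_{11}$ of size $n_y\times n$. Let $\Sigma_u>0$ ($n\times n$) and $\Sigma_w>0$ ($n_w\times n_w$). Put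 $\Psi=G_{11}\Sigma_u^TG_{11}^H+G_{12}\Sigma_w^TG_{12}^H$ and $$\Phi=\begin{bmatrix}\Psi&-G_{11}(I_n+\Sigma_u^T)\\-(I_n+\Sigma_u^T)G_{11}^H&\Sigma_u^T+2I_n\end{bmatrix},\qquad P_e=\begin{bmatrix}H_{11}&I\end{bmatrix}\Phi\begin{bmatrix}H_{11}^H\\I\end{bmatrix}$$ for an $n\times n_y$ rational $H_{11}$. **Equalization problems.** An admissible equalizer is a stable rational $(n_y+n_z)\times(n_y+n_z)$ element $H$ of $H_\infty$ (with some $n_z$ such that $n_y+n_z\ge n$) with $H^HH=HH^H=I$; $H_{11}$ denotes its upper left $n\times n_y$ block. Let $\gamma_\circ$ be the infimum of all $\gamma>0$ for which there is an admissible equalizer with $P_e(i\omega)<\gamma^2I_n$ for all $\omega\in\mathbf R$. For $\gamma>0$ let $\mathcal H^-_{11,\gamma}$ be the set of proper rational stable $n\times n_y$ functions $H_{11}$ with $P_e(i\omega)<\gamma^2I_n$ for all $\omega\in\mathbf R$ and $H_{11}(i\omega)H_{11}(i\omega)^\dagger<I_n$ for all $\omega\in\bar{\mathbf R}$. Let $\gamma_\circ''=\inf\{\gamma>0:\mathcal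 H^-_{11,\gamma}\neq\emptyset\}$. **Data of the semidefinite program.** Suppose that $\lambda\ge0$ and that $\Upsilon_\lambda$ is a stable rational $(n_y+n)\times p$ matrix function with $\Phi+\mathrm{diag}(0,\lambda^2I_n)=\Upsilon_\lambda\Upsilon_\lambda^H$. Let $\left(A_\lambda,B_\lambda,\begin{bmatrix}C_{1,\lambda}\\C_{2,\lambda}\end{bmatrix},\begin{bmatrix}D_{1,\lambda}\\D_{2,\lambda}\end{bmatrix}\right)$ be a minimal realization of $\Upsilon_\lambda$, of state dimension $m$, and let $N_c$ be a matrix of full column rank with $\mathrm{Im}\,N_c=\mathrm{Ker}\,[C_{1,\lambda}\ D_{1,\lambda}]$. Consider the constraints on $\bar\gamma^2\in\mathbf R$ and Hermitian $m\times m$ matrices $X_1,Y_1$: $$\bar\gamma^2>\lambda^2,\quad X_1>0,\quad Y_1>0,\quad A_\lambda X_1+X_1A_\lambda^\dagger+B_\lambda B_\lambda^\dagger<0,\quad\begin{bmatrix}X_1&I\\I&Y_1\end{bmatrix}\ge0,$$ $$\begin{bmatrix}N_c&0\\0&I_n\end{bmatrix}^\dagger\begin{bmatrix}A_\lambda^\dagger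 Y_1+Y_1A_\lambda&Y_1B_\lambda&C_{2,\lambda}^\dagger\\B_\lambda^\dagger Y_1&-I_p&D_{2,\lambda}^\dagger\\C_{2,\lambda}&D_{2,\lambda}&-\bar\gamma^2I_n\end{bmatrix}\begin{bmatrix}N_c&0\\0&I_n\end{bmatrix}<0,\tag{a}$$ and, for a given filter order $m_{11}$, $$\mathrm{rank}\begin{bmatrix}X_1&I\\I&Y_1\end{bmatrix}\le m+m_{11}.\tag{b}$$ **Statement.** Let $m_{11}=m$. Then (b) holds for all $X_1,Y_1$, so that the problem of minimizing $\bar\gamma^2$ subject to (a) and (b) has the same feasible set as the problem of minimizing $\bar\gamma^2$ subject to (a) alone, and this feasible set is convex. Moreover, let $\bar\gamma$ be such that (a) holds with some $X_1,Y_1$, let $\gamma=(\bar\gamma^2-\lambda^2)^{1/2}$, and suppose that for some $\theta>0$ $$\theta\left(\Phi(i\omega)-\gamma^2\begin{bmatrix}0&0\\0&I_n\end{bmatrix}\right)-\begin{bmatrix}I_{n_y}&0\\0&-I_n\end{bmatrix}>0\qquad\text{for all }\omega\in\bar{\mathbf R}.$$ Then $\mathcal H^-_{11,\gamma}\ne\emptyset$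 and $\gamma\ge\gamma_\circ''=\gamma_\circ$. Furthermore, there are matrices $A_{11},B_{11},C_{11},J_{11}$ of sizes $m_{11}\times m_{11}$, $m_{11}\times n_y$, $n\times m_{11}$, $n\times n_y$ and $\hat X>0$ such that $$\Sigma_{\hat X}+\Pi^\dagger K^\dagger\Lambda_{\hat X}+\Lambda_{\hat X}^\dagger K\Pi<0,\qquad K=\begin{bmatrix}A_{11}^\dagger&C_{11}^\dagger\\B_{11}^\dagger&J_{11}^\dagger\end{bmatrix},\tag{c}$$ and for all matrices $A_{11},B_{11},C_{11},J_{11}$ and $\hat X>0$ of these sizes that satisfy (c), the transfer function $H_{11}(s)=C_{11}(sI-A_{11})^{-1}B_{11}+J_{11}$ belongs to $\mathcal H^-_{11,\gamma}$, that is, $\gamma>0$ and $H_{11}$ are feasible for the problem that defines $\gamma_\circ''$. Here $$\Sigma_{\hat X}=\begin{bmatrix}\bar A^\dagger\hat X+\hat X\bar A&\hat X\bar B&\bar C^\dagger\\\bar B^\dagger\hat X&-\bar\gamma^2I_n&\bar D^\dagger\\\bar C&\bar D&-I_p\end{bmatrix},\quad\Lambda_{\hat X}=\begin{bmatrix}\underline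 B^\dagger\hat X&0&\underline D_{12}^\dagger\end{bmatrix},\quad\Pi=\begin{bmatrix}\underline C&\underline D_{21}&0\end{bmatrix},$$ $$\bar A=\begin{bmatrix}A_\lambda^\dagger&0\\0&0\end{bmatrix},\ \bar B=\begin{bmatrix}C_{2,\lambda}^\dagger\\0\end{bmatrix},\ \bar C=\begin{bmatrix}B_\lambda^\dagger&0\end{bmatrix},\ \bar D=D_{2,\lambda}^\dagger,\ \underline B=\begin{bmatrix}0&C_{1,\lambda}^\dagger\\I_{m_{11}}&0\end{bmatrix},\ \underline C=\begin{bmatrix}0&I_{m_{11}}\\0&0\end{bmatrix},\ \underline D_{12}=\begin{bmatrix}0&D_{1,\lambda}^\dagger\end{bmatrix},\ \underline D_{21}=\begin{bmatrix}0\\I_n\end{bmatrix}.$$ -/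

import Mathlib

open scoped ComplexOrder Topology

noncomputable section

namespace CoherentEq

open Matrix Polynomial

/-! ### Rational transfer matrices -/

/-- A rational `ι × κ` matrix transfer function `F(s)` with complex coefficients. -/
abbrev TF (ι κ : Type*) := Matrix ι κ (RatFunc ℂ)

/-- A constant complex matrix viewed as a transfer function. -/
def const {ι κ : Type*} (M : Matrix ι κ ℂ) : TF ι κ := M.map RatFunc.C

/-- The ring homomorphism `p(s) ↦ (p(-s^*))^*` on complex polynomials. -/
def paraPoly : ℂ[X] →+* ℂ[X] :=
  (Polynomial.compRingHom (-Polynomial.X)).comp (Polynomial.mapRingHom (starRingEnd ℂ))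

theorem paraPoly_paraPoly (p : ℂ[X]) : paraPoly (paraPoly p) = p := by
  induction p using Polynomial.induction_on' with
  | add p q hp hq => simp only [map_add, hp, hq]
  | monomial n a => simp [paraPoly, ← Polynomial.C_mul_X_pow_eq_monomial]

theorem paraPoly_injective : Function.Injective paraPoly :=
  Function.LeftInverse.injective paraPoly_paraPoly

/-- The ring homomorphism `f(s) ↦ (f(-s^*))^*` on complex rational functions. -/
def paraRat : RatFunc ℂ →+* RatFunc ℂ :=
  RatFunc.mapRingHom paraPoly
    (nonZeroDivisors_le_comap_nonZeroDivisors_of_injective paraPoly paraPoly_injective)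

/-- The para-Hermitian conjugate `F(s)^H = F(-s^*)^†`. -/
def paraConj {ι κ : Type*} (F : TF ι κ) : TF κ ι := (F.map paraRat)ᵀ

/-- The value `F(s)` at a complex number `s` which is not a pole of `F`. -/
def evalTF {ι κ : Type*} (F : TF ι κ) (s : ℂ) : Matrix ι κ ℂ :=
  F.map (fun f => f.eval (RingHom.id ℂ) s)

/-- The frequency response `F(iω)`. -/
def freq {ι κ : Type*} (F : TF ι κ) (ω : ℝ) : Matrix ι κ ℂ := evalTF F (ω * Complex.I)

/-- `s` is a pole of `F`: a zero of the denominator of one of its (reduced) entries. -/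
def IsPole {ι κ : Type*} (F : TF ι κ) (s : ℂ) : Prop :=
  ∃ i j, (F i j).denom.eval s = 0

/-- `F` is analytic in a half-plane `Re s > -τ` for some `τ > 0`; in particular, all its poles
are in the open left half-plane. -/
def IsStable {ι κ : Type*} (F : TF ι κ) : Prop :=
  ∃ τ : ℝ, 0 < τ ∧ ∀ s : ℂ, -τ < s.re → ¬ IsPole F s

/-- `F` is proper: in each entry the degree of the numerator does not exceed the degree of the
denominator. -/
def IsProper {ι κ : Type*} (F : TF ι κ) : Prop :=
  ∀ i j, (F i j).num.natDegree ≤ (F i j).denom.natDegree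

/-- The rational function `F` belongs to the Hardy space `H_∞`: it is analytic and bounded in the
open right half-plane. -/
def IsHardyInfty {ι κ : Type*} (F : TF ι κ) : Prop :=
  (∀ s : ℂ, 0 < s.re → ¬ IsPole F s) ∧
    ∃ M : ℝ, ∀ s : ℂ, 0 < s.re → ∀ i j, ‖evalTF F s i j‖ ≤ M

/-- The property `P` of complex matrices holds for `F(iω)` for all `ω ∈ ℝ ∪ {±∞}`, where `F(i∞)` is
the limit of `F(iω)` as `ω → ±∞`. -/
def ForallExtFreq {ι κ : Type*} (F : TF ι κ) (P : Matrix ι κ ℂ → Prop) : Prop :=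
  (∀ ω : ℝ, P (freq F ω)) ∧
    ∃ L : Matrix ι κ ℂ, Filter.Tendsto (freq F) (Filter.atBot ⊔ Filter.atTop) (𝓝 L) ∧ P L

/-- The transfer function `C (s I - A)⁻¹ B + D` of a state-space model. -/
def ssTF {ι κ : Type*} {k : ℕ} (A : Matrix (Fin k) (Fin k) ℂ) (B : Matrix (Fin k) κ ℂ)
    (C : Matrix ι (Fin k) ℂ) (D : Matrix ι κ ℂ) : TF ι κ :=
  const C * ((RatFunc.X : RatFunc ℂ) • (1 : TF (Fin k) (Fin k)) - const A)⁻¹ * const B + const D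

/-- `(A, B, C, D)` is a minimal realization of `F`: its state dimension `k` is the smallest among
all realizations, i.e. it equals the McMillan degree of `F`. -/
def IsMinimalRealization {ι κ : Type*} (F : TF ι κ) {k : ℕ} (A : Matrix (Fin k) (Fin k) ℂ)
    (B : Matrix (Fin k) κ ℂ) (C : Matrix ι (Fin k) ℂ) (D : Matrix ι κ ℂ) : Prop :=
  ssTF A B C D = F ∧
    ∀ (k' : ℕ) (A' : Matrix (Fin k') (Fin k') ℂ) (B' : Matrix (Fin k') κ ℂ)
      (C' : Matrix ι (Fin k') ℂ) (D' : Matrix ι κ ℂ), ssTF A' B' C' D' = F → k ≤ k'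

/-! ### The quantum channel -/

/-- A completely passive linear quantum channel with `N` oscillator modes, input fields `u`
(dimension `n`) and `w` (dimension `nw`), output fields `y` (dimension `ny`) and `d` (dimension
`nd`), in a Gaussian state with signal and noise intensities `Su`, `Sw`. The equalities for `D` force
`ny + nd = n + nw`. -/
structure Channel (n nw ny nd N : ℕ) where
  A : Matrix (Fin N) (Fin N) ℂ
  B : Matrix (Fin N) (Fin n ⊕ Fin nw) ℂ
  C : Matrix (Fin ny ⊕ Fin nd) (Fin N) ℂ
  D : Matrix (Fin ny ⊕ Fin nd) (Fin n ⊕ Fin nw) ℂ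
  /-- the intensity `Σ_u` of the signal -/
  Su : Matrix (Fin n) (Fin n) ℂ
  /-- the intensity `Σ_w` of the environment noise -/
  Sw : Matrix (Fin nw) (Fin nw) ℂ
  Su_pos : Su.PosDef
  Sw_pos : Sw.PosDef
  lyap : A + Aᴴ + B * Bᴴ = 0
  B_eq : B = -(Cᴴ * D)
  D_left : Dᴴ * D = 1
  D_right : D * Dᴴ = 1
  minimal : IsMinimalRealization (ssTF A B C D) A B C D

namespace Channel

variable {n nw ny nd N : ℕ} (S : Channel n nw ny nd N)

/-- The transfer function `G(s)` from `col(u, w)` to `col(y, d)`. -/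
def G : TF (Fin ny ⊕ Fin nd) (Fin n ⊕ Fin nw) := ssTF S.A S.B S.C S.D

/-- The block from `u` to `y`. -/
def G₁₁ : TF (Fin ny) (Fin n) := S.G.toBlocks₁₁

/-- The block from `w` to `y`. -/
def G₁₂ : TF (Fin ny) (Fin nw) := S.G.toBlocks₁₂

/-- `Ψ = G₁₁ Σ_uᵀ G₁₁^H + G₁₂ Σ_wᵀ G₁₂^H`. -/
def Psi : TF (Fin ny) (Fin ny) :=
  S.G₁₁ * const S.Suᵀ * paraConj S.G₁₁ + S.G₁₂ * const S.Swᵀ * paraConj S.G₁₂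

/-- The matrix `Φ(s)` of the power spectrum density. -/
def Phi : TF (Fin ny ⊕ Fin n) (Fin ny ⊕ Fin n) :=
  fromBlocks S.Psi (-(S.G₁₁ * const (1 + S.Suᵀ)))
    (-(const (1 + S.Suᵀ) * paraConj S.G₁₁)) (const (S.Suᵀ + (2 : ℂ) • 1))

/-- `Φ_λ = Φ + diag(0, λ² I)`. -/
def PhiLam (lam : ℝ) : TF (Fin ny ⊕ Fin n) (Fin ny ⊕ Fin n) :=
  S.Phi + const (fromBlocks 0 0 0 (((lam ^ 2 : ℝ) : ℂ) • 1))

/-- The power spectrum density `P_e(s) = [H₁₁ I] Φ [H₁₁^H; I]` of the equalization error. -/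
def Pe (H₁₁ : TF (Fin n) (Fin ny)) : TF (Fin n) (Fin n) :=
  (fromCols H₁₁ 1 : TF (Fin n) (Fin ny ⊕ Fin n)) * S.Phi *
    (fromRows (paraConj H₁₁) 1 : TF (Fin ny ⊕ Fin n) (Fin n))

/-- `P_e(iω) < γ² I` for all real `ω`. -/
def PeBound (γ : ℝ) (H₁₁ : TF (Fin n) (Fin ny)) : Prop :=
  ∀ ω : ℝ, (((γ ^ 2 : ℝ) : ℂ) • (1 : Matrix (Fin n) (Fin n) ℂ) - freq (S.Pe H₁₁) ω).PosDef

end Channel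

/-- `H` is the transfer function from `col(y, z)` to `col(û, ẑ)` of an admissible completely passive
physically realizable equalizer: a square (`n + nzh = ny + nz`) stable rational paraunitary element
of `H_∞`. -/
structure IsAdmissible {n nzh ny nz : ℕ} (H : TF (Fin n ⊕ Fin nzh) (Fin ny ⊕ Fin nz)) : Prop where
  dim : n + nzh = ny + nz
  hardy : IsHardyInfty H
  stable : IsStable H
  para_left : paraConj H * H = 1
  para_right : H * paraConj H = 1

namespace Channel

variable {n nw ny nd N : ℕ} (S : Channel n nw ny nd N)

/-- The `γ > 0` for which some admissible equalizer (with an environment of any dimension `nz`)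
achieves `P_e(iω) < γ² I` for all `ω`. -/
def achievable : Set ℝ :=
  {γ | 0 < γ ∧ ∃ (nz nzh : ℕ) (H : TF (Fin n ⊕ Fin nzh) (Fin ny ⊕ Fin nz)),
    IsAdmissible H ∧ S.PeBound γ H.toBlocks₁₁}

/-- The optimal equalization performance `γ_∘`. -/
def gammaOpt : ℝ := sInf S.achievable

/-- The set `ℋ₁₁,γ⁻` of proper rational stable strictly contractive transfer functions which
satisfy `P_e(iω) < γ² I` for all `ω`. -/
def strictSet (γ : ℝ) : Set (TF (Fin n) (Fin ny)) :=
  {H₁₁ | IsProper H₁₁ ∧ IsStable H₁₁ ∧ S.PeBound γ H₁₁ ∧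
    ForallExtFreq H₁₁ (fun M => (1 - M * Mᴴ).PosDef)}

/-- The optimal value `γ_∘''` of the strictly contractive auxiliary problem. -/
def gammaStrict : ℝ := sInf {γ : ℝ | 0 < γ ∧ (S.strictSet γ).Nonempty}

/-- The frequency domain condition: for some `θ > 0`,
`θ (Φ(iω) - γ² diag(0, I)) - diag(I, -I) > 0` for all `ω ∈ ℝ ∪ {±∞}`. -/
def FreqCond (γ : ℝ) : Prop :=
  ∃ θ : ℝ, 0 < θ ∧ ForallExtFreq S.Phi (fun M =>
    ((θ : ℂ) • (M - fromBlocks 0 0 0 (((γ ^ 2 : ℝ) : ℂ) • 1)) - fromBlocks 1 0 0 (-1)).PosDef)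

/-- `Υ` is a spectral factor of `Φ_λ`. -/
def IsSpectralFactor {p : ℕ} (lam : ℝ) (Υ : TF (Fin ny ⊕ Fin n) (Fin p)) : Prop :=
  S.PhiLam lam = Υ * paraConj Υ ∧ IsStable Υ

end Channel

/-! ### The matrix inequalities -/

/-- The matrices of a state-space model of a transfer function with state dimension `m`, input
dimension `p` and outputs partitioned into two vectors of dimensions `ny` and `n`. -/
structure FactorData (n ny p m : ℕ) where
  A : Matrix (Fin m) (Fin m) ℂ
  B : Matrix (Fin m) (Fin p) ℂ
  C₁ : Matrix (Fin ny) (Fin m) ℂ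
  C₂ : Matrix (Fin n) (Fin m) ℂ
  D₁ : Matrix (Fin ny) (Fin p) ℂ
  D₂ : Matrix (Fin n) (Fin p) ℂ

namespace FactorData

variable {n ny p m : ℕ} (R : FactorData n ny p m)

/-- The state-space model `R` is a minimal realization of `Υ`. -/
def Realizes (Υ : TF (Fin ny ⊕ Fin n) (Fin p)) : Prop :=
  IsMinimalRealization Υ R.A R.B (fromRows R.C₁ R.C₂) (fromRows R.D₁ R.D₂)

/-- `Nc` has full column rank and its image is the kernel of `[C₁ D₁]`. -/
def IsKernelMatrix {q : ℕ} (Nc : Matrix (Fin m ⊕ Fin p) (Fin q) ℂ) : Prop :=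
  LinearMap.range Nc.mulVecLin = LinearMap.ker (fromCols R.C₁ R.D₁).mulVecLin ∧ Nc.rank = q

/-- The left-hand side of the matrix inequality in `Y₁` and `ρ = γ̄²`. -/
def lmiY {q : ℕ} (Nc : Matrix (Fin m ⊕ Fin p) (Fin q) ℂ) (ρ : ℝ) (Y : Matrix (Fin m) (Fin m) ℂ) :
    Matrix (Fin q ⊕ Fin n) (Fin q ⊕ Fin n) ℂ :=
  (fromBlocks Nc 0 0 1 : Matrix ((Fin m ⊕ Fin p) ⊕ Fin n) (Fin q ⊕ Fin n) ℂ)ᴴ *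
    fromBlocks (fromBlocks (R.Aᴴ * Y + Y * R.A) (Y * R.B) (R.Bᴴ * Y) (-1)) (fromRows R.C₂ᴴ R.D₂ᴴ)
      (fromCols R.C₂ R.D₂) (-((ρ : ℂ) • 1)) *
    (fromBlocks Nc 0 0 1 : Matrix ((Fin m ⊕ Fin p) ⊕ Fin n) (Fin q ⊕ Fin n) ℂ)

/-- The feasible set of the semidefinite program, in the variables `(ρ, X₁, Y₁)` with `ρ = γ̄²`. -/
def sdpFeasible {q : ℕ} (Nc : Matrix (Fin m ⊕ Fin p) (Fin q) ℂ) (lam : ℝ) :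
    Set (ℝ × Matrix (Fin m) (Fin m) ℂ × Matrix (Fin m) (Fin m) ℂ) :=
  {v | lam ^ 2 < v.1 ∧ v.2.1.PosDef ∧ v.2.2.PosDef ∧
    (-(R.A * v.2.1 + v.2.1 * R.Aᴴ + R.B * R.Bᴴ)).PosDef ∧
    (-(R.lmiY Nc v.1 v.2.2)).PosDef ∧
    (fromBlocks v.2.1 1 1 v.2.2).PosSemidef}

/-- The feasible set of the rank-constrained problem for filters with `m₁₁` states. -/
def rankFeasible {q : ℕ} (Nc : Matrix (Fin m ⊕ Fin p) (Fin q) ℂ) (lam : ℝ) (m₁₁ : ℕ) :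
    Set (ℝ × Matrix (Fin m) (Fin m) ℂ × Matrix (Fin m) (Fin m) ℂ) :=
  {v | v ∈ R.sdpFeasible Nc lam ∧ (fromBlocks v.2.1 1 1 v.2.2).rank ≤ m + m₁₁}

section Synthesis

variable (m₁₁ : ℕ)

/-- `Ā = diag(A_λ^†, 0)`. -/
def Abar : Matrix (Fin m ⊕ Fin m₁₁) (Fin m ⊕ Fin m₁₁) ℂ := fromBlocks R.Aᴴ 0 0 0

/-- `B̄ = col(C₂^†, 0)`. -/
def Bbar : Matrix (Fin m ⊕ Fin m₁₁) (Fin n) ℂ := fromRows R.C₂ᴴ 0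

/-- `C̄ = [B_λ^† 0]`. -/
def Cbar : Matrix (Fin p) (Fin m ⊕ Fin m₁₁) ℂ := fromCols R.Bᴴ 0

/-- `D̄ = D₂^†`. -/
def Dbar : Matrix (Fin p) (Fin n) ℂ := R.D₂ᴴ

/-- The underlined `B`. -/
def Bund : Matrix (Fin m ⊕ Fin m₁₁) (Fin m₁₁ ⊕ Fin ny) ℂ := fromBlocks 0 R.C₁ᴴ 1 0

/-- The underlined `C`. -/
def Cund (n m m₁₁ : ℕ) : Matrix (Fin m₁₁ ⊕ Fin n) (Fin m ⊕ Fin m₁₁) ℂ := fromBlocks 0 1 0 0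

/-- The underlined `D₁₂`. -/
def Dund₁₂ : Matrix (Fin p) (Fin m₁₁ ⊕ Fin ny) ℂ := fromCols 0 R.D₁ᴴ

/-- The underlined `D₂₁`. -/
def Dund₂₁ (n m₁₁ : ℕ) : Matrix (Fin m₁₁ ⊕ Fin n) (Fin n) ℂ := fromRows 0 1

/-- The matrix `Σ_X̂`. -/
def SigmaX (γbar : ℝ) (Xhat : Matrix (Fin m ⊕ Fin m₁₁) (Fin m ⊕ Fin m₁₁) ℂ) :
    Matrix ((Fin m ⊕ Fin m₁₁) ⊕ (Fin n ⊕ Fin p)) ((Fin m ⊕ Fin m₁₁) ⊕ (Fin n ⊕ Fin p)) ℂ :=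
  fromBlocks ((R.Abar m₁₁)ᴴ * Xhat + Xhat * R.Abar m₁₁)
    (fromCols (Xhat * R.Bbar m₁₁) (R.Cbar m₁₁)ᴴ)
    (fromRows ((R.Bbar m₁₁)ᴴ * Xhat) (R.Cbar m₁₁))
    (fromBlocks (-(((γbar ^ 2 : ℝ) : ℂ) • 1)) R.Dbarᴴ R.Dbar (-1))

/-- The matrix `Λ_X̂`. -/
def LambdaX (Xhat : Matrix (Fin m ⊕ Fin m₁₁) (Fin m ⊕ Fin m₁₁) ℂ) :
    Matrix (Fin m₁₁ ⊕ Fin ny) ((Fin m ⊕ Fin m₁₁) ⊕ (Fin n ⊕ Fin p)) ℂ :=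
  fromCols ((R.Bund m₁₁)ᴴ * Xhat) (fromCols 0 (R.Dund₁₂ m₁₁)ᴴ)

/-- The matrix `Π`. -/
def PiMat (n p m m₁₁ : ℕ) :
    Matrix (Fin m₁₁ ⊕ Fin n) ((Fin m ⊕ Fin m₁₁) ⊕ (Fin n ⊕ Fin p)) ℂ :=
  fromCols (Cund n m m₁₁) (fromCols (Dund₂₁ n m₁₁) 0)

/-- The synthesis inequality `Σ_X̂ + Π^† K^† Λ_X̂ + Λ_X̂^† K Π < 0` with
`K = [A₁₁^† C₁₁^†; B₁₁^† J₁₁^†]`. -/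
def SynthesisLMI {m₁₁ : ℕ} (γbar : ℝ)
    (A₁₁ : Matrix (Fin m₁₁) (Fin m₁₁) ℂ) (B₁₁ : Matrix (Fin m₁₁) (Fin ny) ℂ)
    (C₁₁ : Matrix (Fin n) (Fin m₁₁) ℂ) (J₁₁ : Matrix (Fin n) (Fin ny) ℂ)
    (Xhat : Matrix (Fin m ⊕ Fin m₁₁) (Fin m ⊕ Fin m₁₁) ℂ) : Prop :=
  let K : Matrix (Fin m₁₁ ⊕ Fin ny) (Fin m₁₁ ⊕ Fin n) ℂ := fromBlocks A₁₁ᴴ C₁₁ᴴ B₁₁ᴴ J₁₁ᴴ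
  (-(R.SigmaX m₁₁ γbar Xhat + (PiMat n p m m₁₁)ᴴ * Kᴴ * R.LambdaX m₁₁ Xhat
    + (R.LambdaX m₁₁ Xhat)ᴴ * K * PiMat n p m m₁₁)).PosDef

end Synthesis

end FactorData

end CoherentEq

end

open scoped ComplexOrder Topology

noncomputable section

/-! Strict inequalities between Hermitian matrices are handled through their quadratic forms `qf`,
and each analytic claim is reduced to compactness of the unit sphere.

From the semidefinite program to a filter: (c) is affine in the unknown `K`, so for a fixed positive
definite `X̂` it is solvable as soon as `Σ_X̂` is negative on the kernels of `Π` and of `Λ_X̂`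
(`exists_elimination`, via Finsler's lemma). Perturb `X₁` to `X₀ = X₁ + εI` so that `E = X₀ - Y₁⁻¹ >
0`, and take `X̂ = [X₀ E; E E]`. Its inverse has upper left block `Y₁`, so the kernel of `Π` sees
only the Lyapunov inequality for `X₀` and the kernel of `Λ_X̂` only the inequality for `Y₁`
(`exists_synthesisLMI`).

From (c) to the equalizer: (c) is the bounded real inequality of the system whose response along the
imaginary axis is `Υ^† [H₁₁ I]^†`. It bounds `[H₁₁ I] Υ Υ^H [H₁₁ I]^H` by `γ̄²`, and subtracting
`λ²` gives `P_e < γ²`; a diagonal block of `X̂⁻¹` certifies stability of `A₁₁`. The frequency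
condition is an S-procedure: tested on `(H₁₁^† u, u)`, it turns the error bound into `H₁₁ H₁₁^† <
I`, also at infinity (`mem_strictSet_of_synthesisLMI`).

Equality of the optimal values: a strictly contractive `H₁₁` embeds in an admissible equalizer. The
strict bounded real lemma supplies `P`, a factor of its slack supplies additional outputs, and a
unitary completion of the feedthrough supplies additional inputs (`exists_isAdmissible_extension`).
The lemma rests on a strict KYP lemma (`exists_kyp`), obtained by separating convex sets and
splitting the dual matrix into rank-one pieces at single frequencies. Conversely, the block `H₁₁` of
an admissible equalizer is contractive, and replacing it by `r H₁₁` with `r < 1` close to 1 makes it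
strictly contractive at an arbitrarily small cost in `γ`, because the error spectrum is convex along
rays (`strictSet_add_nonempty`). -/

namespace CoherentEq

open Matrix Polynomial

/-! ### Quadratic forms, perturbation of strict inequalities, Finsler's lemma -/

section QuadraticForm

variable {ι κ : Type*} [Fintype ι] [Fintype κ]

/-- The real part of the quadratic form `x ↦ x^† M x`. -/
def qf (M : Matrix ι ι ℂ) (x : ι → ℂ) : ℝ := (star x ⬝ᵥ M *ᵥ x).re

theorem qf_add (M N : Matrix ι ι ℂ) (x : ι → ℂ) : qf (M + N) x = qf M x + qf N x := by
  simp [qf, add_mulVec]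

theorem qf_neg (M : Matrix ι ι ℂ) (x : ι → ℂ) : qf (-M) x = -qf M x := by
  simp [qf, neg_mulVec]

theorem qf_sub (M N : Matrix ι ι ℂ) (x : ι → ℂ) : qf (M - N) x = qf M x - qf N x := by
  simp [qf, sub_mulVec]

theorem qf_smul (c : ℝ) (M : Matrix ι ι ℂ) (x : ι → ℂ) : qf ((c : ℂ) • M) x = c * qf M x := by
  simp [qf, smul_mulVec]

theorem qf_real_smul (c : ℝ) (M : Matrix ι ι ℂ) (x : ι → ℂ) : qf (c • M) x = c * qf M x := by
  simp [qf, smul_mulVec]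

theorem qf_vec_smul (c : ℝ) (M : Matrix ι ι ℂ) (x : ι → ℂ) :
    qf M ((c : ℂ) • x) = c ^ 2 * qf M x := by
  simp [qf, mulVec_smul, pow_two, mul_assoc]

theorem star_dotProduct_mulVec_conjTranspose (M : Matrix ι κ ℂ) (x : κ → ℂ) (y : ι → ℂ) :
    star x ⬝ᵥ Mᴴ *ᵥ y = star (star y ⬝ᵥ M *ᵥ x) := by
  rw [← star_dotProduct, star_mulVec, dotProduct_mulVec]

theorem qf_conjTranspose (M : Matrix ι ι ℂ) (x : ι → ℂ) : qf Mᴴ x = qf M x := by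
  simp [qf, star_dotProduct_mulVec_conjTranspose]

theorem qf_congr (M : Matrix ι ι ℂ) (B : Matrix ι κ ℂ) (x : κ → ℂ) :
    qf (Bᴴ * M * B) x = qf M (B *ᵥ x) := by
  simp only [qf, star_mulVec, ← mulVec_mulVec, dotProduct_mulVec, vecMul_vecMul, Matrix.mul_assoc]

theorem qf_gram (B : Matrix ι κ ℂ) (x : κ → ℂ) :
    qf (Bᴴ * B) x = (star (B *ᵥ x) ⬝ᵥ (B *ᵥ x)).re := by
  classical
  have := qf_congr 1 B x
  rw [Matrix.mul_one] at this
  rw [this, qf, one_mulVec]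

theorem qf_one [DecidableEq ι] (x : ι → ℂ) : qf 1 x = ∑ i, ‖x i‖ ^ 2 := by
  simp [qf, dotProduct, ← Complex.normSq_eq_norm_sq, Complex.normSq_apply]

theorem qf_one_pos [DecidableEq ι] {x : ι → ℂ} (hx : x ≠ 0) : 0 < qf 1 x := by
  obtain ⟨i, hi⟩ := Function.ne_iff.1 hx
  rw [qf_one]
  exact Finset.sum_pos' (fun _ _ => by positivity) ⟨i, Finset.mem_univ _, by
    have : 0 < ‖x i‖ := norm_pos_iff.2 hi
    positivity⟩

theorem qf_vec_add {M : Matrix ι ι ℂ} (hM : M.IsHermitian) (x y : ι → ℂ) :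
    qf M (x + y) = qf M x + qf M y + 2 * (star x ⬝ᵥ M *ᵥ y).re := by
  have h := star_dotProduct_mulVec_conjTranspose M y x
  rw [hM.eq] at h
  simp only [qf, star_add, mulVec_add, add_dotProduct, dotProduct_add, h, Complex.add_re,
    Complex.star_def, Complex.conj_re]
  ring

theorem IsHermitian.dotProduct_eq_qf {M : Matrix ι ι ℂ} (hM : M.IsHermitian) (x : ι → ℂ) :
    star x ⬝ᵥ M *ᵥ x = (qf M x : ℂ) := by
  have h := star_dotProduct_mulVec_conjTranspose M x x
  rw [hM.eq] at h
  exact (Complex.conj_eq_iff_re.1 h.symm).symm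

theorem posDef_iff_qf {M : Matrix ι ι ℂ} : M.PosDef ↔ M.IsHermitian ∧ ∀ x, x ≠ 0 → 0 < qf M x := by
  rw [posDef_iff_dotProduct_mulVec]
  refine and_congr_right fun h => forall_congr' fun x => ?_
  rw [IsHermitian.dotProduct_eq_qf h]
  simp

theorem posSemidef_iff_qf {M : Matrix ι ι ℂ} : M.PosSemidef ↔ M.IsHermitian ∧ ∀ x, 0 ≤ qf M x := by
  rw [posSemidef_iff_dotProduct_mulVec]
  refine and_congr_right fun h => forall_congr' fun x => ?_
  rw [IsHermitian.dotProduct_eq_qf h]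
  simp

theorem _root_.Matrix.PosDef.qf_pos {M : Matrix ι ι ℂ} (hM : M.PosDef) {x : ι → ℂ} (hx : x ≠ 0) :
    0 < qf M x := (posDef_iff_qf.1 hM).2 x hx

theorem _root_.Matrix.PosSemidef.qf_nonneg {M : Matrix ι ι ℂ} (hM : M.PosSemidef) (x : ι → ℂ) :
    0 ≤ qf M x := (posSemidef_iff_qf.1 hM).2 x

theorem continuous_qf : Continuous fun z : Matrix ι ι ℂ × (ι → ℂ) => qf z.1 z.2 := by
  unfold qf
  fun_prop

/-- Positivity needs testing only on the compact unit sphere, so it survives small perturbations. No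
symmetry is imposed: the set is open among all matrices, as the separation argument below requires.
-/
theorem isOpen_setOf_qf_pos : IsOpen {M : Matrix ι ι ℂ | ∀ x, x ≠ 0 → 0 < qf M x} := by
  rw [isOpen_iff_mem_nhds]
  intro M₀ h₀
  have hc : IsCompact (Metric.sphere (0 : ι → ℂ) 1) := isCompact_sphere _ _
  have := hc.eventually_forall_of_forall_eventually (x₀ := M₀)
    (P := fun M x => 0 < qf M x) (fun x hx => by
      have hx0 : x ≠ 0 := by rintro rfl; simp at hx
      exact (continuous_qf.tendsto (M₀, x)).eventually (lt_mem_nhds (h₀ x hx0)))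
  filter_upwards [this] with M hM x hx
  have hn : 0 < ‖x‖ := norm_pos_iff.2 hx
  have h1 := hM (((‖x‖⁻¹ : ℝ) : ℂ) • x) (by
    rw [mem_sphere_zero_iff_norm, norm_smul, Complex.norm_real, Real.norm_eq_abs, abs_of_pos (by positivity),
      inv_mul_cancel₀ hn.ne'])
  rw [qf_vec_smul] at h1
  exact pos_of_mul_pos_right h1 (by positivity)

/-- This is the source of every small margin below: the stability margin `τ`, the shift of `X₁` and
the shrinking of an equalizer. -/
theorem exists_smul_add_posDef {M E : Matrix ι ι ℂ} (hM : M.PosDef) (hE : E.IsHermitian) :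
    ∃ ε₀ : ℝ, 0 < ε₀ ∧ ∀ ε : ℝ, 0 ≤ ε → ε ≤ ε₀ → (M + (ε : ℂ) • E).PosDef := by
  have hcont : Continuous fun ε : ℝ => M + (ε : ℂ) • E := by fun_prop
  have h0 : (fun ε : ℝ => M + (ε : ℂ) • E) 0 ∈ {M : Matrix ι ι ℂ | ∀ x, x ≠ 0 → 0 < qf M x} := by
    simpa using (posDef_iff_qf.1 hM).2
  have h1 := hcont.continuousAt.preimage_mem_nhds (isOpen_setOf_qf_pos.mem_nhds h0)
  obtain ⟨δ, hδ, hsub⟩ := Metric.mem_nhds_iff.1 h1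
  refine ⟨δ / 2, by positivity, fun ε hε hε' => posDef_iff_qf.2 ⟨?_, ?_⟩⟩
  · refine hM.1.add ?_
    simp [IsHermitian, conjTranspose_smul, hE.eq]
  · exact hsub (by
      rw [Metric.mem_ball, dist_zero_right, Real.norm_eq_abs, abs_of_nonneg hε]; linarith)

/-- Finsler's lemma. -/
theorem exists_sub_smul_gram_neg {M : Matrix ι ι ℂ} (L : Matrix κ ι ℂ) (hM : M.IsHermitian)
    (h : ∀ x, x ≠ 0 → L *ᵥ x = 0 → qf M x < 0) :
    ∃ r : ℝ, 0 < r ∧ ((r : ℂ) • (Lᴴ * L) - M).PosDef := by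
  have hc : IsCompact (Metric.sphere (0 : ι → ℂ) 1) := isCompact_sphere _ _
  have hgn : ∀ x, 0 ≤ qf (Lᴴ * L) x := (posSemidef_conjTranspose_mul_self L).qf_nonneg
  -- The sets `U k` are open and increase with `k`, since `LᴴL ≥ 0`. They cover the sphere: on the
  -- kernel of `L` already `k = 0` works, and elsewhere any large `k` does. By compactness a single
  -- `k` serves all vectors.
  let U : ℕ → Set (ι → ℂ) := fun k => {x | 0 < qf (((k : ℝ) : ℂ) • (Lᴴ * L) - M) x}
  have hU : ∀ k, IsOpen (U k) := fun k =>
    isOpen_lt continuous_const (continuous_qf.comp (by fun_prop : Continuous fun x : ι → ℂ =>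
      ((((k : ℝ) : ℂ) • (Lᴴ * L) - M), x)))
  have hmono : Monotone U := by
    intro k l hkl x hx
    simp only [U, Set.mem_ofPred_eq, qf_sub, qf_smul] at hx ⊢
    have : (k : ℝ) ≤ l := by exact_mod_cast hkl
    nlinarith [hgn x]
  have hcov : Metric.sphere (0 : ι → ℂ) 1 ⊆ ⋃ k, U k := by
    intro x hx
    have hx0 : x ≠ 0 := by rintro rfl; simp at hx
    rw [Set.mem_iUnion]
    simp only [U, Set.mem_ofPred_eq, qf_sub, qf_smul]
    by_cases hL : L *ᵥ x = 0
    · exact ⟨0, by simpa using h x hx0 hL⟩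
    · have hp : 0 < qf (Lᴴ * L) x := by
        classical
        rw [qf_gram]
        simpa [qf] using qf_one_pos hL
      obtain ⟨k, hk⟩ := exists_nat_gt (qf M x / qf (Lᴴ * L) x)
      rw [div_lt_iff₀ hp] at hk
      exact ⟨k, by linarith⟩
  obtain ⟨k, hk⟩ := hc.elim_directed_cover U hU hcov hmono.directed_le
  -- Passing from `k` to `k + 1` only ensures that the multiplier is positive.
  refine ⟨k + 1, by positivity, posDef_iff_qf.2 ⟨?_, fun x hx => ?_⟩⟩
  · refine IsHermitian.sub ?_ hM
    simp [IsHermitian, conjTranspose_smul]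
  have hn : 0 < ‖x‖ := norm_pos_iff.2 hx
  have h1 : (((‖x‖⁻¹ : ℝ) : ℂ) • x) ∈ U (k + 1) := hmono (Nat.le_succ k) (hk (by
    rw [mem_sphere_zero_iff_norm, norm_smul, Complex.norm_real, Real.norm_eq_abs, abs_of_pos (by positivity),
      inv_mul_cancel₀ hn.ne']))
  simp only [U, Set.mem_ofPred_eq] at h1
  rw [qf_vec_smul] at h1
  have := pos_of_mul_pos_right h1 (by positivity)
  push_cast at this ⊢
  exact this

end QuadraticForm

/-! ### Elimination of the unknown gain from a matrix inequality -/

section Elimination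

variable {ι κ μ : Type*} [Fintype ι] [Fintype κ] [Fintype μ]

/-- The elimination lemma for matrix inequalities with a surjective right factor. -/
theorem exists_elimination [DecidableEq μ] {M : Matrix ι ι ℂ} (hM : M.IsHermitian)
    (L : Matrix κ ι ℂ) (P : Matrix μ ι ℂ) (hP : P * Pᴴ = 1)
    (hPM : ∀ x, x ≠ 0 → P *ᵥ x = 0 → qf M x < 0) (hLM : ∀ x, x ≠ 0 → L *ᵥ x = 0 → qf M x < 0) :
    ∃ K : Matrix κ μ ℂ, (-(M + Pᴴ * Kᴴ * L + Lᴴ * K * P)).PosDef := by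
  classical
  obtain ⟨r, hr, hQ⟩ := exists_sub_smul_gram_neg L hM hLM
  set Q := (r : ℂ) • (Lᴴ * L) - M with hQdef
  have hQu : IsUnit Q.det := (isUnit_iff_isUnit_det _).1 hQ.isUnit
  have hG : (P * Q⁻¹ * Pᴴ).PosDef := by
    refine hQ.inv.mul_mul_conjTranspose_same fun x y hxy => ?_
    have := congrArg (fun z => z ᵥ* Pᴴ) hxy
    simpa [hP] using this
  have hGu : IsUnit (P * Q⁻¹ * Pᴴ).det := (isUnit_iff_isUnit_det _).1 hG.isUnit
  set G := P * Q⁻¹ * Pᴴ with hGdef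
  -- `T` is the `Q`-orthogonal projection along the kernel of `P`: it splits `v = a + b` with `P a =
  -- 0` and `a`, `b` orthogonal for `Q`. The gain is chosen so that `K P v = -r L b`.
  let T : Matrix ι ι ℂ := Q⁻¹ * Pᴴ * G⁻¹ * P
  refine ⟨-((r : ℂ) • (L * Q⁻¹ * Pᴴ * G⁻¹)), posDef_iff_qf.2 ⟨?_, fun v hv => ?_⟩⟩
  · simp [IsHermitian, hM.eq, Matrix.mul_assoc]
    abel
  set K := -((r : ℂ) • (L * Q⁻¹ * Pᴴ * G⁻¹)) with hK
  set b := T *ᵥ v with hb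
  set a := v - b with ha
  have hPT : P * T = P := by
    simp only [T, ← Matrix.mul_assoc]
    rw [← hGdef, Matrix.mul_nonsing_inv _ hGu, Matrix.one_mul]
  have hPa : P *ᵥ a = 0 := by
    rw [ha, hb, mulVec_sub, mulVec_mulVec, hPT, sub_self]
  have hvab : v = a + b := by simp [ha]
  have hQb : Q *ᵥ b = Pᴴ *ᵥ ((G⁻¹ * P) *ᵥ v) := by
    rw [hb, mulVec_mulVec, mulVec_mulVec]
    simp only [T, Matrix.mul_assoc]
    rw [Matrix.mul_nonsing_inv_cancel_left _ _ hQu]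
  have hcross : star a ⬝ᵥ Q *ᵥ b = 0 := by
    rw [hQb, star_dotProduct_mulVec_conjTranspose, hPa]
    simp
  have hKP : (K * P) *ᵥ v = -((r : ℂ) • (L *ᵥ b)) := by
    rw [hb, mulVec_mulVec, hK]
    simp only [T, Matrix.mul_assoc, Matrix.neg_mul, Matrix.smul_mul, neg_mulVec, smul_mulVec]
  have h1 : qf (Lᴴ * K * P) v = -(r * (star (L *ᵥ v) ⬝ᵥ L *ᵥ b).re) := by
    rw [qf, Matrix.mul_assoc, ← mulVec_mulVec, hKP, dotProduct_mulVec, ← star_mulVec]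
    simp
  have h2 : qf (Pᴴ * Kᴴ * L) v = -(r * (star (L *ᵥ v) ⬝ᵥ L *ᵥ b).re) := by
    rw [← h1, ← qf_conjTranspose]
    simp [Matrix.mul_assoc]
  have h3 : qf M v = r * qf (Lᴴ * L) v - qf Q v := by
    rw [hQdef, qf_sub, qf_smul]; ring
  have h3a : qf M a = r * qf (Lᴴ * L) a - qf Q a := by
    rw [hQdef, qf_sub, qf_smul]; ring
  have h4 : qf Q v = qf Q a + qf Q b := by
    rw [hvab, qf_vec_add hQ.1, hcross]; simp
  have hLL : (Lᴴ * L).IsHermitian := isHermitian_conjTranspose_mul_self L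
  have hip : ∀ x y, (star x ⬝ᵥ (Lᴴ * L) *ᵥ y).re = (star (L *ᵥ x) ⬝ᵥ L *ᵥ y).re := by
    intro x y
    rw [← mulVec_mulVec, dotProduct_mulVec, ← star_mulVec]
  have h5 : qf (Lᴴ * L) v = qf (Lᴴ * L) a + qf (Lᴴ * L) b + 2 * (star (L *ᵥ a) ⬝ᵥ L *ᵥ b).re := by
    rw [hvab, qf_vec_add hLL, hip]
  have h6 : (star (L *ᵥ v) ⬝ᵥ L *ᵥ b).re = (star (L *ᵥ a) ⬝ᵥ L *ᵥ b).re + qf (Lᴴ * L) b := by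
    rw [hvab, mulVec_add, star_add, add_dotProduct, Complex.add_re, qf_gram]
  have hLb : 0 ≤ qf (Lᴴ * L) b := (posSemidef_conjTranspose_mul_self L).qf_nonneg b
  rw [qf_neg, qf_add, qf_add, h1, h2, h3, h4, h5, h6]
  -- After expansion the cross terms `⟨L a, L b⟩` cancel, and the form to be shown positive is
  -- `-M(a) + Q(b) + r |L b|²`.
  have key : 0 < -qf M a + qf Q b := by
    by_cases ha0 : a = 0
    · have hb0 : b ≠ 0 := by rintro hb0; exact hv (by rw [hvab, ha0, hb0, add_zero])
      rw [ha0]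
      have := hQ.qf_pos hb0
      simpa [qf] using this
    · have := hPM a ha0 hPa
      have := hQ.posSemidef.qf_nonneg b
      linarith
  nlinarith

end Elimination

/-! ### Duality and the Kalman–Yakubovich–Popov lemma -/

section KYP

variable {ι σ τ : Type*} [Fintype ι] [Fintype σ] [Fintype τ]

/-- The values of `f` at the matrix units and at `i` times the matrix units are the real parts and
the negated imaginary parts of the entries of `Y`. -/
theorem exists_re_trace_eq [DecidableEq ι] (f : Matrix ι ι ℂ →ₗ[ℝ] ℝ) :
    ∃ Y : Matrix ι ι ℂ, ∀ N, f N = (trace (Y * N)).re := by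
  refine ⟨of fun j i => ((f (single i j (1 : ℂ)) : ℝ) : ℂ) - ((f (single i j Complex.I) : ℝ) : ℂ) * Complex.I, fun N => ?_⟩
  have hs : ∀ (i j : ι) (c : ℂ), single i j c = c.re • single i j (1 : ℂ) + c.im • single i j Complex.I := by
    intro i j c
    rw [smul_single, smul_single, ← single_add]
    congr 1
    simp [Complex.re_add_im]
  conv_lhs => rw [matrix_eq_sum_single N]
  simp only [map_sum, trace, diag, mul_apply, Complex.re_sum, of_apply]
  rw [Finset.sum_comm]
  refine Finset.sum_congr rfl fun j _ => Finset.sum_congr rfl fun i _ => ?_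
  rw [hs i j (N i j), map_add, map_smul, map_smul]
  simp
  ring

theorem qf_eq_re_trace (M : Matrix ι ι ℂ) (x : ι → ℂ) :
    qf M x = (trace (M * vecMulVec x (star x))).re := by
  rw [qf, mul_vecMulVec, trace_vecMulVec, dotProduct_comm]

theorem re_trace_conjTranspose_mul_mul [DecidableEq σ] (M : Matrix τ τ ℂ) (W : Matrix τ σ ℂ) :
    (trace (Wᴴ * M * W)).re = ∑ j, qf M (W.col j) := by
  rw [trace, Complex.re_sum]
  refine Finset.sum_congr rfl fun j => ?_
  intro _
  have := qf_congr M W (Pi.single j 1)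
  rw [mulVec_single_one] at this
  rw [← this, qf]
  simp

/-- A dual certificate for infeasibility of a linear matrix inequality of Kalman–Yakubovich–Popov
type. -/
theorem exists_dual_certificate [DecidableEq τ] {M : Matrix τ τ ℂ} (hM : M.IsHermitian)
    (K₁ K₂ : Matrix σ τ ℂ)
    (h : ∀ P : Matrix σ σ ℂ, P.IsHermitian → ¬ (-(M + (K₁ᴴ * P * K₂ + K₂ᴴ * P * K₁))).PosDef) :
    ∃ Z : Matrix τ τ ℂ, Z.PosSemidef ∧ Z ≠ 0 ∧ 0 ≤ (trace (Z * M)).re ∧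
      K₂ * Z * K₁ᴴ + K₁ * Z * K₂ᴴ = 0 := by
  let V : Matrix σ σ ℂ → Matrix τ τ ℂ := fun P => K₁ᴴ * P * K₂ + K₂ᴴ * P * K₁
  have hVH : ∀ P, P.IsHermitian → (V P).IsHermitian := by
    intro P hP
    simp [V, IsHermitian, hP.eq, Matrix.mul_assoc, add_comm]
  set s : Set (Matrix τ τ ℂ) := {N | ∀ x, x ≠ 0 → 0 < qf N x} with hs
  let t : Set (Matrix τ τ ℂ) := {N | ∃ P : Matrix σ σ ℂ, P.IsHermitian ∧ N = -(M + V P)}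
  have hsc : Convex ℝ s := by
    intro a ha b hb α β hα hβ hαβ x hx
    rw [qf_add, qf_real_smul, qf_real_smul]
    have h1 := ha x hx
    have h2 := hb x hx
    rcases hα.eq_or_lt with rfl | hα'
    · have : β = 1 := by linarith
      subst this; linarith
    · have := mul_pos hα' h1
      have := mul_nonneg hβ h2.le
      linarith
  have htc : Convex ℝ t := by
    rintro _ ⟨P, hP, rfl⟩ _ ⟨P', hP', rfl⟩ α β hα hβ hαβ
    refine ⟨α • P + β • P', ?_, ?_⟩
    · simp [IsHermitian, hP.eq, hP'.eq]
    · have : M = α • M + β • M := by rw [← add_smul, hαβ, one_smul]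
      conv_rhs => rw [this]
      simp only [V, Matrix.mul_add, Matrix.add_mul, Matrix.mul_smul, Matrix.smul_mul, smul_neg,
        smul_add]
      abel
  have hdisj : Disjoint s t := by
    rw [Set.disjoint_left]
    rintro _ hN ⟨P, hP, rfl⟩
    exact h P hP (posDef_iff_qf.2 ⟨(hM.add (hVH P hP)).neg, hN⟩)
  -- Infeasibility says that the open convex cone `s` misses the affine family `t`. The dual matrix
  -- is minus the Hermitian part of the matrix representing the separating functional.
  obtain ⟨f, u, hfs, hft⟩ := geometric_hahn_banach_open hsc isOpen_setOf_qf_pos htc hdisj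
  obtain ⟨Y, hY⟩ := exists_re_trace_eq (f : Matrix τ τ ℂ →ₗ[ℝ] ℝ)
  replace hY : ∀ N, f N = (trace (Y * N)).re := hY
  obtain ⟨Z, hZdef⟩ : ∃ Z : Matrix τ τ ℂ, Z = -((2⁻¹ : ℂ) • (Y + Yᴴ)) := ⟨_, rfl⟩
  have hZ : ∀ N : Matrix τ τ ℂ, N.IsHermitian → (trace (Z * N)).re = -f N := by
    intro N hN
    have h1 : (trace (Yᴴ * N)).re = (trace (Y * N)).re := by
      have : trace (Yᴴ * N) = star (trace (Y * N)) := by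
        rw [← trace_conjTranspose, conjTranspose_mul, hN.eq, trace_mul_comm]
      rw [this]; simp
    simp only [hZdef, Matrix.neg_mul, Matrix.smul_mul, trace_neg, trace_smul, Matrix.add_mul, trace_add]
    rw [hY]
    simp [h1]
    ring
  have hZH : Z.IsHermitian := by
    simp [hZdef, IsHermitian, conjTranspose_smul, add_comm]
  have hone : (1 : Matrix τ τ ℂ) ∈ s := fun x hx => qf_one_pos hx
  -- As `s` is a cone, positive multiples of `1` bring `f` arbitrarily close to 0 from within `s`.
  have hu : 0 ≤ u := by
    by_contra hu
    push Not at hu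
    have h1 : f 1 < u := hfs 1 hone
    have hf1 : f 1 < 0 := h1.trans hu
    have hpos : 0 < u / (2 * f 1) := div_pos_of_neg_of_neg hu (by linarith)
    have h2 : f ((u / (2 * f 1)) • (1 : Matrix τ τ ℂ)) < u := hfs _ (fun x hx => by
      rw [qf_real_smul]; exact mul_pos hpos (hone x hx))
    rw [map_smul, smul_eq_mul] at h2
    have : u / (2 * f 1) * f 1 = u / 2 := by field_simp [hf1.ne]
    rw [this] at h2
    linarith
  have hZP : Z.PosSemidef := by
    refine posSemidef_iff_qf.2 ⟨hZH, fun x => ?_⟩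
    have hv : (vecMulVec x (star x)).PosSemidef := posSemidef_vecMulVec_self_star x
    rw [qf_eq_re_trace, hZ _ hv.1]
    by_contra hneg
    push Not at hneg
    set a := f (vecMulVec x (star x)) with ha
    have ha0 : 0 < a := by linarith
    obtain ⟨c, hc⟩ := exists_nat_gt ((u - f 1) / a)
    rw [div_lt_iff₀ ha0] at hc
    have : f ((c : ℝ) • vecMulVec x (star x) + 1) < u := hfs _ (fun y hy => by
      rw [qf_add, qf_real_smul]
      have := hv.qf_nonneg y
      have := hone y hy
      positivity)
    rw [map_add, map_smul, smul_eq_mul, ← ha] at this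
    linarith
  have hkey : ∀ P : Matrix σ σ ℂ, P.IsHermitian → u ≤ (trace (Z * M)).re + (trace (Z * V P)).re := by
    intro P hP
    have := hft _ ⟨P, hP, rfl⟩
    rw [hZ _ hM, hZ _ (hVH P hP)]
    rw [map_neg, map_add] at this
    linarith
  have hV0 : V 0 = 0 := by simp [V]
  have hZM : u ≤ (trace (Z * M)).re := by simpa [hV0] using hkey 0 isHermitian_zero
  refine ⟨Z, hZP, ?_, hu.trans hZM, ?_⟩
  · intro hZ0
    have h1 := hZ 1 isHermitian_one
    have h2 := hfs 1 hone
    rw [hZ0] at h1 hZM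
    simp at h1 hZM
    linarith
  · set Y₀ := K₂ * Z * K₁ᴴ + K₁ * Z * K₂ᴴ with hY₀
    have hY₀H : Y₀.IsHermitian := by
      simp [hY₀, IsHermitian, hZH.eq, Matrix.mul_assoc, add_comm]
    have htr : trace (Z * V Y₀) = trace (Y₀ * Y₀) := by
      have h1 : trace (Z * (K₁ᴴ * Y₀ * K₂)) = trace (K₂ * Z * K₁ᴴ * Y₀) := by
        rw [← Matrix.mul_assoc, trace_mul_comm]; simp only [Matrix.mul_assoc]
      have h2 : trace (Z * (K₂ᴴ * Y₀ * K₁)) = trace (K₁ * Z * K₂ᴴ * Y₀) := by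
        rw [← Matrix.mul_assoc, trace_mul_comm]; simp only [Matrix.mul_assoc]
      simp only [V, Matrix.mul_add, trace_add, h1, h2]
      rw [← trace_add, ← Matrix.add_mul]
    have hlin : ∀ c : ℝ, (trace (Z * V (c • Y₀))).re = c * (trace (Y₀ * Y₀)).re := by
      intro c
      have : V (c • Y₀) = c • V Y₀ := by simp [V]
      rw [this, Matrix.mul_smul, trace_smul, htr, Complex.smul_re, smul_eq_mul]
    -- Along `P = c Y₀` the separation bounds an affine function of `c ∈ ℝ` from below, so its slope
    -- `tr Y₀²` vanishes. Since `Y₀` is Hermitian, it is zero.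
    have hre : (trace (Y₀ * Y₀)).re = 0 := by
      by_contra hne
      have := hkey ((-(((trace (Z * M)).re + 1) / (trace (Y₀ * Y₀)).re)) • Y₀)
        (by simp [IsHermitian, hY₀H.eq])
      rw [hlin, neg_mul, div_mul_cancel₀ _ hne] at this
      linarith
    have hps := posSemidef_conjTranspose_mul_self Y₀
    rw [hY₀H.eq] at hps
    rw [← trace_conjTranspose_mul_self_eq_zero_iff, hY₀H.eq]
    have him := hps.trace_nonneg
    apply Complex.ext
    · exact hre
    · exact (Complex.le_def.1 him).2.symm

theorem qf_zero_vec (M : Matrix ι ι ℂ) : qf M 0 = 0 := by simp [qf]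

open scoped MatrixOrder Matrix.Norms.L2Operator in
theorem exists_eq_conjTranspose_mul_self [DecidableEq τ] {Z : Matrix τ τ ℂ} (hZ : Z.PosSemidef) :
    ∃ W : Matrix τ τ ℂ, Z = Wᴴ * W := by
  obtain ⟨W, hW⟩ := CStarAlgebra.nonneg_iff_eq_star_mul_self.mp hZ.nonneg
  exact ⟨W, hW⟩

/-- A factor of `Z` is determined only up to a unitary on the right. Rotating by eigenvectors of the
Gram matrix makes the columns of `K W` orthogonal, so the zero columns separate from an independent
family. -/
theorem exists_orthogonal_factor [DecidableEq τ] {Z : Matrix τ τ ℂ} (hZ : Z.PosSemidef)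
    (K : Matrix σ τ ℂ) :
    ∃ (W : Matrix τ τ ℂ) (d : τ → ℂ), W * Wᴴ = Z ∧ (K * W)ᴴ * (K * W) = diagonal d := by
  obtain ⟨W₀, hW₀⟩ := exists_eq_conjTranspose_mul_self hZ
  have hH : ((K * W₀ᴴ)ᴴ * (K * W₀ᴴ)).IsHermitian := isHermitian_conjTranspose_mul_self _
  set U : Matrix τ τ ℂ := (hH.eigenvectorUnitary : Matrix τ τ ℂ) with hU
  have hUU : U * Uᴴ = 1 := Unitary.coe_mul_star_self hH.eigenvectorUnitary
  have hUU' : Uᴴ * U = 1 := Unitary.coe_star_mul_self hH.eigenvectorUnitary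
  refine ⟨W₀ᴴ * U, RCLike.ofReal ∘ hH.eigenvalues, ?_, ?_⟩
  · rw [conjTranspose_mul, Matrix.mul_assoc, ← Matrix.mul_assoc U, hUU, Matrix.one_mul,
      conjTranspose_conjTranspose, ← hW₀]
  · have := hH.conjStarAlgAut_star_eigenvectorUnitary
    rw [Unitary.conjStarAlgAut_star_apply] at this
    rw [← this, ← hU]
    simp only [conjTranspose_mul, Matrix.mul_assoc, star_eq_conjTranspose]

/-- The columns of `K₂ W` are independent, so the skew relation forces `K₁ W = K₂ W S` with `S`
skew-Hermitian. A unitary `U` diagonalizing `S` leaves the trace unchanged and makes each column `w`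
of `W U` satisfy `K₁ w = iω K₂ w`, where the hypothesis controls `M`. -/
theorem sum_mulVec_qf_nonneg_eq_zero [DecidableEq σ] {ι : Type*} [Fintype ι] [DecidableEq ι]
    {M : Matrix τ τ ℂ} (K₁ K₂ : Matrix ι τ ℂ)
    (h : ∀ w, w ≠ 0 → (∃ ω : ℝ, K₁ *ᵥ w = ((ω : ℂ) * Complex.I) • K₂ *ᵥ w) → qf M w < 0)
    (W : Matrix τ σ ℂ) {d : σ → ℂ} (hd : ∀ j, d j ≠ 0) (hD : (K₂ * W)ᴴ * (K₂ * W) = diagonal d)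
    (hskew : (K₂ * W) * (K₁ * W)ᴴ + (K₁ * W) * (K₂ * W)ᴴ = 0) :
    (trace (Wᴴ * M * W)).re ≤ 0 ∧ (0 ≤ (trace (Wᴴ * M * W)).re → W = 0) := by
  set F := K₂ * W with hF
  set E := K₁ * W with hE
  set D' : Matrix σ σ ℂ := diagonal (fun j => (d j)⁻¹) with hD'
  have hDD' : (Fᴴ * F) * D' = 1 := by
    rw [hD, hD', diagonal_mul_diagonal]
    simp [hd]
  have hD'D : D' * (Fᴴ * F) = 1 := by
    rw [hD, hD', diagonal_mul_diagonal]
    simp [hd]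
  set S : Matrix σ σ ℂ := -(Eᴴ * F * D') with hS
  have hEF : E * Fᴴ = -(F * Eᴴ) := eq_neg_of_add_eq_zero_right hskew
  have hEFS : E = F * S := by
    calc E = E * ((Fᴴ * F) * D') := by rw [hDD', Matrix.mul_one]
      _ = (E * Fᴴ) * (F * D') := by simp only [Matrix.mul_assoc]
      _ = F * S := by rw [hEF, hS]; simp only [Matrix.mul_assoc, Matrix.neg_mul, Matrix.mul_neg]
  have hSS : S + Sᴴ = 0 := by
    have h1 : F * (S + Sᴴ) * Fᴴ = 0 := by
      have : F * Eᴴ = F * Sᴴ * Fᴴ := by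
        rw [Matrix.mul_assoc F Sᴴ, ← conjTranspose_mul, ← hEFS]
      rw [Matrix.mul_add, Matrix.add_mul, ← hEFS, ← this, hEF]
      simp
    calc S + Sᴴ = (D' * (Fᴴ * F)) * (S + Sᴴ) * ((Fᴴ * F) * D') := by
          rw [hD'D, hDD', Matrix.one_mul, Matrix.mul_one]
      _ = D' * Fᴴ * (F * (S + Sᴴ) * Fᴴ) * F * D' := by simp only [Matrix.mul_assoc]
      _ = 0 := by rw [h1]; simp
  set H : Matrix σ σ ℂ := (-Complex.I) • S with hHdef
  have hHS : S = Complex.I • H := by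
    rw [hHdef, smul_smul]; simp
  have hH : H.IsHermitian := by
    have : Sᴴ = -S := eq_neg_of_add_eq_zero_right hSS
    simp [hHdef, IsHermitian, conjTranspose_smul, this]
  set U : Matrix σ σ ℂ := (hH.eigenvectorUnitary : Matrix σ σ ℂ) with hU
  have hUU : U * Uᴴ = 1 := Unitary.coe_mul_star_self hH.eigenvectorUnitary
  have htr : trace (Wᴴ * M * W) = trace ((W * U)ᴴ * M * (W * U)) := by
    rw [conjTranspose_mul]
    have : Uᴴ * Wᴴ * M * (W * U) = Uᴴ * ((Wᴴ * M * W) * U) := by simp only [Matrix.mul_assoc]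
    rw [this, trace_mul_comm Uᴴ, Matrix.mul_assoc _ U, hUU, Matrix.mul_one]
  have heig : ∀ j, ∃ ω : ℝ, K₁ *ᵥ (W * U).col j = ((ω : ℂ) * Complex.I) • K₂ *ᵥ (W * U).col j := by
    intro j
    refine ⟨hH.eigenvalues j, ?_⟩
    have hc : (W * U).col j = W *ᵥ U.col j := by
      ext i; simp [mul_apply, mulVec, dotProduct]
    have h1 : H *ᵥ U.col j = (hH.eigenvalues j) • U.col j := hH.mulVec_eigenvectorBasis j
    rw [hc, mulVec_mulVec, mulVec_mulVec, ← hE, ← hF, hEFS, ← mulVec_mulVec, hHS, smul_mulVec, h1,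
      mulVec_smul, mulVec_smul, smul_comm, mul_smul]
    ext i; simp
  rw [htr, re_trace_conjTranspose_mul_mul]
  have hterm : ∀ j, qf M ((W * U).col j) ≤ 0 := by
    intro j
    by_cases h0 : (W * U).col j = 0
    · rw [h0, qf_zero_vec]
    · exact (h _ h0 (heig j)).le
  refine ⟨Finset.sum_nonpos fun j _ => hterm j, fun hge => ?_⟩
  have hz := (Finset.sum_eq_zero_iff_of_nonpos fun j _ => hterm j).1
    (le_antisymm (Finset.sum_nonpos fun j _ => hterm j) hge)
  have hWU : W * U = 0 := by
    ext i j
    by_contra hne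
    have h0 : (W * U).col j ≠ 0 := fun h0 => hne (congrFun h0 i)
    exact (h _ h0 (heig j)).ne (hz j (Finset.mem_univ _))
  calc W = W * U * Uᴴ := by rw [Matrix.mul_assoc, hUU, Matrix.mul_one]
    _ = 0 := by rw [hWU, Matrix.zero_mul]

/-- The Kalman–Yakubovich–Popov lemma with a strict frequency domain inequality. -/
theorem exists_kyp [DecidableEq τ] [DecidableEq σ] {M : Matrix τ τ ℂ} (hM : M.IsHermitian)
    (K₁ K₂ : Matrix σ τ ℂ)
    (h : ∀ w, w ≠ 0 → (K₂ *ᵥ w = 0 ∨ ∃ ω : ℝ, K₁ *ᵥ w = ((ω : ℂ) * Complex.I) • K₂ *ᵥ w) →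
      qf M w < 0) :
    ∃ P : Matrix σ σ ℂ, P.IsHermitian ∧ (-(M + (K₁ᴴ * P * K₂ + K₂ᴴ * P * K₁))).PosDef := by
  by_contra! hno
  obtain ⟨Z, hZ, hZ0, hZM, hZK⟩ := exists_dual_certificate hM K₁ K₂ hno
  apply hZ0
  obtain ⟨W, d, hW, hd⟩ := exists_orthogonal_factor hZ K₂
  have hcol0 : ∀ j, d j = 0 → ∀ i, (K₂ * W) i j = 0 := by
    intro j hj i
    have h1 : ((K₂ * W)ᴴ * (K₂ * W)) j j = 0 := by rw [hd]; simp [hj]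
    have h2 : (∑ i, ‖(K₂ * W) i j‖ ^ 2 : ℝ) = 0 := by
      have := congrArg Complex.re h1
      rw [mul_apply, Complex.re_sum, Complex.zero_re] at this
      rw [← this]
      refine Finset.sum_congr rfl fun k _ => ?_
      rw [conjTranspose_apply, Complex.star_def, ← Complex.normSq_eq_conj_mul_self,
        Complex.ofReal_re, Complex.normSq_eq_norm_sq]
    have h3 := (Finset.sum_eq_zero_iff_of_nonneg (fun _ _ => by positivity)).1 h2 i (Finset.mem_univ _)
    simpa using h3
  -- Columns with `d j = 0` lie in the kernel of `K₂`, the case of infinite frequency, and drop out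
  -- of the skew relation. The remaining ones are covered by the finite-frequency lemma.
  let J := {j // d j ≠ 0}
  let W₁ : Matrix τ J ℂ := W.submatrix id Subtype.val
  have hK₁W : K₁ * W₁ = (K₁ * W).submatrix id Subtype.val := by ext i j; simp [W₁, mul_apply]
  have hK₂W : K₂ * W₁ = (K₂ * W).submatrix id Subtype.val := by ext i j; simp [W₁, mul_apply]
  have hD₁ : (K₂ * W₁)ᴴ * (K₂ * W₁) = diagonal (fun j : J => d j) := by
    rw [hK₂W]
    ext i j
    have := congrFun (congrFun hd i) j
    simp only [mul_apply, conjTranspose_apply, submatrix_apply, id] at this ⊢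
    rw [this]
    by_cases hij : i = j
    · simp [hij]
    · rw [diagonal_apply_ne _ hij, diagonal_apply_ne _ fun h => hij (Subtype.ext h)]
  have hFE : ∀ (G : Matrix σ τ ℂ), (K₂ * W) * Gᴴ =
      (K₂ * W).submatrix id (Subtype.val : J → τ) * (G.submatrix id (Subtype.val : J → τ))ᴴ := by
    intro G
    ext i k
    simp only [mul_apply, conjTranspose_apply, submatrix_apply, id]
    have := Fintype.sum_subtype_add_sum_subtype (fun j => d j ≠ 0)
      (fun j => (∑ l, K₂ i l * W l j) * star (G k j))
    rw [← this]
    refine (add_eq_left.2 (Finset.sum_eq_zero fun j _ => ?_))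
    have h0 := hcol0 j (not_not.1 j.2) i
    rw [mul_apply] at h0
    rw [h0, zero_mul]
  have hskew : (K₂ * W₁) * (K₁ * W₁)ᴴ + (K₁ * W₁) * (K₂ * W₁)ᴴ = 0 := by
    have h1 : (K₂ * W₁) * (K₁ * W₁)ᴴ = K₂ * Z * K₁ᴴ := by
      rw [hK₁W, hK₂W, ← hFE, ← hW, conjTranspose_mul]; simp only [Matrix.mul_assoc]
    have h2 : (K₁ * W₁) * (K₂ * W₁)ᴴ = K₁ * Z * K₂ᴴ := by
      have := congrArg conjTranspose h1
      simpa [hZ.1.eq, Matrix.mul_assoc] using this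
    rw [h1, h2, hZK]
  obtain ⟨h1, h1'⟩ := sum_mulVec_qf_nonneg_eq_zero K₁ K₂ (fun w hw hw' => h w hw (Or.inr hw'))
    W₁ (fun j : J => j.2) hD₁ hskew
  -- Both groups contribute nonpositively to a trace that is nonnegative, so every column vanishes,
  -- contradicting `Z ≠ 0`.
  have htr : (trace (Z * M)).re = (∑ j : J, qf M (W.col j)) +
      ∑ j : {j // ¬ d j ≠ 0}, qf M (W.col j) := by
    rw [Fintype.sum_subtype_add_sum_subtype (fun j => d j ≠ 0) (fun j => qf M (W.col j)),
      ← re_trace_conjTranspose_mul_mul, ← hW, Matrix.mul_assoc, trace_mul_comm]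
  have htr₁ : (trace (W₁ᴴ * M * W₁)).re = ∑ j : J, qf M (W.col j) :=
    re_trace_conjTranspose_mul_mul M W₁
  have hz : ∀ j : {j // ¬ d j ≠ 0}, W.col j ≠ 0 → qf M (W.col j) < 0 := by
    intro j hj
    refine h _ hj (Or.inl ?_)
    ext i
    have := hcol0 j (not_not.1 j.2) i
    simpa [mul_apply, mulVec, dotProduct] using this
  have hz' : ∀ j : {j // ¬ d j ≠ 0}, qf M (W.col j) ≤ 0 := by
    intro j
    by_cases h0 : W.col j = 0
    · rw [h0, qf_zero_vec]
    · exact (hz j h0).le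
  have hs : ∑ j : {j // ¬ d j ≠ 0}, qf M (W.col j) ≤ 0 := Finset.sum_nonpos fun j _ => hz' j
  rw [htr₁] at h1 h1'
  have hW₁ := h1' (by linarith)
  have hz'' := (Finset.sum_eq_zero_iff_of_nonpos fun j _ => hz' j).1 (le_antisymm hs (by linarith))
  have hW0 : W = 0 := by
    ext i j
    by_cases hj : d j = 0
    · by_contra hne
      have h0 : W.col j ≠ 0 := fun h0 => hne (congrFun h0 i)
      exact (hz ⟨j, not_not.2 hj⟩ h0).ne (hz'' ⟨j, not_not.2 hj⟩ (Finset.mem_univ _))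
    · exact congrFun (congrFun hW₁ i) ⟨j, hj⟩
  rw [← hW, hW0, Matrix.zero_mul]

end KYP

/-! ### Values and poles of rational functions -/

section RationalFunctions

/-- The value of a rational function at a complex number. -/
abbrev ev (f : RatFunc ℂ) (s : ℂ) : ℂ := f.eval (RingHom.id ℂ) s

/-- The rational function `f` has no pole at `s`. -/
def RegAt (f : RatFunc ℂ) (s : ℂ) : Prop := f.denom.eval s ≠ 0

/-- The reduced denominator divides every denominator, so any representation `p / q` with `q(s) ≠ 0`
shows regularity at `s` and computes the value. -/
theorem regAt_and_ev_of_mul_eq {f : RatFunc ℂ} {p q : ℂ[X]} {s : ℂ} (hq : q.eval s ≠ 0)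
    (h : f * algebraMap ℂ[X] (RatFunc ℂ) q = algebraMap ℂ[X] (RatFunc ℂ) p) :
    RegAt f s ∧ ev f s = p.eval s / q.eval s := by
  have hq0 : q ≠ 0 := by rintro rfl; simp at hq
  have hq0' : algebraMap ℂ[X] (RatFunc ℂ) q ≠ 0 := RatFunc.algebraMap_ne_zero hq0
  have hf : f = algebraMap ℂ[X] (RatFunc ℂ) p / algebraMap ℂ[X] (RatFunc ℂ) q :=
    (eq_div_iff hq0').2 h
  have hd : f.denom ∣ q := hf ▸ RatFunc.denom_div_dvd p q
  have hr : RegAt f s := fun h0 => hq (eval_eq_zero_of_dvd_of_eval_eq_zero hd h0)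
  refine ⟨hr, ?_⟩
  have := congrArg (Polynomial.eval s) ((RatFunc.num_mul_eq_mul_denom_iff hq0).2 hf)
  rw [eval_mul, eval_mul] at this
  rw [ev, RatFunc.eval, eval₂_id, eval₂_id, div_eq_div_iff hr hq, this]

theorem RegAt.add {f g : RatFunc ℂ} {s : ℂ} (hf : RegAt f s) (hg : RegAt g s) :
    RegAt (f + g) s := fun h0 => by
  have := eval_eq_zero_of_dvd_of_eval_eq_zero (RatFunc.denom_add_dvd f g) h0
  rw [eval_mul] at this
  exact mul_ne_zero hf hg this

theorem RegAt.mul {f g : RatFunc ℂ} {s : ℂ} (hf : RegAt f s) (hg : RegAt g s) :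
    RegAt (f * g) s := fun h0 => by
  have := eval_eq_zero_of_dvd_of_eval_eq_zero (RatFunc.denom_mul_dvd f g) h0
  rw [eval_mul] at this
  exact mul_ne_zero hf hg this

theorem regAt_C (c : ℂ) (s : ℂ) : RegAt (RatFunc.C c) s := by simp [RegAt]

theorem ev_add {f g : RatFunc ℂ} {s : ℂ} (hf : RegAt f s) (hg : RegAt g s) :
    ev (f + g) s = ev f s + ev g s :=
  RatFunc.eval_add _ _ (by rwa [eval₂_id]) (by rwa [eval₂_id])

theorem ev_mul {f g : RatFunc ℂ} {s : ℂ} (hf : RegAt f s) (hg : RegAt g s) :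
    ev (f * g) s = ev f s * ev g s :=
  RatFunc.eval_mul _ _ (by rwa [eval₂_id]) (by rwa [eval₂_id])

theorem regAt_sum {α : Type*} (t : Finset α) {f : α → RatFunc ℂ} {s : ℂ}
    (h : ∀ i ∈ t, RegAt (f i) s) :
    RegAt (∑ i ∈ t, f i) s ∧ ev (∑ i ∈ t, f i) s = ∑ i ∈ t, ev (f i) s := by
  classical
  induction t using Finset.induction_on with
  | empty => simp [RegAt]
  | insert a t ha ih =>
    obtain ⟨h1, h2⟩ := ih fun i hi => h i (Finset.mem_insert_of_mem hi)
    have h3 := h a (Finset.mem_insert_self a t)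
    rw [Finset.sum_insert ha, Finset.sum_insert ha, ev_add h3 h1, h2]
    exact ⟨h3.add h1, rfl⟩

theorem eval_paraPoly (p : ℂ[X]) (s : ℂ) :
    (paraPoly p).eval s = star (p.eval (-star s)) := by
  have : (paraPoly p).eval s = p.eval₂ (starRingEnd ℂ) (-s) := by
    simp [paraPoly, eval_comp, eval_map]
  rw [this]
  have h := Polynomial.hom_eval₂ p (RingHom.id ℂ) (starRingEnd ℂ) (-star s)
  rw [eval₂_id] at h
  rw [Complex.star_def] at h ⊢
  rw [h]
  simp

theorem paraRat_algebraMap (p : ℂ[X]) :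
    paraRat (algebraMap ℂ[X] (RatFunc ℂ) p) = algebraMap ℂ[X] (RatFunc ℂ) (paraPoly p) := by
  have h := RatFunc.map_apply_div paraPoly
    (nonZeroDivisors_le_comap_nonZeroDivisors_of_injective paraPoly paraPoly_injective) p 1
  simp only [map_one, div_one] at h
  exact h

theorem paraRat_C (c : ℂ) : paraRat (RatFunc.C c) = RatFunc.C (star c) := by
  rw [← RatFunc.algebraMap_C, paraRat_algebraMap]
  simp [paraPoly]

theorem paraRat_X : paraRat RatFunc.X = -RatFunc.X := by
  rw [← RatFunc.algebraMap_X, paraRat_algebraMap]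
  simp [paraPoly]

theorem RegAt.paraRat {f : RatFunc ℂ} {s : ℂ} (hf : RegAt f (-star s)) :
    RegAt (paraRat f) s ∧ ev (CoherentEq.paraRat f) s = star (ev f (-star s)) := by
  have hne : (paraPoly f.denom).eval s ≠ 0 := by
    rw [eval_paraPoly]; exact star_ne_zero.2 hf
  have hfd : f * algebraMap ℂ[X] (RatFunc ℂ) f.denom = algebraMap ℂ[X] (RatFunc ℂ) f.num := by
    have h0 : algebraMap ℂ[X] (RatFunc ℂ) f.denom ≠ 0 :=
      RatFunc.algebraMap_ne_zero f.denom_ne_zero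
    conv_lhs => rw [← f.num_div_denom]
    rw [RatFunc.num_div_denom, ← eq_div_iff h0, RatFunc.num_div_denom]
  have := regAt_and_ev_of_mul_eq (f := CoherentEq.paraRat f) (p := paraPoly f.num) hne (by
    rw [← paraRat_algebraMap, ← paraRat_algebraMap, ← map_mul, hfd])
  refine ⟨this.1, this.2.trans ?_⟩
  rw [eval_paraPoly, eval_paraPoly, ev, RatFunc.eval, eval₂_id, eval₂_id, star_div₀]

end RationalFunctions

/-! ### Evaluation and para-Hermitian conjugation of transfer matrices -/

section TransferMatrices

variable {ι κ μ ν : Type*}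

theorem not_isPole_iff {F : TF ι κ} {s : ℂ} : ¬ IsPole F s ↔ ∀ i j, RegAt (F i j) s := by
  simp [IsPole, RegAt]

theorem not_isPole_const (M : Matrix ι κ ℂ) (s : ℂ) : ¬ IsPole (const M) s :=
  not_isPole_iff.2 fun _ _ => regAt_C _ _

@[simp] theorem evalTF_const (M : Matrix ι κ ℂ) (s : ℂ) : evalTF (const M) s = M := by
  ext i j; simp [evalTF, const]

theorem not_isPole_add {F G : TF ι κ} {s : ℂ} (hF : ¬ IsPole F s) (hG : ¬ IsPole G s) :
    ¬ IsPole (F + G) s := by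
  rw [not_isPole_iff] at *
  exact fun i j => (hF i j).add (hG i j)

theorem evalTF_add {F G : TF ι κ} {s : ℂ} (hF : ¬ IsPole F s) (hG : ¬ IsPole G s) :
    evalTF (F + G) s = evalTF F s + evalTF G s := by
  rw [not_isPole_iff] at *
  ext i j
  exact ev_add (hF i j) (hG i j)

theorem not_isPole_mul [Fintype κ] {F : TF ι κ} {G : TF κ μ} {s : ℂ} (hF : ¬ IsPole F s)
    (hG : ¬ IsPole G s) : ¬ IsPole (F * G) s := by
  rw [not_isPole_iff] at *
  exact fun i j => (regAt_sum _ fun k _ => (hF i k).mul (hG k j)).1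

theorem evalTF_mul [Fintype κ] {F : TF ι κ} {G : TF κ μ} {s : ℂ} (hF : ¬ IsPole F s)
    (hG : ¬ IsPole G s) : evalTF (F * G) s = evalTF F s * evalTF G s := by
  rw [not_isPole_iff] at *
  ext i j
  refine (regAt_sum _ fun k _ => (hF i k).mul (hG k j)).2.trans ?_
  exact Finset.sum_congr rfl fun k _ => ev_mul (hF i k) (hG k j)

theorem not_isPole_paraConj {F : TF ι κ} {s : ℂ} (hF : ¬ IsPole F (-star s)) :
    ¬ IsPole (paraConj F) s := by
  rw [not_isPole_iff] at *
  exact fun i j => (hF j i).paraRat.1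

theorem evalTF_paraConj {F : TF ι κ} {s : ℂ} (hF : ¬ IsPole F (-star s)) :
    evalTF (paraConj F) s = (evalTF F (-star s))ᴴ := by
  rw [not_isPole_iff] at *
  ext i j
  exact (hF j i).paraRat.2

theorem neg_star_freq (ω : ℝ) : -star ((ω : ℂ) * Complex.I) = ω * Complex.I := by simp

theorem not_isPole_paraConj_freq {F : TF ι κ} {ω : ℝ} (hF : ¬ IsPole F (ω * Complex.I)) :
    ¬ IsPole (paraConj F) (ω * Complex.I) :=
  not_isPole_paraConj (by rwa [neg_star_freq])

theorem freq_paraConj {F : TF ι κ} {ω : ℝ} (hF : ¬ IsPole F (ω * Complex.I)) :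
    freq (paraConj F) ω = (freq F ω)ᴴ := by
  have := evalTF_paraConj (F := F) (s := ω * Complex.I) (by rwa [neg_star_freq])
  rw [neg_star_freq] at this
  exact this

theorem IsStable.not_isPole_freq {F : TF ι κ} (hF : IsStable F) (ω : ℝ) :
    ¬ IsPole F (ω * Complex.I) := by
  obtain ⟨τ, hτ, h⟩ := hF
  exact h _ (by simpa using hτ)

theorem not_isPole_submatrix {F : TF ι κ} {s : ℂ} (hF : ¬ IsPole F s) (e : μ → ι) (e' : ν → κ) :
    ¬ IsPole (F.submatrix e e' : TF μ ν) s := by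
  rw [not_isPole_iff] at *
  exact fun i j => hF _ _

theorem IsStable.submatrix {F : TF ι κ} (hF : IsStable F) (e : μ → ι) (e' : ν → κ) :
    IsStable (F.submatrix e e' : TF μ ν) := by
  obtain ⟨τ, hτ, h⟩ := hF
  exact ⟨τ, hτ, fun s hs => not_isPole_submatrix (h s hs) e e'⟩

theorem not_isPole_fromCols {F : TF ι κ} {G : TF ι μ} {s : ℂ} (hF : ¬ IsPole F s)
    (hG : ¬ IsPole G s) : ¬ IsPole (fromCols F G : TF ι (κ ⊕ μ)) s := by
  rw [not_isPole_iff] at *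
  rintro i (j | j)
  exacts [hF i j, hG i j]

theorem not_isPole_fromRows {F : TF ι κ} {G : TF μ κ} {s : ℂ} (hF : ¬ IsPole F s)
    (hG : ¬ IsPole G s) : ¬ IsPole (fromRows F G : TF (ι ⊕ μ) κ) s := by
  rw [not_isPole_iff] at *
  rintro (i | i) j
  exacts [hF i j, hG i j]

theorem not_isPole_one [DecidableEq ι] (s : ℂ) : ¬ IsPole (1 : TF ι ι) s := by
  have : (1 : TF ι ι) = const 1 := by simp [const]
  rw [this]; exact not_isPole_const _ _

theorem evalTF_one [DecidableEq ι] (s : ℂ) : evalTF (1 : TF ι ι) s = 1 := by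
  have : (1 : TF ι ι) = const 1 := by simp [const]
  rw [this, evalTF_const]

theorem const_mul [Fintype κ] (M : Matrix ι κ ℂ) (N : Matrix κ μ ℂ) :
    const (M * N) = const M * const N := Matrix.map_mul

theorem const_add (M N : Matrix ι κ ℂ) : const (M + N) = const M + const N :=
  Matrix.map_add _ (map_add _) _ _

theorem const_neg (M : Matrix ι κ ℂ) : const (-M) = -const M := by
  ext i j; simp [const]

@[simp] theorem const_one [DecidableEq ι] : const (1 : Matrix ι ι ℂ) = 1 := by simp [const]

@[simp] theorem const_zero : const (0 : Matrix ι κ ℂ) = 0 := by simp [const]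

theorem paraConj_const (M : Matrix ι κ ℂ) : paraConj (const M) = const Mᴴ := by
  ext i j; simp [paraConj, const, paraRat_C]

theorem paraConj_mul [Fintype κ] (F : TF ι κ) (G : TF κ μ) :
    paraConj (F * G) = paraConj G * paraConj F := by
  rw [paraConj, Matrix.map_mul, transpose_mul]; rfl

theorem paraConj_sub (F G : TF ι κ) : paraConj (F - G) = paraConj F - paraConj G := by
  ext i j; simp [paraConj]

theorem paraConj_one [DecidableEq ι] : paraConj (1 : TF ι ι) = 1 := by
  rw [← const_one, paraConj_const]; simp

end TransferMatrices

theorem qf_lyap {σ : Type*} [Fintype σ] {A P : Matrix σ σ ℂ} (hP : P.IsHermitian) {x : σ → ℂ} {s : ℂ}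
    (hx : A *ᵥ x = s • x) : qf (Aᴴ * P + P * A) x = 2 * s.re * qf P x := by
  have h1 : qf (P * A) x = s.re * qf P x := by
    rw [qf, ← mulVec_mulVec, hx, mulVec_smul, dotProduct_smul, IsHermitian.dotProduct_eq_qf hP]
    simp
  have h2 : qf (Aᴴ * P) x = s.re * qf P x := by
    rw [← h1, ← qf_conjTranspose]; simp [hP.eq]
  rw [qf_add, h1, h2]; ring

/-! ### State-space models and Lyapunov stability -/

section StateSpace

variable {ι κ σ : Type*} [Fintype σ] [DecidableEq σ]

/-- The matrix `s I - A` of rational functions. -/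
def pencil (A : Matrix σ σ ℂ) : TF σ σ := (RatFunc.X : RatFunc ℂ) • (1 : TF σ σ) - const A

theorem pencil_eq_map (A : Matrix σ σ ℂ) :
    pencil A = (charmatrix A).map (algebraMap ℂ[X] (RatFunc ℂ)) := by
  ext i j
  by_cases h : i = j
  · subst h; simp [pencil, const, charmatrix_apply_eq]
  · simp [pencil, const, h]

theorem det_pencil (A : Matrix σ σ ℂ) :
    (pencil A).det = algebraMap ℂ[X] (RatFunc ℂ) A.charpoly := by
  rw [pencil_eq_map, ← RingHom.mapMatrix_apply, ← RingHom.map_det]; rfl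

theorem isUnit_det_pencil (A : Matrix σ σ ℂ) : IsUnit (pencil A).det := by
  rw [det_pencil]
  exact (RatFunc.algebraMap_ne_zero (charpoly_monic A).ne_zero).isUnit

theorem not_isPole_pencil (A : Matrix σ σ ℂ) (s : ℂ) : ¬ IsPole (pencil A) s := by
  rw [not_isPole_iff]
  intro i j
  have := regAt_and_ev_of_mul_eq (f := pencil A i j) (q := 1) (p := charmatrix A i j) (s := s)
    (by simp) (by rw [pencil_eq_map]; simp)
  exact this.1

theorem evalTF_pencil (A : Matrix σ σ ℂ) (s : ℂ) : evalTF (pencil A) s = s • 1 - A := by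
  ext i j
  have := regAt_and_ev_of_mul_eq (f := pencil A i j) (q := 1) (p := charmatrix A i j) (s := s)
    (by simp) (by rw [pencil_eq_map]; simp)
  refine this.2.trans ?_
  by_cases h : i = j
  · subst h; simp [charmatrix_apply_eq]
  · simp [h]

/-- By Cramer's rule the entries of the resolvent are adjugate entries over the characteristic
polynomial. -/
theorem not_isPole_pencil_inv {A : Matrix σ σ ℂ} {s : ℂ} (hs : (s • 1 - A).det ≠ 0) :
    ¬ IsPole (pencil A)⁻¹ s := by
  rw [not_isPole_iff]
  intro i j
  have hc : A.charpoly.eval s ≠ 0 := by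
    rw [eval_charpoly, scalar_apply, ← smul_one_eq_diagonal]; exact hs
  refine (regAt_and_ev_of_mul_eq (q := A.charpoly) (p := (charmatrix A).adjugate i j) hc ?_).1
  rw [← det_pencil, Matrix.inv_def, Matrix.smul_apply, smul_eq_mul, mul_right_comm,
    Ring.inverse_mul_cancel _ (isUnit_det_pencil A), one_mul]
  rw [pencil_eq_map, ← RingHom.mapMatrix_apply, ← RingHom.map_adjugate]; rfl

theorem evalTF_pencil_inv {A : Matrix σ σ ℂ} {s : ℂ} (hs : (s • 1 - A).det ≠ 0) :
    evalTF (pencil A)⁻¹ s = (s • 1 - A)⁻¹ := by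
  have h := evalTF_mul (not_isPole_pencil A s) (not_isPole_pencil_inv hs)
  rw [Matrix.mul_nonsing_inv _ (isUnit_det_pencil A), evalTF_one, evalTF_pencil] at h
  exact (inv_eq_right_inv h.symm).symm

/-- The transfer function `C (s I - A)⁻¹ B + D` of a state-space model with an arbitrary finite
index type of states. -/
def transfer (A : Matrix σ σ ℂ) (B : Matrix σ κ ℂ) (C : Matrix ι σ ℂ) (D : Matrix ι κ ℂ) : TF ι κ :=
  const C * (pencil A)⁻¹ * const B + const D

theorem ssTF_eq_transfer {k : ℕ} (A : Matrix (Fin k) (Fin k) ℂ) (B : Matrix (Fin k) κ ℂ)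
    (C : Matrix ι (Fin k) ℂ) (D : Matrix ι κ ℂ) : ssTF A B C D = transfer A B C D := rfl

variable {A : Matrix σ σ ℂ} {B : Matrix σ κ ℂ} {C : Matrix ι σ ℂ} {D : Matrix ι κ ℂ}

theorem not_isPole_transfer {s : ℂ} (hs : (s • 1 - A).det ≠ 0) : ¬ IsPole (transfer A B C D) s :=
  not_isPole_add (not_isPole_mul (not_isPole_mul (not_isPole_const _ _) (not_isPole_pencil_inv hs))
    (not_isPole_const _ _)) (not_isPole_const _ _)

theorem evalTF_transfer {s : ℂ} (hs : (s • 1 - A).det ≠ 0) :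
    evalTF (transfer A B C D) s = C * (s • 1 - A)⁻¹ * B + D := by
  have h1 := not_isPole_pencil_inv hs
  have h2 := not_isPole_mul (not_isPole_const C s) h1
  rw [transfer, evalTF_add (not_isPole_mul h2 (not_isPole_const _ _)) (not_isPole_const _ _),
    evalTF_mul h2 (not_isPole_const _ _), evalTF_mul (not_isPole_const _ _) h1,
    evalTF_pencil_inv hs]
  simp

/-- `A` satisfies a strict Lyapunov inequality. -/
def IsLyapStable (A : Matrix σ σ ℂ) : Prop :=
  ∃ P : Matrix σ σ ℂ, P.PosDef ∧ (-(Aᴴ * P + P * A)).PosDef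

/-- The strict Lyapunov inequality survives the addition of `εP`. Tested on an eigenvector, this
gives `2 Re s < -ε` for each eigenvalue `s`, hence a margin to the imaginary axis. -/
theorem IsLyapStable.exists_det_ne_zero (hA : IsLyapStable A) :
    ∃ τ : ℝ, 0 < τ ∧ ∀ s : ℂ, -τ < s.re → (s • 1 - A).det ≠ 0 := by
  obtain ⟨P, hP, hL⟩ := hA
  obtain ⟨ε, hε, h⟩ := exists_smul_add_posDef hL hP.1.neg
  refine ⟨ε / 2, by positivity, fun s hs hdet => ?_⟩
  obtain ⟨x, hx, hx'⟩ := exists_mulVec_eq_zero_iff.2 hdet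
  have hAx : A *ᵥ x = s • x := by
    rw [sub_mulVec, smul_mulVec, one_mulVec, sub_eq_zero] at hx'
    exact hx'.symm
  have h1 := (h ε hε.le le_rfl).qf_pos hx
  rw [qf_add, qf_neg, qf_lyap hP.1 hAx, qf_smul, qf_neg] at h1
  have := hP.qf_pos hx
  nlinarith

theorem IsLyapStable.det_ne_zero (hA : IsLyapStable A) {s : ℂ} (hs : 0 ≤ s.re) :
    (s • 1 - A).det ≠ 0 := by
  obtain ⟨τ, hτ, h⟩ := hA.exists_det_ne_zero
  exact h s (by linarith)

theorem IsLyapStable.isStable_transfer (hA : IsLyapStable A) : IsStable (transfer A B C D) := by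
  obtain ⟨τ, hτ, h⟩ := hA.exists_det_ne_zero
  exact ⟨τ, hτ, fun s hs => not_isPole_transfer (h s hs)⟩

theorem IsLyapStable.freq_transfer (hA : IsLyapStable A) (ω : ℝ) :
    freq (transfer A B C D) ω = C * (((ω : ℂ) * Complex.I) • 1 - A)⁻¹ * B + D :=
  evalTF_transfer (hA.det_ne_zero (by simp))

end StateSpace

/-! ### Behaviour at infinity and properness -/

section Limits

open Filter Bornology

variable {ι κ σ : Type*} [Fintype σ] [DecidableEq σ]

theorem tendsto_mul_I_cobounded :
    Tendsto (fun ω : ℝ => (ω : ℂ) * Complex.I) (atBot ⊔ atTop) (cobounded ℂ) := by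
  rw [← tendsto_norm_atTop_iff_cobounded]
  simp only [norm_mul, Complex.norm_real, Complex.norm_I, mul_one, Real.norm_eq_abs]
  exact tendsto_sup.2 ⟨tendsto_abs_atBot_atTop, tendsto_abs_atTop_atTop⟩

open scoped Matrix.Norms.Operator in
theorem tendsto_resolvent_matrix (A : Matrix σ σ ℂ) :
    Tendsto (fun s : ℂ => (s • 1 - A)⁻¹) (cobounded ℂ) (𝓝 0) := by
  have h := spectrum.resolvent_tendsto_cobounded (𝕜 := ℂ) A
  refine h.congr fun s => ?_
  rw [resolvent, ← Matrix.nonsing_inv_eq_ringInverse, Algebra.algebraMap_eq_smul_one]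

theorem tendsto_freq_transfer {A : Matrix σ σ ℂ} {B : Matrix σ κ ℂ} {C : Matrix ι σ ℂ}
    {D : Matrix ι κ ℂ} (hA : IsLyapStable A) :
    Tendsto (freq (transfer A B C D)) (atBot ⊔ atTop) (𝓝 D) := by
  have h1 := (tendsto_resolvent_matrix A).comp tendsto_mul_I_cobounded
  have hc : Continuous fun R : Matrix σ σ ℂ => C * R * B + D := by fun_prop
  have h2 := (hc.tendsto 0).comp h1
  simp only [Matrix.mul_zero, Matrix.zero_mul, zero_add] at h2
  exact h2.congr fun ω => (hA.freq_transfer ω).symm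

/-- The quotient is the reversed polynomial at `1/z`, whose value at 0 is the leading coefficient.
-/
theorem tendsto_eval_div_pow_natDegree (p : ℂ[X]) :
    Tendsto (fun z => p.eval z / z ^ p.natDegree) (cobounded ℂ) (𝓝 p.leadingCoeff) := by
  have h1 : Tendsto (fun z : ℂ => p.reverse.eval z⁻¹) (cobounded ℂ) (𝓝 (p.reverse.eval 0)) :=
    (p.reverse.continuous.tendsto 0).comp tendsto_inv₀_cobounded
  rw [← coeff_zero_eq_eval_zero, coeff_zero_reverse] at h1
  refine h1.congr' ?_
  filter_upwards [eventually_ne_cobounded (0 : ℂ)] with z hz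
  let _ := invertibleOfNonzero hz
  have := eval₂_reverse_mul_pow (RingHom.id ℂ) z p
  rw [eval₂_id, eval₂_id, invOf_eq_inv] at this
  rw [← this, mul_div_cancel_right₀ _ (pow_ne_zero _ hz)]

/-- If the numerator degree exceeded the denominator degree by `k + 1`, then `f(z) z^{-(k+1)}` would
tend to the nonzero ratio of leading coefficients, and to 0 by boundedness. One path to infinity
suffices, so this covers both frequency responses and `H_∞` functions. -/
theorem natDegree_le_of_eventually_bounded {f : RatFunc ℂ} {α : Type*} {l : Filter α} [NeBot l]
    {g : α → ℂ} (hg : Tendsto g l (cobounded ℂ)) {M : ℝ} (hM : ∀ᶠ a in l, ‖ev f (g a)‖ ≤ M) :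
    f.num.natDegree ≤ f.denom.natDegree := by
  by_contra! hlt
  obtain ⟨k, hk⟩ := Nat.exists_eq_add_of_lt hlt
  have hlim := (tendsto_eval_div_pow_natDegree f.num).div (tendsto_eval_div_pow_natDegree f.denom)
    (by simpa using f.denom_ne_zero)
  have hlim' := hlim.comp hg
  have hz : Tendsto (fun a => ev f (g a) * ((g a)⁻¹) ^ (k + 1)) l (𝓝 0) := by
    have h0 : Tendsto (fun a => ((g a)⁻¹) ^ (k + 1)) l (𝓝 0) := by
      simpa using (tendsto_inv₀_cobounded.comp hg).pow (k + 1)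
    exact isBoundedUnder_le_mul_tendsto_zero ⟨M, by simpa using hM⟩ h0
  have heq : (fun a => ev f (g a) * ((g a)⁻¹) ^ (k + 1)) =ᶠ[l]
      ((fun z => f.num.eval z / z ^ f.num.natDegree) / (fun z => f.denom.eval z / z ^ f.denom.natDegree))
        ∘ g := by
    filter_upwards [hg.eventually (eventually_ne_cobounded (0 : ℂ))] with a ha
    simp only [Function.comp, Pi.div_apply, ev, RatFunc.eval, eval₂_id, hk]
    by_cases hd : eval (g a) f.denom = 0
    · simp [hd]
    · rw [inv_pow]
      field_simp
      ring
  have := tendsto_nhds_unique (hlim'.congr' heq.symm) hz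
  have h0 : f.num.leadingCoeff ≠ 0 := by
    rw [Ne, leadingCoeff_eq_zero]
    intro h0
    rw [h0] at hlt
    simp at hlt
  rw [div_eq_zero_iff] at this
  exact this.elim h0 (by simpa using f.denom_ne_zero)

theorem IsLyapStable.isProper_transfer {A : Matrix σ σ ℂ} {B : Matrix σ κ ℂ} {C : Matrix ι σ ℂ}
    {D : Matrix ι κ ℂ} (hA : IsLyapStable A) : IsProper (transfer A B C D) := by
  intro i j
  have h : Tendsto (fun ω : ℝ => freq (transfer A B C D) ω i j) (atBot ⊔ atTop) (𝓝 (D i j)) :=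
    ((continuous_id.matrix_elem i j).tendsto D).comp (tendsto_freq_transfer hA)
  obtain ⟨M, hM⟩ := h.norm.isBoundedUnder_le
  exact natDegree_le_of_eventually_bounded tendsto_mul_I_cobounded (M := M) (Filter.eventually_map.1 hM)

end Limits

/-! ### Stable realizations of proper stable rational matrices -/

section Realization

variable {ι κ μ σ τ : Type*} [Fintype σ] [DecidableEq σ] [Fintype τ] [DecidableEq τ]

/-- Any solution of `(sI - A) Z = B` identifies the transfer function, so composite systems need no
inverse of a block matrix. -/
theorem transfer_eq_of_pencil_mul {A : Matrix σ σ ℂ} {B : Matrix σ κ ℂ} {C : Matrix ι σ ℂ}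
    {D : Matrix ι κ ℂ} {Z : TF σ κ} (h : pencil A * Z = const B) :
    transfer A B C D = const C * Z + const D := by
  rw [transfer, ← h, Matrix.mul_assoc, nonsing_inv_mul_cancel_left _ _ (isUnit_det_pencil A)]

theorem pencil_mul_inv_mul (A : Matrix σ σ ℂ) (Z : TF σ κ) :
    pencil A * ((pencil A)⁻¹ * Z) = Z :=
  mul_nonsing_inv_cancel_left _ _ (isUnit_det_pencil A)

theorem const_fromBlocks {ι' κ' : Type*} (A : Matrix ι κ ℂ) (B : Matrix ι κ' ℂ) (C : Matrix ι' κ ℂ)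
    (D : Matrix ι' κ' ℂ) :
    const (fromBlocks A B C D) = fromBlocks (const A) (const B) (const C) (const D) :=
  fromBlocks_map _ _ _ _ _

theorem const_fromRows (A : Matrix ι κ ℂ) (B : Matrix μ κ ℂ) :
    const (fromRows A B) = fromRows (const A) (const B) := by
  ext (i | i) j <;> rfl

theorem const_fromCols (A : Matrix ι κ ℂ) (B : Matrix ι μ ℂ) :
    const (fromCols A B) = fromCols (const A) (const B) := by
  ext i (j | j) <;> rfl

theorem fromBlocks_sub {α m n l o : Type*} [AddGroup α] (A A' : Matrix m n α) (B B' : Matrix m o α)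
    (C C' : Matrix l n α) (D D' : Matrix l o α) :
    fromBlocks A B C D - fromBlocks A' B' C' D' =
      fromBlocks (A - A') (B - B') (C - C') (D - D') := by
  ext (i | i) (j | j) <;> rfl

theorem pencil_fromBlocks {σ τ : Type*} [DecidableEq σ] [DecidableEq τ] (A : Matrix σ σ ℂ)
    (R : Matrix σ τ ℂ) (A' : Matrix τ τ ℂ) :
    pencil (fromBlocks A R 0 A') = fromBlocks (pencil A) (-const R) 0 (pencil A') := by
  rw [pencil, const_fromBlocks, ← fromBlocks_one, fromBlocks_smul, fromBlocks_sub]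
  simp [pencil]

/-- The Lyapunov matrix is `diag(P, rP')`. By Finsler's lemma a large `r` dominates the coupling
`R`, since the rest of the form is already negative where the second component vanishes. -/
theorem IsLyapStable.fromBlocks {σ τ : Type*} [Fintype σ] [Fintype τ] [DecidableEq τ]
    {A : Matrix σ σ ℂ} {A' : Matrix τ τ ℂ} (hA : IsLyapStable A) (hA' : IsLyapStable A') (R : Matrix σ τ ℂ) : IsLyapStable (fromBlocks A R 0 A') := by
  obtain ⟨P, hP, hL⟩ := hA
  obtain ⟨P', hP', hL'⟩ := hA'
  obtain ⟨T, hT⟩ := exists_eq_conjTranspose_mul_self hL'.posSemidef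
  let S : Matrix (σ ⊕ τ) (σ ⊕ τ) ℂ :=
    Matrix.fromBlocks (Aᴴ * P + P * A) (P * R) (Rᴴ * P) 0
  have hS : S.IsHermitian := by
    rw [IsHermitian, fromBlocks_conjTranspose]
    simp [hP.1.eq, S, add_comm]
  obtain ⟨r, hr, hr'⟩ := exists_sub_smul_gram_neg (fromCols (0 : Matrix τ σ ℂ) T) hS (by
    intro x hx hTx
    obtain ⟨y, z, rfl⟩ : ∃ y z, x = Sum.elim y z := ⟨_, _, (Sum.elim_comp_inl_inr x).symm⟩
    rw [fromCols_mulVec_sumElim, zero_mulVec, zero_add] at hTx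
    have hz : z = 0 := by
      by_contra hz
      have := hL'.qf_pos hz
      rw [hT, qf_gram, hTx] at this
      simp at this
    subst hz
    have hy : y ≠ 0 := by
      rintro rfl
      exact hx (by ext (i | i) <;> rfl)
    have h1 := hL.qf_pos hy
    have : qf S (Sum.elim y 0) = qf (Aᴴ * P + P * A) y := by
      simp [qf, S, fromBlocks_mulVec, dotProduct, Fintype.sum_sum_type]
    rw [this]
    rw [qf_neg] at h1
    linarith)
  refine ⟨Matrix.fromBlocks P 0 0 ((r : ℂ) • P'), ?_, ?_⟩
  · refine posDef_iff_qf.2 ⟨?_, ?_⟩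
    · rw [IsHermitian, fromBlocks_conjTranspose]
      simp [hP.1.eq, hP'.1.eq]
    · intro x hx
      obtain ⟨y, z, rfl⟩ : ∃ y z, x = Sum.elim y z := ⟨_, _, (Sum.elim_comp_inl_inr x).symm⟩
      have h1 : qf (Matrix.fromBlocks P 0 0 ((r : ℂ) • P')) (Sum.elim y z) = qf P y + r * qf P' z := by
        rw [← qf_smul]
        simp [qf, fromBlocks_mulVec, dotProduct, Fintype.sum_sum_type]
      rw [h1]
      have h2 := hP.posSemidef.qf_nonneg y
      have h3 := hP'.posSemidef.qf_nonneg z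
      by_cases hy : y = 0
      · have hz : z ≠ 0 := by
          rintro rfl; subst hy
          exact hx (by ext (i | i) <;> rfl)
        have := mul_pos hr (hP'.qf_pos hz)
        linarith
      · have := hP.qf_pos hy
        have := mul_nonneg hr.le h3
        linarith
  · convert hr' using 1
    rw [conjTranspose_fromCols_eq_fromRows_conjTranspose, fromRows_mul_fromCols, ← hT,
      fromBlocks_conjTranspose, fromBlocks_multiply, fromBlocks_multiply, fromBlocks_smul, fromBlocks_sub,
      fromBlocks_add, fromBlocks_neg]
    simp [smul_add]

/-- `F` has a state-space realization whose state matrix satisfies a strict Lyapunov inequality. -/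
def IsRealizable (F : TF ι κ) : Prop :=
  ∃ (σ : Type) (_ : Fintype σ) (_ : DecidableEq σ) (A : Matrix σ σ ℂ) (B : Matrix σ κ ℂ)
    (C : Matrix ι σ ℂ) (D : Matrix ι κ ℂ), IsLyapStable A ∧ F = transfer A B C D

theorem isRealizable_const (M : Matrix ι κ ℂ) : IsRealizable (const M) := by
  refine ⟨Empty, inferInstance, inferInstance, 0, 0, 0, M, ⟨1, PosDef.one, ?_⟩, by simp [transfer]⟩
  exact posDef_iff_qf.2 ⟨by simp [IsHermitian], fun x hx => (hx (Subsingleton.elim _ _)).elim⟩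

theorem IsRealizable.add {F G : TF ι κ} (hF : IsRealizable F) (hG : IsRealizable G) :
    IsRealizable (F + G) := by
  obtain ⟨σ, _, _, A, B, C, D, hA, rfl⟩ := hF
  obtain ⟨τ, _, _, A', B', C', D', hA', rfl⟩ := hG
  refine ⟨σ ⊕ τ, inferInstance, inferInstance, fromBlocks A 0 0 A', fromRows B B', fromCols C C',
    D + D', hA.fromBlocks hA' 0, ?_⟩
  rw [transfer_eq_of_pencil_mul (Z := fromRows ((pencil A)⁻¹ * const B) ((pencil A')⁻¹ * const B'))]
  · rw [const_fromCols, fromCols_mul_fromRows, const_add, transfer, transfer]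
    simp only [Matrix.mul_assoc]
    abel
  · rw [pencil_fromBlocks, fromBlocks_mul_fromRows, pencil_mul_inv_mul, pencil_mul_inv_mul,
      const_fromRows]
    simp

theorem IsRealizable.mul [Fintype κ] {F : TF ι κ} {G : TF κ μ} (hF : IsRealizable F)
    (hG : IsRealizable G) : IsRealizable (F * G) := by
  obtain ⟨σ, _, _, A, B, C, D, hA, rfl⟩ := hF
  obtain ⟨τ, _, _, A', B', C', D', hA', rfl⟩ := hG
  refine ⟨σ ⊕ τ, inferInstance, inferInstance, fromBlocks A (B * C') 0 A', fromRows (B * D') B',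
    fromCols C (D * C'), D * D', hA.fromBlocks hA' _, ?_⟩
  have hT : const C' * ((pencil A')⁻¹ * const B') + const D' = transfer A' B' C' D' := by
    rw [transfer, Matrix.mul_assoc]
  rw [transfer_eq_of_pencil_mul (Z := fromRows ((pencil A)⁻¹ * (const B * transfer A' B' C' D'))
    ((pencil A')⁻¹ * const B'))]
  · rw [const_fromCols, fromCols_mul_fromRows, const_mul, const_mul, transfer, Matrix.add_mul, add_assoc]
    conv_lhs => rw [← hT]
    conv_rhs => rw [← hT]
    simp only [Matrix.mul_assoc, Matrix.mul_add]
  · rw [pencil_fromBlocks, fromBlocks_mul_fromRows, pencil_mul_inv_mul, pencil_mul_inv_mul,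
      const_fromRows, const_mul, const_mul, ← hT]
    congr 1
    · simp only [Matrix.mul_assoc, Matrix.mul_add, Matrix.neg_mul]
      abel
    · simp

/-- A rational function viewed as a `1 × 1` transfer matrix. -/
def scalarTF (f : RatFunc ℂ) : TF Unit Unit := of fun _ _ => f

theorem isRealizable_scalarTF_inv {a : ℂ} (ha : a.re < 0) :
    IsRealizable (scalarTF (RatFunc.X - RatFunc.C a)⁻¹) := by
  refine ⟨Unit, inferInstance, inferInstance, of fun _ _ => a, 1, 1, 0, ⟨1, PosDef.one, ?_⟩, ?_⟩
  · refine posDef_iff_qf.2 ⟨?_, fun x hx => ?_⟩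
    · ext i j; simp [add_comm]
    · have hax : (of fun _ _ => a : Matrix Unit Unit ℂ) *ᵥ x = a • x := by
        ext i; simp [mulVec, dotProduct]
      rw [qf_neg, qf_lyap isHermitian_one hax]
      have := qf_one_pos hx
      nlinarith
  · have h0 : (RatFunc.X - RatFunc.C a : RatFunc ℂ) ≠ 0 := by
      rw [← RatFunc.algebraMap_X, ← RatFunc.algebraMap_C, ← map_sub]
      exact RatFunc.algebraMap_ne_zero (X_sub_C_ne_zero a)
    rw [transfer_eq_of_pencil_mul (Z := scalarTF (RatFunc.X - RatFunc.C a)⁻¹)]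
    · simp
    · ext i j
      simp [pencil, scalarTF, const, mul_apply, h0]

/-- Splitting off a root `a` of the denominator writes `p/d` as `c + (p₁/d') · 1/(s - a)`: a cascade
of first-order stable systems with feedthroughs. -/
theorem isRealizable_scalarTF_div (n : ℕ) : ∀ d p : ℂ[X], d.Monic → d.natDegree = n →
    (∀ a, d.eval a = 0 → a.re < 0) → p.natDegree ≤ n →
    IsRealizable (scalarTF (algebraMap ℂ[X] (RatFunc ℂ) p / algebraMap ℂ[X] (RatFunc ℂ) d)) := by
  induction n with
  | zero =>
    intro d p hd hdn _ hp
    rw [eq_one_of_monic_natDegree_zero hd hdn, eq_C_of_natDegree_le_zero hp]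
    convert isRealizable_const (of fun _ _ : Unit => p.coeff 0)
    ext i j
    simp [scalarTF, const]
  | succ n ih =>
    intro d p hd hdn hroot hp
    obtain ⟨a, ha⟩ := IsAlgClosed.exists_root d (by
      rw [degree_eq_natDegree hd.ne_zero, hdn]
      exact_mod_cast Nat.succ_ne_zero n)
    obtain ⟨d', rfl⟩ := dvd_iff_isRoot.2 ha
    have hd' : d'.Monic := (monic_X_sub_C a).of_mul_monic_left hd
    have hdn' : d'.natDegree = n := by
      rw [(monic_X_sub_C a).natDegree_mul hd', natDegree_X_sub_C] at hdn
      omega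
    set c := p.coeff (n + 1) with hc
    set p₁ := p - C c * ((X - C a) * d') with hp₁
    -- Since `d` is monic of degree `n + 1`, subtracting `c d` removes the coefficient of degree `n
    -- + 1`.
    have hp₁n : p₁.natDegree ≤ n := by
      rw [natDegree_le_iff_coeff_eq_zero]
      intro k hk
      have hle : p₁.natDegree ≤ n + 1 :=
        (natDegree_sub_le _ _).trans (max_le hp ((natDegree_C_mul_le _ _).trans hdn.le))
      rcases Nat.lt_or_ge (n + 1) k with h | h
      · exact coeff_eq_zero_of_natDegree_lt (hle.trans_lt h)
      · have : k = n + 1 := by omega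
        subst this
        have h1 : ((X - C a) * d').coeff (n + 1) = 1 := by
          have := hd.coeff_natDegree
          rwa [hdn] at this
        rw [hp₁, coeff_sub, coeff_C_mul, h1, hc]; ring
    have hr := ih d' p₁ hd' hdn' (fun b hb => hroot b (by simp [hb])) hp₁n
    have hra := isRealizable_scalarTF_inv (hroot a ha)
    have hsum := (isRealizable_const (of fun _ _ : Unit => c)).add (hr.mul hra)
    convert hsum using 1
    ext i j
    have h0 : (RatFunc.X - RatFunc.C a : RatFunc ℂ) ≠ 0 := by
      rw [← RatFunc.algebraMap_X, ← RatFunc.algebraMap_C, ← map_sub]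
      exact RatFunc.algebraMap_ne_zero (X_sub_C_ne_zero a)
    have h1 : algebraMap ℂ[X] (RatFunc ℂ) d' ≠ 0 := RatFunc.algebraMap_ne_zero hd'.ne_zero
    simp only [scalarTF, const, of_apply, Matrix.add_apply, mul_apply, map_apply, map_mul, map_sub,
      hp₁, RatFunc.algebraMap_X, RatFunc.algebraMap_C, Finset.univ_unique, Finset.sum_singleton]
    field_simp
    ring

theorem isRealizable_sum {α : Type*} (t : Finset α) {F : α → TF ι κ}
    (h : ∀ i ∈ t, IsRealizable (F i)) : IsRealizable (∑ i ∈ t, F i) := by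
  classical
  induction t using Finset.induction_on with
  | empty => simpa using isRealizable_const (0 : Matrix ι κ ℂ)
  | insert a t ha ih =>
    rw [Finset.sum_insert ha]
    exact (h a (Finset.mem_insert_self a t)).add (ih fun i hi => h i (Finset.mem_insert_of_mem hi))

/-- Every proper stable rational matrix function has a stable state-space realization. -/
theorem isRealizable_of_isProper_of_isStable [Fintype ι] [DecidableEq ι] [Fintype κ] [DecidableEq κ]
    {F : TF ι κ} (hp : IsProper F) (hs : IsStable F) : IsRealizable F := by
  obtain ⟨τ, hτ, h⟩ := hs
  have hij : ∀ i j, IsRealizable (scalarTF (F i j)) := by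
    intro i j
    rw [← RatFunc.num_div_denom (F i j)]
    refine isRealizable_scalarTF_div _ _ _ (RatFunc.monic_denom _) rfl (fun a ha => ?_) (hp i j)
    by_contra hre
    push Not at hre
    exact h a (by linarith) ⟨i, j, ha⟩
  have hF : F = ∑ i, ∑ j, const (of fun k (_ : Unit) => if k = i then 1 else 0) *
      (scalarTF (F i j) * const (of fun (_ : Unit) k => if k = j then 1 else 0)) := by
    ext k l
    simp [Matrix.sum_apply, mul_apply, scalarTF, const]
  rw [hF]
  exact isRealizable_sum _ fun i _ => isRealizable_sum _ fun j _ =>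
    (isRealizable_const _).mul ((hij i j).mul (isRealizable_const _))

end Realization

/-! ### Tools for the lossless embedding -/

section Embedding

/-- Expanding `|u - M^†M u|² ≥ 0` gives `|u|² ≥ 2|M u|² - |M^†M u|²`, and the hypothesis at `M u`
bounds the last term strictly by `|M u|²`. -/
theorem contraction_of_posDef {ι κ : Type*} [Fintype ι] [Fintype κ] [DecidableEq ι] [DecidableEq κ]
    {M : Matrix ι κ ℂ} (h : (1 - M * Mᴴ).PosDef) {u : κ → ℂ} (hu : u ≠ 0) :
    qf (Mᴴ * M) u < qf 1 u := by
  by_cases hy : M *ᵥ u = 0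
  · rw [qf_gram, hy]
    simpa using qf_one_pos hu
  · have h1 := h.qf_pos hy
    have h2 : 0 ≤ qf 1 (u + -(Mᴴ *ᵥ (M *ᵥ u))) := PosSemidef.one.qf_nonneg _
    rw [qf_vec_add isHermitian_one, one_mulVec, mulVec_mulVec, dotProduct_neg, Complex.neg_re] at h2
    have h3 : qf 1 (-((Mᴴ * M) *ᵥ u)) = qf (M * Mᴴ) (M *ᵥ u) := by
      have := qf_gram Mᴴ (M *ᵥ u)
      rw [conjTranspose_conjTranspose, mulVec_mulVec] at this
      rw [this]
      simp [qf]
    have h4 : (star u ⬝ᵥ (Mᴴ * M) *ᵥ u).re = qf (Mᴴ * M) u := rfl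
    have h5 : qf 1 (M *ᵥ u) = qf (Mᴴ * M) u := by
      rw [qf_gram]; simp [qf]
    rw [qf_sub, h5] at h1
    rw [h3, h4] at h2
    linarith

/-- Otherwise the minimum `-t` of the ratio of the forms of `P` and `P₀` is nonpositive, and `Q = P
+ tP₀` is positive semidefinite and annihilates a minimizer `x`. The Lyapunov form of `Q` then
vanishes at `x`, although it is strictly negative as a sum of those of `P` and `tP₀`. -/
theorem posDef_of_lyap {σ : Type*} [Fintype σ] [DecidableEq σ] {A P : Matrix σ σ ℂ}
    (hA : IsLyapStable A) (hP : P.IsHermitian) (hL : (-(Aᴴ * P + P * A)).PosDef) : P.PosDef := by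
  obtain ⟨P₀, hP₀, hL₀⟩ := hA
  refine posDef_iff_qf.2 ⟨hP, ?_⟩
  by_contra! hneg
  obtain ⟨x₀, hx₀, hx₀'⟩ := hneg
  have hc : IsCompact (Metric.sphere (0 : σ → ℂ) 1) := isCompact_sphere _ _
  have hcont : ∀ N : Matrix σ σ ℂ, Continuous fun x => qf N x := fun N =>
    continuous_qf.comp (by fun_prop : Continuous fun x : σ → ℂ => (N, x))
  have hne : ∀ x ∈ Metric.sphere (0 : σ → ℂ) 1, x ≠ 0 := by
    rintro x hx rfl; simp at hx
  have hnorm : ∀ x : σ → ℂ, x ≠ 0 → (((‖x‖⁻¹ : ℝ) : ℂ) • x) ∈ Metric.sphere (0 : σ → ℂ) 1 := by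
    intro x hx
    have hn : 0 < ‖x‖ := norm_pos_iff.2 hx
    rw [mem_sphere_zero_iff_norm, norm_smul, Complex.norm_real, Real.norm_eq_abs,
      abs_of_pos (by positivity), inv_mul_cancel₀ hn.ne']
  obtain ⟨x, hx, hmin⟩ := hc.exists_isMinOn ⟨_, hnorm x₀ hx₀⟩
    (f := fun x => qf P x / qf P₀ x) ((hcont P).continuousOn.div (hcont P₀).continuousOn
      fun x hx => (hP₀.qf_pos (hne x hx)).ne')
  have hx0 := hne x hx
  have hall : ∀ y, y ≠ 0 → qf P x / qf P₀ x ≤ qf P y / qf P₀ y := by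
    intro y hy
    have := isMinOn_iff.1 hmin _ (hnorm y hy)
    simp only [qf_vec_smul] at this
    rwa [mul_div_mul_left _ _ (by have := norm_pos_iff.2 hy; positivity)] at this
  set t := -(qf P x / qf P₀ x) with ht
  have ht0 : 0 ≤ t := by
    have h1 := hall x₀ hx₀
    have h2 : qf P x₀ / qf P₀ x₀ ≤ 0 := div_nonpos_of_nonpos_of_nonneg hx₀' (hP₀.qf_pos hx₀).le
    linarith
  set Q := P + (t : ℂ) • P₀ with hQ
  have hQH : Q.IsHermitian := hP.add (by simp [IsHermitian, conjTranspose_smul, hP₀.1.eq])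
  have hQP : Q.PosSemidef := by
    refine posSemidef_iff_qf.2 ⟨hQH, fun y => ?_⟩
    by_cases hy : y = 0
    · rw [hy, qf_zero_vec]
    · have h1 := hall y hy
      have h2 := hP₀.qf_pos hy
      rw [le_div_iff₀ h2] at h1
      rw [hQ, qf_add, qf_smul, ht]
      linarith
  have hQx : qf Q x = 0 := by
    rw [hQ, qf_add, qf_smul, ht]
    field_simp [(hP₀.qf_pos hx0).ne']
    ring
  have hQx' : Q *ᵥ x = 0 := by
    rw [← hQP.dotProduct_mulVec_zero_iff, IsHermitian.dotProduct_eq_qf hQH, hQx]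
    simp
  have h1 : qf (Q * A) x = 0 := by
    rw [qf, dotProduct_mulVec, ← vecMul_vecMul]
    have : star x ᵥ* Q = 0 := by
      have := congrArg star hQx'
      rwa [star_mulVec, hQH.eq, star_zero] at this
    rw [this]; simp
  have h2 : qf (Aᴴ * Q) x = 0 := by
    rw [← h1, ← qf_conjTranspose]; simp [hQH.eq]
  have h3 : qf (-(Aᴴ * Q + Q * A)) x = 0 := by
    rw [qf_neg, qf_add, h1, h2]; simp
  have h4 : -(Aᴴ * Q + Q * A) = -(Aᴴ * P + P * A) + (t : ℂ) • -(Aᴴ * P₀ + P₀ * A) := by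
    simp only [hQ, Matrix.mul_add, Matrix.add_mul, Matrix.mul_smul, Matrix.smul_mul, smul_neg,
      smul_add]
    abel
  rw [h4, qf_add, qf_smul] at h3
  have h5 := hL.qf_pos hx0
  have h6 := mul_nonneg ht0 (hL₀.qf_pos hx0).le
  linarith

theorem exists_unitary_extension {ρ κ μ : Type*} [Fintype ρ] [Fintype κ] [Fintype μ] [DecidableEq ρ]
    [DecidableEq κ] [DecidableEq μ] (hcard : Fintype.card ρ = Fintype.card κ + Fintype.card μ)
    {V : Matrix ρ κ ℂ} (hV : Vᴴ * V = 1) :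
    ∃ V' : Matrix ρ μ ℂ, (fromCols V V')ᴴ * fromCols V V' = 1 := by
  let v : κ ⊕ μ → EuclideanSpace ℂ ρ := Sum.elim (fun j => WithLp.toLp 2 (V.col j)) 0
  have hv : Orthonormal ℂ ((Set.range (Sum.inl : κ → κ ⊕ μ)).domRestrict v) := by
    rw [orthonormal_iff_ite]
    rintro ⟨i', hi'⟩ ⟨j', hj'⟩
    obtain ⟨i, rfl⟩ := hi'
    obtain ⟨j, rfl⟩ := hj'
    have := congrFun (congrFun hV i) j
    rw [Matrix.one_apply] at this
    have hiff : ((⟨Sum.inl i, Set.mem_range_self i⟩ : Set.range (Sum.inl : κ → κ ⊕ μ)) = ⟨Sum.inl j, Set.mem_range_self j⟩) ↔ i = j :=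
      Subtype.ext_iff.trans Sum.inl_injective.eq_iff
    rw [if_congr hiff rfl rfl, ← this, Set.domRestrict_apply, Set.domRestrict_apply,
      EuclideanSpace.inner_eq_star_dotProduct, dotProduct_comm]
    rfl
  obtain ⟨b, hb⟩ := hv.exists_orthonormalBasis_extension_of_card_eq (by simp [hcard])
  refine ⟨of fun i j => b (Sum.inr j) i, ?_⟩
  have hU : fromCols V (of fun i j => b (Sum.inr j) i) = of fun i j => b j i := by
    ext i (j | j)
    · have := hb (Sum.inl j) ⟨j, rfl⟩
      simp [this, v]
    · rfl
  rw [hU]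
  ext i j
  have := orthonormal_iff_ite.1 b.orthonormal i j
  rw [EuclideanSpace.inner_eq_star_dotProduct, dotProduct_comm] at this
  rw [Matrix.one_apply, ← this]
  rfl

/-- Stated over a commutative ring to serve twice: over rational functions the middle factor
vanishes identically, while over `ℂ` at a point `s` it equals `2 Re(s) P`. -/
theorem lossless_identity {S : Type*} [CommRing S] {σ ρ : Type*} [Fintype σ] [DecidableEq σ]
    [Fintype ρ] [DecidableEq ρ] {P P' X R Xh Rh : Matrix σ σ S} (C : Matrix ρ σ S)
    (Ch : Matrix σ ρ S) (hP : P' * P = 1) (hR : X * R = 1) (hRh : Rh * Xh = 1) :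
    (1 - C * P' * Rh * Ch) * (1 - C * R * P' * Ch) =
      1 - C * P' * Rh * (P * X + Xh * P - Ch * C) * R * P' * Ch := by
  have hP' : P * P' = 1 := mul_eq_one_comm.1 hP
  have h1 : C * P' * Rh * (P * X) * R * P' * Ch = C * P' * Rh * Ch := by
    calc _ = C * P' * Rh * (P * (X * R) * P') * Ch := by simp only [Matrix.mul_assoc]
      _ = _ := by rw [hR, Matrix.mul_one, hP', Matrix.mul_one]
  have h2 : C * P' * Rh * (Xh * P) * R * P' * Ch = C * R * P' * Ch := by
    calc _ = C * (P' * (Rh * Xh) * P) * R * P' * Ch := by simp only [Matrix.mul_assoc]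
      _ = _ := by rw [hRh, Matrix.mul_one, hP, Matrix.mul_one]
  rw [Matrix.mul_sub (C * P' * Rh), Matrix.mul_add, Matrix.sub_mul (_ + _) _ R,
    Matrix.sub_mul (_ * R) _ P', Matrix.sub_mul (_ * P') _ Ch, Matrix.add_mul _ _ R,
    Matrix.add_mul _ _ P', Matrix.add_mul _ _ Ch, h1, h2]
  simp only [Matrix.mul_sub, Matrix.sub_mul, Matrix.one_mul, Matrix.mul_one, Matrix.mul_assoc]
  abel

end Embedding

/-! ### Bounded real lemma and completion to a paraunitary function -/

section LosslessCompletion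

variable {ι κ ρ σ : Type*} [Fintype ι] [DecidableEq ι] [Fintype κ] [DecidableEq κ] [Fintype ρ]
  [DecidableEq ρ] [Fintype σ] [DecidableEq σ]

/-- The strict bounded real lemma. -/
theorem exists_bounded_real {A : Matrix σ σ ℂ} {B : Matrix σ κ ℂ} {C : Matrix ι σ ℂ}
    {D : Matrix ι κ ℂ} (hA : IsLyapStable A)
    (h : ∀ ω : ℝ, (1 - freq (transfer A B C D) ω * (freq (transfer A B C D) ω)ᴴ).PosDef)
    (hD : (1 - D * Dᴴ).PosDef) :
    ∃ P : Matrix σ σ ℂ, P.PosDef ∧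
      (fromBlocks (-(Aᴴ * P + P * A) - Cᴴ * C) (-(P * B) - Cᴴ * D) (-(Bᴴ * P) - Dᴴ * C)
        (1 - Dᴴ * D)).PosDef := by
  let M : Matrix (σ ⊕ κ) (σ ⊕ κ) ℂ := (fromCols C D)ᴴ * fromCols C D - fromBlocks 0 0 0 1
  have hM : M.IsHermitian := by
    refine (isHermitian_conjTranspose_mul_self _).sub ?_
    rw [IsHermitian, fromBlocks_conjTranspose]; simp
  have hMq : ∀ x u, qf M (Sum.elim x u) = qf 1 (C *ᵥ x + D *ᵥ u) - qf 1 u := by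
    intro x u
    rw [qf_sub, qf_gram, fromCols_mulVec_sumElim]
    congr 1
    · simp [qf]
    · simp [qf, fromBlocks_mulVec, dotProduct, Fintype.sum_sum_type]
  obtain ⟨P, hP, hN⟩ := exists_kyp hM (fromCols A B) (fromCols (1 : Matrix σ σ ℂ) 0) (by
    intro w hw hw'
    obtain ⟨x, u, rfl⟩ : ∃ x u, w = Sum.elim x u := ⟨_, _, (Sum.elim_comp_inl_inr w).symm⟩
    rw [fromCols_mulVec_sumElim, fromCols_mulVec_sumElim, one_mulVec, zero_mulVec, add_zero] at hw'
    rw [hMq, sub_neg]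
    -- A zero state is the case of infinite frequency, governed by `D`. Otherwise the state is `(iωI
    -- - A)⁻¹ B u` and the output is the frequency response applied to `u`.
    rcases hw' with rfl | ⟨ω, hω⟩
    · have hu : u ≠ 0 := by
        rintro rfl
        exact hw (by ext (i | i) <;> rfl)
      have := contraction_of_posDef hD hu
      rw [qf_gram] at this
      simpa [qf] using this
    · have hdet := hA.det_ne_zero (s := ω * Complex.I) (by simp)
      have hx : (((ω : ℂ) * Complex.I) • 1 - A) *ᵥ x = B *ᵥ u := by
        rw [sub_mulVec, smul_mulVec, one_mulVec, ← hω]; simp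
      have hx' : x = (((ω : ℂ) * Complex.I) • 1 - A)⁻¹ *ᵥ (B *ᵥ u) := by
        rw [← hx, mulVec_mulVec, nonsing_inv_mul _ hdet.isUnit, one_mulVec]
      have hu : u ≠ 0 := by
        rintro rfl
        have : x = 0 := by rw [hx']; simp
        subst this
        exact hw (by ext (i | i) <;> rfl)
      have hy : freq (transfer A B C D) ω *ᵥ u = C *ᵥ x + D *ᵥ u := by
        rw [hA.freq_transfer, add_mulVec, ← mulVec_mulVec, ← mulVec_mulVec, ← hx']
      have := contraction_of_posDef (h ω) hu
      rw [qf_gram, hy] at this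
      simpa [qf] using this)
  have hNeq : -(M + ((fromCols A B)ᴴ * P * fromCols (1 : Matrix σ σ ℂ) 0 +
      (fromCols (1 : Matrix σ σ ℂ) 0)ᴴ * P * fromCols A B)) =
      fromBlocks (-(Aᴴ * P + P * A) - Cᴴ * C) (-(P * B) - Cᴴ * D) (-(Bᴴ * P) - Dᴴ * C)
        (1 - Dᴴ * D) := by
    simp only [M, conjTranspose_fromCols_eq_fromRows_conjTranspose, fromRows_mul Aᴴ Bᴴ P,
      fromRows_mul _ _ P, fromRows_mul_fromCols, fromBlocks_sub, fromBlocks_add, fromBlocks_neg, conjTranspose_one,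
      conjTranspose_zero, Matrix.one_mul, Matrix.mul_one, Matrix.zero_mul, Matrix.mul_zero]
    congr 1 <;> abel
  rw [hNeq] at hN
  refine ⟨P, posDef_of_lyap hA hP ?_, hN⟩
  have h11 := hN.submatrix (e := Sum.inl) Sum.inl_injective
  have : (-(Aᴴ * P + P * A)) = (-(Aᴴ * P + P * A) - Cᴴ * C) + Cᴴ * C := by abel
  rw [this]
  exact PosDef.add_posSemidef h11 (posSemidef_conjTranspose_mul_self C)

/-- The lossless system with state matrix `A`, output matrix `C` and feedthrough `U`. -/
def losslessTF (A P : Matrix σ σ ℂ) (C : Matrix ρ σ ℂ) (U : Matrix ρ κ ℂ) : TF ρ κ :=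
  transfer A (-(P⁻¹ * Cᴴ * U)) C U

theorem losslessTF_eq {κ : Type*} (A P : Matrix σ σ ℂ) (C : Matrix ρ σ ℂ) (U : Matrix ρ κ ℂ) :
    losslessTF A P C U =
      (1 - const C * (pencil A)⁻¹ * const P⁻¹ * const Cᴴ) * const U := by
  rw [losslessTF, transfer, const_neg, const_mul, const_mul]
  simp only [Matrix.sub_mul, Matrix.one_mul, Matrix.mul_neg, Matrix.mul_assoc]
  abel

theorem paraConj_pencil {σ : Type*} [DecidableEq σ] (A : Matrix σ σ ℂ) :
    paraConj (pencil A) = -((RatFunc.X : RatFunc ℂ) • (1 : TF σ σ)) - const Aᴴ := by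
  rw [pencil, paraConj_sub, paraConj_const]
  congr 1
  ext i j
  by_cases h : i = j
  · subst h; simp [paraConj, paraRat_X]
  · simp [paraConj, h, Ne.symm h]

variable {A P : Matrix σ σ ℂ} {C : Matrix ρ σ ℂ} {U : Matrix ρ κ ℂ}

theorem paraConj_losslessTF_mul_self {κ : Type*} [DecidableEq κ] {U : Matrix ρ κ ℂ} (hP : P.PosDef) (hC : Cᴴ * C = -(Aᴴ * P + P * A))
    (hU : Uᴴ * U = 1) : paraConj (losslessTF A P C U) * losslessTF A P C U = 1 := by
  have hPP : const P⁻¹ * const P = 1 := by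
    rw [← const_mul, nonsing_inv_mul _ ((isUnit_iff_isUnit_det _).1 hP.isUnit), const_one]
  have hR : pencil A * (pencil A)⁻¹ = 1 := mul_nonsing_inv _ (isUnit_det_pencil A)
  have hRh : paraConj (pencil A)⁻¹ * paraConj (pencil A) = 1 := by
    rw [← paraConj_mul, hR, paraConj_one]
  have hslack : const P * pencil A + paraConj (pencil A) * const P - const Cᴴ * const C = 0 := by
    rw [← const_mul, hC, paraConj_pencil, pencil, const_neg, const_add, const_mul, const_mul]
    simp only [Matrix.mul_sub, Matrix.sub_mul, Matrix.neg_mul, Matrix.mul_smul, Matrix.smul_mul,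
      Matrix.mul_one, Matrix.one_mul]
    abel
  have hid := lossless_identity (const C) (const Cᴴ) hPP hR hRh
  rw [hslack, Matrix.mul_zero, Matrix.zero_mul, Matrix.zero_mul, Matrix.zero_mul, sub_zero] at hid
  rw [losslessTF_eq, paraConj_mul, paraConj_sub, paraConj_one, paraConj_mul, paraConj_mul,
    paraConj_mul, paraConj_const, paraConj_const, paraConj_const, paraConj_const,
    conjTranspose_conjTranspose, hP.inv.1.eq]
  simp only [← Matrix.mul_assoc] at hid ⊢
  rw [Matrix.mul_assoc (const Uᴴ), hid, Matrix.mul_one, ← const_mul, hU, const_one]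

/-- In the closed right half-plane the defect `I - H^†H` is `2 Re(s)` times a positive semidefinite
matrix, so the columns of `H` have norm at most 1. -/
theorem norm_evalTF_losslessTF_le (hA : IsLyapStable A) (hP : P.PosDef)
    (hC : Cᴴ * C = -(Aᴴ * P + P * A)) (hU : Uᴴ * U = 1) {s : ℂ} (hs : 0 ≤ s.re) (i : ρ) (j : κ) :
    ‖evalTF (losslessTF A P C U) s i j‖ ≤ 1 := by
  have hdet := hA.det_ne_zero hs
  set R := (s • 1 - A)⁻¹ with hRdef
  have hPP : P⁻¹ * P = 1 := nonsing_inv_mul _ ((isUnit_iff_isUnit_det _).1 hP.isUnit)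
  have hR : (s • 1 - A) * R = 1 := mul_nonsing_inv _ hdet.isUnit
  have hRh : Rᴴ * (s • 1 - A)ᴴ = 1 := by rw [← conjTranspose_mul, hR, conjTranspose_one]
  have hslack : P * (s • 1 - A) + (s • 1 - A)ᴴ * P - Cᴴ * C = ((2 * s.re : ℝ) : ℂ) • P := by
    have : ((2 * s.re : ℝ) : ℂ) = s + star s := by
      rw [Complex.star_def, Complex.add_conj]
    rw [hC, this, add_smul, conjTranspose_sub, conjTranspose_smul, conjTranspose_one]
    simp only [Matrix.mul_sub, Matrix.sub_mul, Matrix.mul_smul, Matrix.smul_mul,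
      Matrix.mul_one, Matrix.one_mul]
    abel
  have hid := lossless_identity C Cᴴ hPP hR hRh
  set W := 1 - C * R * P⁻¹ * Cᴴ with hW
  have hWh : Wᴴ = 1 - C * P⁻¹ * Rᴴ * Cᴴ := by
    simp [hW, hP.inv.1.eq, Matrix.mul_assoc]
  set Z := R * P⁻¹ * Cᴴ with hZ
  have hZh : Zᴴ = C * P⁻¹ * Rᴴ := by
    simp [hZ, hP.inv.1.eq, Matrix.mul_assoc]
  have hWW : Wᴴ * W = 1 - ((2 * s.re : ℝ) : ℂ) • (Zᴴ * P * Z) := by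
    rw [hWh, hid, hslack, ← hZh, Matrix.mul_smul, Matrix.smul_mul, Matrix.smul_mul, Matrix.smul_mul,
      hZ]
    simp only [Matrix.mul_assoc]
  have hev : evalTF (losslessTF A P C U) s = W * U := by
    rw [losslessTF, evalTF_transfer hdet, ← hRdef, hW]
    simp only [Matrix.sub_mul, Matrix.one_mul, Matrix.mul_neg, Matrix.mul_assoc]
    abel
  rw [hev]
  set H := W * U with hH
  have hcol : qf (Hᴴ * H) (Pi.single j 1) ≤ 1 := by
    have h1 : Hᴴ * H = 1 - ((2 * s.re : ℝ) : ℂ) • (Uᴴ * (Zᴴ * P * Z) * U) := by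
      rw [hH, conjTranspose_mul, Matrix.mul_assoc, ← Matrix.mul_assoc Wᴴ, hWW, Matrix.sub_mul,
        Matrix.mul_sub, Matrix.one_mul, hU, Matrix.smul_mul, Matrix.mul_smul]
      simp only [Matrix.mul_assoc]
    have h2 : (Uᴴ * (Zᴴ * P * Z) * U).PosSemidef :=
      (hP.posSemidef.conjTranspose_mul_mul_same Z).conjTranspose_mul_mul_same U
    rw [h1, qf_sub, qf_smul]
    have h3 := h2.qf_nonneg (Pi.single j 1)
    have h4 : qf (1 : Matrix κ κ ℂ) (Pi.single j 1) = 1 := by simp [qf]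
    nlinarith
  have h5 : qf (Hᴴ * H) (Pi.single j 1) = ∑ k, ‖H k j‖ ^ 2 := by
    have := qf_one (H *ᵥ Pi.single j 1)
    rw [qf_gram, qf, one_mulVec] at *
    rw [this]
    simp
  have h6 : ‖H i j‖ ^ 2 ≤ ∑ k, ‖H k j‖ ^ 2 :=
    Finset.single_le_sum (f := fun k => ‖H k j‖ ^ 2) (fun _ _ => by positivity) (Finset.mem_univ i)
  have h7 : ‖H i j‖ ^ 2 ≤ 1 := by linarith
  exact (sq_le_one_iff₀ (norm_nonneg _)).1 h7

/-- Every strictly contractive proper stable rational function is a block of a stable paraunitary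
one. -/
theorem exists_isAdmissible_extension {n ny : ℕ} {H₁₁ : TF (Fin n) (Fin ny)} (hp : IsProper H₁₁)
    (hs : IsStable H₁₁) (hc : ForallExtFreq H₁₁ (fun M => (1 - M * Mᴴ).PosDef)) :
    ∃ (nz nzh : ℕ) (H : TF (Fin n ⊕ Fin nzh) (Fin ny ⊕ Fin nz)),
      IsAdmissible H ∧ H.toBlocks₁₁ = H₁₁ := by
  obtain ⟨σ, _, _, A, B, C, D, hA, rfl⟩ := isRealizable_of_isProper_of_isStable hp hs
  obtain ⟨hω, L, hL, hLc⟩ := hc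
  rw [tendsto_nhds_unique hL (tendsto_freq_transfer hA)] at hLc
  obtain ⟨P, hP, hN⟩ := exists_bounded_real hA hω hLc
  -- A factor of the bounded real slack supplies output rows `C'`, `D'` that turn the inequality
  -- into the lossless equalities for the stacked matrices `Ce`, `De`.
  obtain ⟨T₀, hT₀⟩ := exists_eq_conjTranspose_mul_self hN.posSemidef
  obtain ⟨e⟩ : Nonempty (Fin (Fintype.card (σ ⊕ Fin ny)) ≃ (σ ⊕ Fin ny)) :=
    ⟨(Fintype.equivFin _).symm⟩
  set nzh := Fintype.card (σ ⊕ Fin ny) with hnzh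
  let T : Matrix (Fin nzh) (σ ⊕ Fin ny) ℂ := T₀.submatrix e id
  have hT : Tᴴ * T = T₀ᴴ * T₀ := by
    simp only [T, conjTranspose_submatrix]
    exact submatrix_mul_equiv _ _ id e id |>.trans (submatrix_id_id _)
  let C' : Matrix (Fin nzh) σ ℂ := T.toCols₁
  let D' : Matrix (Fin nzh) (Fin ny) ℂ := T.toCols₂
  have hTC : T = fromCols C' D' := (fromCols_toCols T).symm
  rw [← hT, hTC, conjTranspose_fromCols_eq_fromRows_conjTranspose, fromRows_mul_fromCols,
    fromBlocks_inj] at hT₀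
  obtain ⟨h11, h12, h21, h22⟩ := hT₀
  let Ce : Matrix (Fin n ⊕ Fin nzh) σ ℂ := fromRows C C'
  let De : Matrix (Fin n ⊕ Fin nzh) (Fin ny) ℂ := fromRows D D'
  have hCC : Ceᴴ * Ce = -(Aᴴ * P + P * A) := by
    simp only [Ce, conjTranspose_fromRows_eq_fromCols_conjTranspose, fromCols_mul_fromRows, ← h11]
    abel
  have hCD : Ceᴴ * De = -(P * B) := by
    simp only [Ce, De, conjTranspose_fromRows_eq_fromCols_conjTranspose, fromCols_mul_fromRows,
      ← h12]
    abel
  have hDD : Deᴴ * De = 1 := by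
    simp only [De, conjTranspose_fromRows_eq_fromCols_conjTranspose, fromCols_mul_fromRows, ← h22]
    abel
  have hcard : nzh = Fintype.card σ + ny := by simp [hnzh]
  -- `De` is an isometry with `n + card σ + ny` rows and `ny` columns; the `n + card σ` columns
  -- missing from a unitary matrix become additional inputs.
  obtain ⟨V, hV⟩ := exists_unitary_extension (μ := Fin (n + Fintype.card σ)) (by
    simp [hcard]; ring) hDD
  set U := fromCols De V with hU
  have hdim : n + nzh = ny + (n + Fintype.card σ) := by omega
  refine ⟨n + Fintype.card σ, nzh, losslessTF A P Ce U, ⟨hdim, ⟨fun s hs => ?_, 1, fun s hs => ?_⟩,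
    hA.isStable_transfer, ?_, ?_⟩, ?_⟩
  · exact not_isPole_transfer (hA.det_ne_zero hs.le)
  · exact norm_evalTF_losslessTF_le hA hP hCC hV hs.le
  · exact paraConj_losslessTF_mul_self hP hCC hV
  · exact (mul_eq_one_comm_of_card_eq _ _ _ (by simp; omega)).1 (paraConj_losslessTF_mul_self hP hCC hV)
  -- The lossless input matrix extends the original `B`, because `Ce^† De = -P B`.
  · have hB : -(P⁻¹ * Ceᴴ * U) = fromCols B (-(P⁻¹ * Ceᴴ * V)) := by
      rw [hU, mul_fromCols, Matrix.mul_assoc, hCD, Matrix.mul_neg,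
        nonsing_inv_mul_cancel_left _ _ ((isUnit_iff_isUnit_det _).1 hP.isUnit)]
      ext i (j | j) <;> simp
    rw [losslessTF, hB, hU, transfer, transfer, const_fromCols, const_fromCols, const_fromRows,
      const_fromRows, fromRows_mul, mul_fromCols]
    ext i j
    simp [toBlocks₁₁, fromRows_mul]

end LosslessCompletion

/-- The matrix `[F I]`. -/
def rowOne {ι κ : Type*} [DecidableEq ι] (F : Matrix ι κ ℂ) : Matrix ι (κ ⊕ ι) ℂ := fromCols F 1

/-! ### The error spectrum on the imaginary axis -/

namespace Channel

variable {n nw ny nd N p : ℕ} {S : Channel n nw ny nd N} {lam : ℝ}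
  {Υ : TF (Fin ny ⊕ Fin n) (Fin p)}

theorem IsSpectralFactor.Phi_eq (hΥ : S.IsSpectralFactor lam Υ) :
    S.Phi = Υ * paraConj Υ + const (fromBlocks 0 0 0 (-(((lam ^ 2 : ℝ) : ℂ) • 1))) := by
  rw [← hΥ.1, PhiLam, add_assoc, ← const_add, fromBlocks_add]
  simp

theorem IsSpectralFactor.not_isPole_Phi (hΥ : S.IsSpectralFactor lam Υ) (ω : ℝ) :
    ¬ IsPole S.Phi (ω * Complex.I) := by
  rw [hΥ.Phi_eq]
  have h := hΥ.2.not_isPole_freq ω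
  exact not_isPole_add (not_isPole_mul h (not_isPole_paraConj_freq h)) (not_isPole_const _ _)

theorem IsSpectralFactor.freq_Phi (hΥ : S.IsSpectralFactor lam Υ) (ω : ℝ) :
    freq S.Phi ω = freq Υ ω * (freq Υ ω)ᴴ + fromBlocks 0 0 0 (-(((lam ^ 2 : ℝ) : ℂ) • 1)) := by
  have h := hΥ.2.not_isPole_freq ω
  have h' := not_isPole_paraConj_freq h
  rw [← freq_paraConj h, hΥ.Phi_eq]
  simp only [freq]
  rw [evalTF_add (not_isPole_mul h h') (not_isPole_const _ _), evalTF_mul h h', evalTF_const]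

theorem IsSpectralFactor.freq_Pe (hΥ : S.IsSpectralFactor lam Υ) {H : TF (Fin n) (Fin ny)}
    {ω : ℝ} (hH : ¬ IsPole H (ω * Complex.I)) :
    freq (S.Pe H) ω = rowOne (freq H ω) * freq S.Phi ω * (rowOne (freq H ω))ᴴ := by
  have h1 : ¬ IsPole (fromCols H 1 : TF (Fin n) (Fin ny ⊕ Fin n)) (ω * Complex.I) :=
    not_isPole_fromCols hH (not_isPole_one _)
  have h2 : ¬ IsPole (fromRows (paraConj H) 1 : TF (Fin ny ⊕ Fin n) (Fin n)) (ω * Complex.I) :=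
    not_isPole_fromRows (not_isPole_paraConj_freq hH) (not_isPole_one _)
  have h3 := hΥ.not_isPole_Phi ω
  have e1 : evalTF (fromCols H 1 : TF (Fin n) (Fin ny ⊕ Fin n)) (ω * Complex.I) =
      rowOne (freq H ω) := by
    rw [rowOne, ← evalTF_one (ω * Complex.I)]
    ext i (j | j) <;> rfl
  have e2 : evalTF (fromRows (paraConj H) 1 : TF (Fin ny ⊕ Fin n) (Fin n)) (ω * Complex.I) =
      (rowOne (freq H ω))ᴴ := by
    rw [rowOne, conjTranspose_fromCols_eq_fromRows_conjTranspose, ← freq_paraConj hH, conjTranspose_one,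
      ← evalTF_one (ω * Complex.I)]
    ext (i | i) j <;> rfl
  rw [Pe, freq, evalTF_mul (not_isPole_mul h1 h3) h2, evalTF_mul h1 h3, e1, e2]
  rfl

theorem freq_Phi_blocks (S : Channel n nw ny nd N) (ω : ℝ) :
    (freq S.Phi ω).toBlocks₂₂ = S.Suᵀ + (2 : ℂ) • 1 := by
  have h : S.Phi.toBlocks₂₂ = const (S.Suᵀ + (2 : ℂ) • 1) := toBlocks_fromBlocks₂₂ _ _ _ _
  have h2 := evalTF_const (S.Suᵀ + (2 : ℂ) • (1 : Matrix (Fin n) (Fin n) ℂ)) (ω * Complex.I)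
  rw [← h] at h2
  exact h2

theorem IsSpectralFactor.isHermitian_freq_Phi (hΥ : S.IsSpectralFactor lam Υ) (ω : ℝ) :
    (freq S.Phi ω).IsHermitian := by
  rw [hΥ.freq_Phi]
  refine (isHermitian_mul_conjTranspose_self _).add ?_
  rw [IsHermitian, fromBlocks_conjTranspose]
  simp

theorem IsSpectralFactor.posSemidef_freq_Phi_toBlocks₁₁ (hΥ : S.IsSpectralFactor lam Υ) (ω : ℝ) :
    (freq S.Phi ω).toBlocks₁₁.PosSemidef := by
  have h := (posSemidef_self_mul_conjTranspose (freq Υ ω)).submatrix (Sum.inl : Fin ny → _)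
  convert h using 1
  rw [hΥ.freq_Phi]
  ext i j
  simp [toBlocks₁₁]

/-- Scaling an equalizer moves its error spectrum at most convexly towards that of the zero
equalizer. -/
theorem IsSpectralFactor.posSemidef_convex (hΥ : S.IsSpectralFactor lam Υ) (ω : ℝ)
    (F : Matrix (Fin n) (Fin ny) ℂ) {r : ℝ} (hr0 : 0 ≤ r) (hr1 : r ≤ 1) :
    ((r : ℂ) • (rowOne F * freq S.Phi ω * (rowOne F)ᴴ) +
      ((1 - r : ℝ) : ℂ) • (S.Suᵀ + (2 : ℂ) • 1) -
      rowOne ((r : ℂ) • F) * freq S.Phi ω * (rowOne ((r : ℂ) • F))ᴴ).PosSemidef := by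
  -- The terms linear in `F` cancel, leaving the quadratic term with factor `r - r² ≥ 0`. The block
  -- `Su^T + 2` is the error spectrum of the zero equalizer.
  have h : (r : ℂ) • (rowOne F * freq S.Phi ω * (rowOne F)ᴴ) +
      ((1 - r : ℝ) : ℂ) • (S.Suᵀ + (2 : ℂ) • 1) -
      rowOne ((r : ℂ) • F) * freq S.Phi ω * (rowOne ((r : ℂ) • F))ᴴ =
      ((r * (1 - r) : ℝ) : ℂ) • (F * (freq S.Phi ω).toBlocks₁₁ * Fᴴ) := by
    rw [← freq_Phi_blocks S ω]
    conv_lhs => rw [← fromBlocks_toBlocks (freq S.Phi ω)]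
    simp only [rowOne, conjTranspose_fromCols_eq_fromRows_conjTranspose, conjTranspose_smul,
      conjTranspose_one, fromCols_mul_fromBlocks, fromCols_mul_fromRows, Matrix.one_mul,
      Matrix.mul_one, Matrix.smul_mul, Matrix.mul_smul, Matrix.add_mul, toBlocks_fromBlocks₂₂,
      Complex.star_def, Complex.conj_ofReal, Complex.ofReal_mul, Complex.ofReal_sub,
      Complex.ofReal_one]
    module
  rw [h]
  refine ((hΥ.posSemidef_freq_Phi_toBlocks₁₁ ω).mul_mul_conjTranspose_same F).smul ?_
  exact Complex.zero_le_real.2 (mul_nonneg hr0 (by linarith))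

theorem mem_achievable_of_strictSet_nonempty {γ : ℝ} (hγ : 0 < γ) (h : (S.strictSet γ).Nonempty) :
    γ ∈ S.achievable := by
  obtain ⟨H₁₁, hp, hs, hPe, hc⟩ := h
  obtain ⟨nz, nzh, H, hH, hH₁₁⟩ := exists_isAdmissible_extension hp hs hc
  exact ⟨hγ, nz, nzh, H, hH, hH₁₁ ▸ hPe⟩

theorem isProper_toBlocks₁₁_of_isHardyInfty {n nzh ny nz : ℕ}
    {H : TF (Fin n ⊕ Fin nzh) (Fin ny ⊕ Fin nz)} (hH : IsHardyInfty H) : IsProper H := by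
  obtain ⟨_, M, hM⟩ := hH
  intro i j
  have hg : Filter.Tendsto (fun t : ℝ => (t : ℂ)) Filter.atTop (Bornology.cobounded ℂ) := by
    rw [← tendsto_norm_atTop_iff_cobounded]
    simp only [Complex.norm_real, Real.norm_eq_abs]
    exact Filter.tendsto_abs_atTop_atTop
  refine natDegree_le_of_eventually_bounded hg (M := M) ?_
  filter_upwards [Filter.eventually_gt_atTop 0] with t ht
  exact hM t (by simpa using ht) i j

theorem _root_.CoherentEq.IsAdmissible.posSemidef_one_sub {n nzh ny nz : ℕ}
    {H : TF (Fin n ⊕ Fin nzh) (Fin ny ⊕ Fin nz)} (hH : IsAdmissible H) (ω : ℝ) :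
    (1 - freq H.toBlocks₁₁ ω * (freq H.toBlocks₁₁ ω)ᴴ).PosSemidef := by
  have hp := hH.stable.not_isPole_freq ω
  have h1 : freq H ω * (freq H ω)ᴴ = 1 := by
    rw [← freq_paraConj hp]
    have := evalTF_mul hp (not_isPole_paraConj_freq hp)
    rw [hH.para_right, evalTF_one] at this
    exact this.symm
  have h2 : freq H.toBlocks₁₁ ω = (freq H ω).toBlocks₁₁ := rfl
  rw [h2]
  set M := freq H ω
  have h3 : 1 - M.toBlocks₁₁ * M.toBlocks₁₁ᴴ = M.toBlocks₁₂ * M.toBlocks₁₂ᴴ := by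
    have h4 := congrArg toBlocks₁₁ h1
    rw [← fromBlocks_toBlocks M, fromBlocks_conjTranspose, fromBlocks_multiply,
      toBlocks_fromBlocks₁₁, ← fromBlocks_one, toBlocks_fromBlocks₁₁] at h4
    rw [← h4]
    abel
  rw [h3]
  exact posSemidef_self_mul_conjTranspose _

end Channel

theorem isClosed_posSemidef {ι : Type*} [Fintype ι] :
    IsClosed {M : Matrix ι ι ℂ | M.PosSemidef} := by
  have h : {M : Matrix ι ι ℂ | M.PosSemidef} = {M | Mᴴ = M} ∩ ⋂ x, {M | 0 ≤ qf M x} := by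
    ext M
    simp only [Set.mem_ofPred_eq, Set.mem_inter_iff, Set.mem_iInter]
    exact posSemidef_iff_qf
  rw [h]
  refine (isClosed_eq (by fun_prop) continuous_id).inter (isClosed_iInter fun x => ?_)
  exact isClosed_le continuous_const
    (continuous_qf.comp (by fun_prop : Continuous fun M : Matrix ι ι ℂ => (M, x)))

theorem posSemidef_smul_one {ι : Type*} [DecidableEq ι] {c : ℝ} (hc : 0 ≤ c) :
    ((c : ℂ) • (1 : Matrix ι ι ℂ)).PosSemidef :=
  PosSemidef.one.smul (Complex.zero_le_real.2 hc)

theorem posDef_smul_one {ι : Type*} [DecidableEq ι] {c : ℝ} (hc : 0 < c) :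
    ((c : ℂ) • (1 : Matrix ι ι ℂ)).PosDef :=
  PosDef.one.smul (Complex.zero_lt_real.2 hc)

theorem IsRealizable.isStable {ι κ : Type*} {F : TF ι κ} (hF : IsRealizable F) : IsStable F := by
  obtain ⟨σ, _, _, A, B, C, D, hA, rfl⟩ := hF
  exact hA.isStable_transfer

theorem IsRealizable.isProper {ι κ : Type*} {F : TF ι κ} (hF : IsRealizable F) : IsProper F := by
  obtain ⟨σ, _, _, A, B, C, D, hA, rfl⟩ := hF
  exact hA.isProper_transfer

theorem IsRealizable.exists_tendsto {ι κ : Type*} {F : TF ι κ} (hF : IsRealizable F) :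
    ∃ L, Filter.Tendsto (freq F) (Filter.atBot ⊔ Filter.atTop) (𝓝 L) := by
  obtain ⟨σ, _, _, A, B, C, D, hA, rfl⟩ := hF
  exact ⟨D, tendsto_freq_transfer hA⟩

/-! ### Equality of the two optimal values -/

namespace Channel

variable {n nw ny nd N p : ℕ} {S : Channel n nw ny nd N} {lam : ℝ}
  {Υ : TF (Fin ny ⊕ Fin n) (Fin p)}

/-- The block `H₁₁` is scaled by `r = 1 - ε`. The contractivity gap `1 - r²` is uniform in the
frequency and so persists at infinity, while `(γ + δ)² - γ²` absorbs the convex move of the error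
towards that of the zero equalizer. -/
theorem IsSpectralFactor.strictSet_add_nonempty (hΥ : S.IsSpectralFactor lam Υ) {γ δ : ℝ}
    (hγ : γ ∈ S.achievable) (hδ : 0 < δ) : (S.strictSet (γ + δ)).Nonempty := by
  obtain ⟨hγ0, nz, nzh, H, hH, hPe⟩ := hγ
  have hs₁₁ : IsStable H.toBlocks₁₁ := hH.stable.submatrix _ _
  have hp₁₁ : IsProper H.toBlocks₁₁ := fun i j =>
    isProper_toBlocks₁₁_of_isHardyInfty hH.hardy (Sum.inl i) (Sum.inl j)
  have hreal := isRealizable_of_isProper_of_isStable hp₁₁ hs₁₁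
  have hcon := hH.posSemidef_one_sub
  set H₁₁ := H.toBlocks₁₁
  set Φ₂ : Matrix (Fin n) (Fin n) ℂ := S.Suᵀ + (2 : ℂ) • 1 with hΦ₂
  have hΦ₂H : Φ₂.IsHermitian := by
    have := S.Su_pos.1.transpose
    rw [IsHermitian, hΦ₂, conjTranspose_add, this.eq, conjTranspose_smul]
    simp
  have hM₀ : ((((γ + δ) ^ 2 - γ ^ 2 : ℝ) : ℂ) • (1 : Matrix (Fin n) (Fin n) ℂ)).PosDef :=
    posDef_smul_one (by nlinarith)
  have hE : (((γ ^ 2 : ℝ) : ℂ) • (1 : Matrix (Fin n) (Fin n) ℂ) - Φ₂).IsHermitian :=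
    (posSemidef_smul_one (by positivity)).1.sub hΦ₂H
  obtain ⟨ε₀, hε₀, hε⟩ := exists_smul_add_posDef hM₀ hE
  -- The cap `1/2` keeps `r` in `(0, 1)`.
  set ε := min ε₀ (1 / 2) with hεdef
  have hε1 : 0 < ε := by positivity
  have hε2 : ε ≤ ε₀ := min_le_left _ _
  have hε3 : ε ≤ 1 / 2 := min_le_right _ _
  set r := 1 - ε with hr
  have hreal' : IsRealizable (const ((r : ℂ) • (1 : Matrix (Fin n) (Fin n) ℂ)) * H₁₁) :=
    (isRealizable_const _).mul hreal
  have hfreq : ∀ ω, freq (const ((r : ℂ) • (1 : Matrix (Fin n) (Fin n) ℂ)) * H₁₁) ω =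
      (r : ℂ) • freq H₁₁ ω := by
    intro ω
    rw [freq, evalTF_mul (not_isPole_const _ _) (hs₁₁.not_isPole_freq ω), evalTF_const]
    simp [freq]
  have hgap : ∀ ω, (1 - (r : ℂ) • freq H₁₁ ω * ((r : ℂ) • freq H₁₁ ω)ᴴ -
      ((1 - r ^ 2 : ℝ) : ℂ) • 1).PosSemidef := by
    intro ω
    have h1 : 1 - (r : ℂ) • freq H₁₁ ω * ((r : ℂ) • freq H₁₁ ω)ᴴ - ((1 - r ^ 2 : ℝ) : ℂ) • 1 =
        ((r ^ 2 : ℝ) : ℂ) • (1 - freq H₁₁ ω * (freq H₁₁ ω)ᴴ) := by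
      simp only [conjTranspose_smul, Matrix.smul_mul, Matrix.mul_smul, Complex.star_def,
        Complex.conj_ofReal]
      push_cast
      module
    rw [h1]
    exact (hcon ω).smul (Complex.zero_le_real.2 (by positivity))
  have hr2 : 0 < 1 - r ^ 2 := by nlinarith
  refine ⟨const ((r : ℂ) • (1 : Matrix (Fin n) (Fin n) ℂ)) * H₁₁, hreal'.isProper, hreal'.isStable,
    fun ω => ?_, fun ω => ?_, ?_⟩
  · rw [hΥ.freq_Pe (hreal'.isStable.not_isPole_freq ω), hfreq]
    have h1 := hPe ω
    rw [hΥ.freq_Pe (hs₁₁.not_isPole_freq ω)] at h1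
    have h2 := hΥ.posSemidef_convex ω (freq H₁₁ ω) (r := r) (by linarith) (by linarith)
    have h3 := h1.posSemidef.smul (a := (r : ℂ)) (Complex.zero_le_real.2 (by linarith))
    have h4 := ((hε ε hε1.le hε2).add_posSemidef h3).add_posSemidef h2
    convert h4 using 1
    rw [← hΦ₂, hr]
    push_cast
    module
  · rw [hfreq]
    have := (posDef_smul_one (ι := Fin n) hr2).posSemidef_add (hgap ω)
    simpa using this
  · obtain ⟨L, hL⟩ := hreal'.exists_tendsto
    refine ⟨L, hL, ?_⟩
    have hcont : Continuous fun M : Matrix (Fin n) (Fin ny) ℂ =>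
        1 - M * Mᴴ - ((1 - r ^ 2 : ℝ) : ℂ) • (1 : Matrix (Fin n) (Fin n) ℂ) := by fun_prop
    have h1 := isClosed_posSemidef.mem_of_tendsto ((hcont.tendsto L).comp hL)
      (Filter.Eventually.of_forall fun ω => by
        simp only [Function.comp, Set.mem_ofPred_eq, hfreq]
        exact hgap ω)
    have := (posDef_smul_one (ι := Fin n) hr2).posSemidef_add h1
    simpa using this

theorem IsSpectralFactor.gammaStrict_eq_gammaOpt (hΥ : S.IsSpectralFactor lam Υ)
    (hne : ∃ γ, 0 < γ ∧ (S.strictSet γ).Nonempty) : S.gammaStrict = S.gammaOpt := by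
  have hsub : {γ : ℝ | 0 < γ ∧ (S.strictSet γ).Nonempty} ⊆ S.achievable :=
    fun γ hγ => mem_achievable_of_strictSet_nonempty hγ.1 hγ.2
  have hb : BddBelow S.achievable := ⟨0, fun γ hγ => hγ.1.le⟩
  refine le_antisymm (le_csInf (hne.imp fun γ hγ => hsub hγ) fun γ hγ => ?_)
    (csInf_le_csInf hb hne hsub)
  refine le_of_forall_pos_le_add fun δ hδ => csInf_le (hb.mono hsub) ⟨?_, ?_⟩
  · exact add_pos hγ.1 hδ
  · exact hΥ.strictSet_add_nonempty hγ hδ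

theorem gammaStrict_le {γ : ℝ} (hγ : 0 < γ) (h : (S.strictSet γ).Nonempty) : S.gammaStrict ≤ γ :=
  csInf_le ⟨0, fun _ hγ => hγ.1.le⟩ ⟨hγ, h⟩

/-- The frequency domain condition turns the error bound into strict contractivity. -/
theorem posDef_one_sub_of_freq_condition {n ny : ℕ}
    {M : Matrix (Fin ny ⊕ Fin n) (Fin ny ⊕ Fin n) ℂ} {F : Matrix (Fin n) (Fin ny) ℂ} {θ γ : ℝ} (hθ : 0 < θ)
    (hM : ((θ : ℂ) • (M - fromBlocks 0 0 0 (((γ ^ 2 : ℝ) : ℂ) • 1)) - fromBlocks 1 0 0 (-1)).PosDef)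
    (hF : (((γ ^ 2 : ℝ) : ℂ) • 1 - rowOne F * M * (rowOne F)ᴴ).PosSemidef) :
    (1 - F * Fᴴ).PosDef := by
  refine posDef_iff_qf.2 ⟨isHermitian_one.sub (isHermitian_mul_conjTranspose_self F), fun u hu => ?_⟩
  have hw : (rowOne F)ᴴ *ᵥ u = Sum.elim (Fᴴ *ᵥ u) u := by
    rw [rowOne, conjTranspose_fromCols_eq_fromRows_conjTranspose, fromRows_mulVec]
    simp
  have hne : Sum.elim (Fᴴ *ᵥ u) u ≠ 0 := by
    intro h0
    exact hu (funext fun i => congrFun h0 (Sum.inr i))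
  have h1 := hM.qf_pos hne
  have h2 := hF.qf_nonneg u
  have h3 : qf (rowOne F * M * (rowOne F)ᴴ) u = qf M (Sum.elim (Fᴴ *ᵥ u) u) := by
    have := qf_congr M (rowOne F)ᴴ u
    rwa [conjTranspose_conjTranspose, hw] at this
  have h4 : qf (fromBlocks 0 0 0 (((γ ^ 2 : ℝ) : ℂ) • 1) : Matrix (Fin ny ⊕ Fin n) _ ℂ)
      (Sum.elim (Fᴴ *ᵥ u) u) = γ ^ 2 * qf 1 u := by
    rw [← qf_smul]
    simp [qf, fromBlocks_mulVec, dotProduct, Fintype.sum_sum_type]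
  have h5 : qf (fromBlocks 1 0 0 (-1) : Matrix (Fin ny ⊕ Fin n) (Fin ny ⊕ Fin n) ℂ)
      (Sum.elim (Fᴴ *ᵥ u) u) = qf (F * Fᴴ) u - qf 1 u := by
    have := qf_gram Fᴴ u
    rw [conjTranspose_conjTranspose] at this
    rw [this]
    simp [qf, fromBlocks_mulVec, neg_mulVec, dotProduct, Fintype.sum_sum_type, sub_eq_add_neg]
  rw [qf_sub, qf_smul, qf_sub, h4, h5] at h1
  rw [qf_sub, qf_smul, h3] at h2
  rw [qf_sub]
  -- S-procedure: the error bound makes the `θ`-term nonpositive on `(F^† u, u)`, so `|u|² - |F^†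
  -- u|²` must be positive.
  nlinarith

end Channel

/-! ### The bounded real inequality and output bounds -/

section BoundedReal

variable {ι κ σ : Type*} [Fintype ι] [Fintype κ] [Fintype σ] [DecidableEq ι] [DecidableEq κ]

theorem IsLyapStable.of_conjTranspose [DecidableEq σ] {A : Matrix σ σ ℂ} (hA : IsLyapStable Aᴴ) :
    IsLyapStable A := by
  obtain ⟨P, hP, hL⟩ := hA
  have hu := (isUnit_iff_isUnit_det _).1 hP.isUnit
  refine ⟨P⁻¹, hP.inv, ?_⟩
  have hinj : Function.Injective P⁻¹.vecMul := by
    intro x y hxy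
    have := congrArg (fun z => z ᵥ* P) hxy
    simpa [nonsing_inv_mul _ hu] using this
  have h := hL.mul_mul_conjTranspose_same hinj
  convert h using 1
  rw [hP.inv.1.eq, conjTranspose_conjTranspose]
  simp only [Matrix.mul_neg, Matrix.neg_mul, Matrix.mul_add, Matrix.add_mul, Matrix.mul_assoc,
    mul_nonsing_inv _ hu, Matrix.mul_one]
  rw [nonsing_inv_mul_cancel_left _ _ hu]
  abel

/-- The quadratic form of the bounded real matrix. -/
theorem qf_boundedReal {A X : Matrix σ σ ℂ} {B : Matrix σ κ ℂ} {C : Matrix ι σ ℂ}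
    {D : Matrix ι κ ℂ} {ρ : ℝ} (hX : X.IsHermitian) (x : σ → ℂ) (u : κ → ℂ) (v : ι → ℂ) :
    qf (fromBlocks (Aᴴ * X + X * A) (fromCols (X * B) Cᴴ) (fromRows (Bᴴ * X) C)
      (fromBlocks (-((ρ : ℂ) • 1)) Dᴴ D (-1)))
      (Sum.elim x (Sum.elim u v)) =
      2 * (star x ⬝ᵥ X *ᵥ (A *ᵥ x + B *ᵥ u)).re + 2 * (star v ⬝ᵥ (C *ᵥ x + D *ᵥ u)).re
        - ρ * qf 1 u - qf 1 v := by
  have e : ∀ (a : σ → ℂ) (b : κ → ℂ) (c : ι → ℂ), star (Sum.elim x (Sum.elim u v)) ⬝ᵥ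
      Sum.elim a (Sum.elim b c) = star x ⬝ᵥ a + (star u ⬝ᵥ b + star v ⬝ᵥ c) := by
    intro a b c
    simp [dotProduct, Fintype.sum_sum_type]
  have hm : fromBlocks (Aᴴ * X + X * A) (fromCols (X * B) Cᴴ) (fromRows (Bᴴ * X) C)
      (fromBlocks (-((ρ : ℂ) • 1)) Dᴴ D (-1)) *ᵥ Sum.elim x (Sum.elim u v) =
      Sum.elim ((Aᴴ * X + X * A) *ᵥ x + ((X * B) *ᵥ u + Cᴴ *ᵥ v))
        (Sum.elim ((Bᴴ * X) *ᵥ x + (-((ρ : ℂ) • u) + Dᴴ *ᵥ v)) (C *ᵥ x + (D *ᵥ u - v))) := by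
    rw [fromBlocks_mulVec]
    simp only [Sum.elim_comp_inl, Sum.elim_comp_inr, fromCols_mulVec_sumElim, fromRows_mulVec,
      fromBlocks_mulVec]
    congr 1
    ext (i | i) <;> simp [neg_mulVec, smul_mulVec, sub_eq_add_neg]
  have c1 : star x ⬝ᵥ Aᴴ *ᵥ (X *ᵥ x) = star (star x ⬝ᵥ X *ᵥ (A *ᵥ x)) := by
    rw [mulVec_mulVec, mulVec_mulVec, ← star_dotProduct_mulVec_conjTranspose, conjTranspose_mul, hX.eq]
  have c2 : star u ⬝ᵥ Bᴴ *ᵥ (X *ᵥ x) = star (star x ⬝ᵥ X *ᵥ (B *ᵥ u)) := by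
    rw [mulVec_mulVec, mulVec_mulVec, ← star_dotProduct_mulVec_conjTranspose, conjTranspose_mul, hX.eq]
  have c3 := star_dotProduct_mulVec_conjTranspose C x v
  have c4 := star_dotProduct_mulVec_conjTranspose D u v
  rw [qf, hm, e]
  simp only [dotProduct_add, add_mulVec, mulVec_add, c1, c2, c3, c4, dotProduct_neg,
    dotProduct_smul, dotProduct_sub, ← mulVec_mulVec, qf, one_mulVec, Complex.add_re,
    Complex.sub_re, Complex.neg_re, Complex.star_def, Complex.conj_re, smul_eq_mul,
    Complex.re_ofReal_mul]
  ring

/-- The bounded real inequality, along a trajectory of frequency `-ω`. -/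
theorem qf_output_lt_of_bounded_real {A X : Matrix σ σ ℂ} {B : Matrix σ κ ℂ} {C : Matrix ι σ ℂ}
    {D : Matrix ι κ ℂ} {ρ : ℝ} (hX : X.IsHermitian)
    (h : (-(fromBlocks (Aᴴ * X + X * A) (fromCols (X * B) Cᴴ) (fromRows (Bᴴ * X) C)
      (fromBlocks (-((ρ : ℂ) • 1)) Dᴴ D (-1)))).PosDef) {ω : ℝ} {x : σ → ℂ} {u : κ → ℂ}
    (hu : u ≠ 0) (hx : A *ᵥ x + B *ᵥ u = (-((ω : ℂ) * Complex.I)) • x) :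
    qf 1 (C *ᵥ x + D *ᵥ u) < ρ * qf 1 u := by
  -- With the output itself as third component, `2 Re⟨v, y⟩ - |v|²` becomes `|y|²`; the storage term
  -- vanishes because the state equation has an imaginary frequency.
  set v := C *ᵥ x + D *ᵥ u with hv
  have hne : Sum.elim x (Sum.elim u v) ≠ 0 := by
    intro h0
    exact hu (funext fun i => congrFun h0 (Sum.inr (Sum.inl i)))
  have h1 := h.qf_pos hne
  have hx0 : (star x ⬝ᵥ X *ᵥ (A *ᵥ x + B *ᵥ u)).re = 0 := by
    rw [hx, mulVec_smul, dotProduct_smul, IsHermitian.dotProduct_eq_qf hX]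
    simp
  have hvv : (star v ⬝ᵥ (C *ᵥ x + D *ᵥ u)).re = qf 1 v := by
    rw [← hv]; simp [qf]
  rw [qf_neg, qf_boundedReal hX, ← hv, hvv] at h1
  rw [hx0] at h1
  linarith

end BoundedReal

/-! ### The synthesis inequality as a closed-loop bounded real inequality -/

namespace FactorData

variable {n ny p m m₁₁ : ℕ} (R : FactorData n ny p m)

section ClosedLoop

variable (A₁₁ : Matrix (Fin m₁₁) (Fin m₁₁) ℂ) (B₁₁ : Matrix (Fin m₁₁) (Fin ny) ℂ)
  (C₁₁ : Matrix (Fin n) (Fin m₁₁) ℂ) (J₁₁ : Matrix (Fin n) (Fin ny) ℂ)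

/-- The closed-loop state matrix. -/
def closedA : Matrix (Fin m ⊕ Fin m₁₁) (Fin m ⊕ Fin m₁₁) ℂ :=
  fromBlocks R.Aᴴ (R.C₁ᴴ * B₁₁ᴴ) 0 A₁₁ᴴ

/-- The closed-loop input matrix. -/
def closedB : Matrix (Fin m ⊕ Fin m₁₁) (Fin n) ℂ := fromRows (R.C₂ᴴ + R.C₁ᴴ * J₁₁ᴴ) C₁₁ᴴ

/-- The closed-loop output matrix. -/
def closedC : Matrix (Fin p) (Fin m ⊕ Fin m₁₁) ℂ := fromCols R.Bᴴ (R.D₁ᴴ * B₁₁ᴴ)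

/-- The closed-loop feedthrough matrix. -/
def closedD : Matrix (Fin p) (Fin n) ℂ := R.D₂ᴴ + R.D₁ᴴ * J₁₁ᴴ

variable {A₁₁ B₁₁ C₁₁ J₁₁}

/-- All four closed-loop matrices are affine in `K`, with coefficients given by the underlined
matrices. -/
theorem synthesisLMI_iff {γbar : ℝ} {X : Matrix (Fin m ⊕ Fin m₁₁) (Fin m ⊕ Fin m₁₁) ℂ}
    (hX : X.IsHermitian) :
    R.SynthesisLMI γbar A₁₁ B₁₁ C₁₁ J₁₁ X ↔
      (-(fromBlocks ((R.closedA A₁₁ B₁₁)ᴴ * X + X * R.closedA A₁₁ B₁₁)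
        (fromCols (X * R.closedB C₁₁ J₁₁) (R.closedC B₁₁)ᴴ)
        (fromRows ((R.closedB C₁₁ J₁₁)ᴴ * X) (R.closedC B₁₁))
        (fromBlocks (-(((γbar ^ 2 : ℝ) : ℂ) • 1)) (R.closedD J₁₁)ᴴ (R.closedD J₁₁) (-1)))).PosDef := by
  set K : Matrix (Fin m₁₁ ⊕ Fin ny) (Fin m₁₁ ⊕ Fin n) ℂ := fromBlocks A₁₁ᴴ C₁₁ᴴ B₁₁ᴴ J₁₁ᴴ with hK
  have hA : R.closedA A₁₁ B₁₁ = R.Abar m₁₁ + R.Bund m₁₁ * K * Cund n m m₁₁ := by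
    simp [closedA, Abar, Bund, Cund, hK, fromBlocks_multiply, fromBlocks_add]
  have hB : R.closedB C₁₁ J₁₁ = R.Bbar m₁₁ + R.Bund m₁₁ * K * Dund₂₁ n m₁₁ := by
    simp [closedB, Bbar, Bund, Dund₂₁, hK, fromBlocks_multiply, fromBlocks_mul_fromRows]
    ext (i | i) j <;> simp
  have hC : R.closedC B₁₁ = R.Cbar m₁₁ + R.Dund₁₂ m₁₁ * K * Cund n m m₁₁ := by
    simp [closedC, Cbar, Dund₁₂, Cund, hK, fromCols_mul_fromBlocks]
    ext i (j | j) <;> simp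
  have hD : R.closedD J₁₁ = R.Dbar + R.Dund₁₂ m₁₁ * K * Dund₂₁ n m₁₁ := by
    simp [closedD, Dbar, Dund₁₂, Dund₂₁, hK, fromCols_mul_fromBlocks, fromCols_mul_fromRows]
  have hL : (R.LambdaX m₁₁ X)ᴴ = fromRows (X * R.Bund m₁₁) (fromRows 0 (R.Dund₁₂ m₁₁)) := by
    simp [LambdaX, conjTranspose_fromCols_eq_fromRows_conjTranspose, hX.eq]
  have hterm : (R.LambdaX m₁₁ X)ᴴ * K * PiMat n p m m₁₁ =
      fromBlocks (X * (R.Bund m₁₁ * K * Cund n m m₁₁))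
        (fromCols (X * (R.Bund m₁₁ * K * Dund₂₁ n m₁₁)) 0)
        (fromRows 0 (R.Dund₁₂ m₁₁ * K * Cund n m m₁₁))
        (fromBlocks 0 0 (R.Dund₁₂ m₁₁ * K * Dund₂₁ n m₁₁) 0) := by
    rw [hL, PiMat, fromRows_mul, fromRows_mul_fromCols, fromRows_mul]
    simp only [mul_fromCols, fromRows_mul, Matrix.zero_mul, Matrix.mul_zero, Matrix.mul_assoc]
    congr 1
    ext (i | i) (j | j) <;> rfl
  have hterm' : (PiMat n p m m₁₁)ᴴ * Kᴴ * R.LambdaX m₁₁ X =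
      ((R.LambdaX m₁₁ X)ᴴ * K * PiMat n p m m₁₁)ᴴ := by
    simp [Matrix.mul_assoc]
  have heq : R.SigmaX m₁₁ γbar X + (PiMat n p m m₁₁)ᴴ * Kᴴ * R.LambdaX m₁₁ X
      + (R.LambdaX m₁₁ X)ᴴ * K * PiMat n p m m₁₁ =
      fromBlocks ((R.closedA A₁₁ B₁₁)ᴴ * X + X * R.closedA A₁₁ B₁₁)
        (fromCols (X * R.closedB C₁₁ J₁₁) (R.closedC B₁₁)ᴴ)
        (fromRows ((R.closedB C₁₁ J₁₁)ᴴ * X) (R.closedC B₁₁))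
        (fromBlocks (-(((γbar ^ 2 : ℝ) : ℂ) • 1)) (R.closedD J₁₁)ᴴ (R.closedD J₁₁) (-1)) := by
    rw [hterm', hterm, SigmaX, hA, hB, hC, hD, fromBlocks_conjTranspose, fromBlocks_add,
      fromBlocks_add]
    congr 1
    · simp only [conjTranspose_add, conjTranspose_mul, Matrix.add_mul, Matrix.mul_add,
        Matrix.mul_assoc, hX.eq]
      abel
    · simp only [conjTranspose_fromRows_eq_fromCols_conjTranspose, conjTranspose_add,
        Matrix.mul_add, conjTranspose_zero]
      ext i (j | j) <;> simp
    · simp only [conjTranspose_fromCols_eq_fromRows_conjTranspose, conjTranspose_add,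
        Matrix.add_mul, conjTranspose_zero, conjTranspose_mul, hX.eq]
      ext (i | i) j <;> simp
    · simp only [fromBlocks_conjTranspose, fromBlocks_add, conjTranspose_add]
      simp
  rw [SynthesisLMI, ← heq]

end ClosedLoop

end FactorData

namespace FactorData

variable {n ny p m m₁₁ : ℕ} {R : FactorData n ny p m} {A₁₁ : Matrix (Fin m₁₁) (Fin m₁₁) ℂ}
  {B₁₁ : Matrix (Fin m₁₁) (Fin ny) ℂ} {C₁₁ : Matrix (Fin n) (Fin m₁₁) ℂ}
  {J₁₁ : Matrix (Fin n) (Fin ny) ℂ} {γbar : ℝ}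
  {X : Matrix (Fin m ⊕ Fin m₁₁) (Fin m ⊕ Fin m₁₁) ℂ}

/-- Congruence with `X⁻¹` moves the Lyapunov inequality to the adjoint system. As the closed-loop
state matrix is block upper triangular, its lower right block involves only `A₁₁` and the lower
right block of `X⁻¹`. -/
theorem isLyapStable_of_synthesisLMI (hX : X.PosDef)
    (h : R.SynthesisLMI γbar A₁₁ B₁₁ C₁₁ J₁₁ X) : IsLyapStable A₁₁ := by
  rw [synthesisLMI_iff R hX.1] at h
  have h1 : (-((R.closedA A₁₁ B₁₁)ᴴ * X + X * R.closedA A₁₁ B₁₁)).PosDef :=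
    h.submatrix (e := Sum.inl) Sum.inl_injective
  have hu := (isUnit_iff_isUnit_det _).1 hX.isUnit
  refine ⟨X⁻¹.toBlocks₂₂, hX.inv.submatrix (e := Sum.inr) Sum.inr_injective, ?_⟩
  have hinj : Function.Injective X⁻¹.vecMul := by
    intro x y hxy
    have := congrArg (fun z => z ᵥ* X) hxy
    simpa [nonsing_inv_mul _ hu] using this
  have h2 := h1.mul_mul_conjTranspose_same hinj
  have h3 : X⁻¹ * -((R.closedA A₁₁ B₁₁)ᴴ * X + X * R.closedA A₁₁ B₁₁) * (X⁻¹)ᴴ =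
      -(X⁻¹ * (R.closedA A₁₁ B₁₁)ᴴ + R.closedA A₁₁ B₁₁ * X⁻¹) := by
    rw [hX.inv.1.eq]
    simp only [Matrix.mul_neg, Matrix.neg_mul, Matrix.mul_add, Matrix.add_mul, Matrix.mul_assoc,
      mul_nonsing_inv _ hu, Matrix.mul_one]
    rw [nonsing_inv_mul_cancel_left _ _ hu]
  rw [h3] at h2
  have h4 := h2.submatrix (e := Sum.inr) Sum.inr_injective
  convert h4 using 1
  conv_rhs => rw [← fromBlocks_toBlocks X⁻¹]
  rw [closedA, fromBlocks_conjTranspose, fromBlocks_multiply, fromBlocks_multiply, fromBlocks_add,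
    fromBlocks_neg]
  simp only [conjTranspose_conjTranspose, conjTranspose_zero, Matrix.mul_zero, Matrix.zero_mul,
    zero_add]
  rw [add_comm]
  rfl

theorem isLyapStable_of_mem_sdpFeasible {q : ℕ} {Nc : Matrix (Fin m ⊕ Fin p) (Fin q) ℂ}
    {lam ρ : ℝ} {X₁ Y₁ : Matrix (Fin m) (Fin m) ℂ} (h : (ρ, X₁, Y₁) ∈ R.sdpFeasible Nc lam) :
    IsLyapStable R.A := by
  obtain ⟨_, hX, _, hL, _⟩ := h
  refine IsLyapStable.of_conjTranspose ⟨X₁, hX, ?_⟩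
  have := hL.add_posSemidef (posSemidef_self_mul_conjTranspose R.B)
  convert this using 1
  simp only [conjTranspose_conjTranspose]
  abel

end FactorData

/-! ### Filters solving the synthesis inequality are feasible -/

namespace Channel

variable {n nw ny nd N p m m₁₁ : ℕ} {S : Channel n nw ny nd N} {lam : ℝ}
  {Υ : TF (Fin ny ⊕ Fin n) (Fin p)} {R : FactorData n ny p m} {A₁₁ : Matrix (Fin m₁₁) (Fin m₁₁) ℂ}
  {B₁₁ : Matrix (Fin m₁₁) (Fin ny) ℂ} {C₁₁ : Matrix (Fin n) (Fin m₁₁) ℂ}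
  {J₁₁ : Matrix (Fin n) (Fin ny) ℂ} {γbar γ : ℝ}
  {X : Matrix (Fin m ⊕ Fin m₁₁) (Fin m ⊕ Fin m₁₁) ℂ}

/-- For a direction `u`, the closed-loop state at frequency `-ω` is built from the adjoint
resolvents at `iω`, and its output is `v = Υ^†(F^†u, u)`. The bounded real inequality gives `|v|² <
γ̄²|u|²`, and `|v|²` exceeds the error form by exactly `λ²|u|²`. -/
theorem IsSpectralFactor.peBound_of_synthesisLMI (hΥ : S.IsSpectralFactor lam Υ)
    (hR : R.Realizes Υ) (hRA : IsLyapStable R.A) (hγ : γ ^ 2 = γbar ^ 2 - lam ^ 2) (hX : X.PosDef)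
    (h : R.SynthesisLMI γbar A₁₁ B₁₁ C₁₁ J₁₁ X) : S.PeBound γ (ssTF A₁₁ B₁₁ C₁₁ J₁₁) := by
  have hA₁₁ := FactorData.isLyapStable_of_synthesisLMI hX h
  rw [FactorData.synthesisLMI_iff R hX.1] at h
  have hΥR : Υ = transfer R.A R.B (fromRows R.C₁ R.C₂) (fromRows R.D₁ R.D₂) := hR.1.symm
  rw [ssTF_eq_transfer]
  intro ω
  rw [hΥ.freq_Pe (hA₁₁.isStable_transfer.not_isPole_freq ω)]
  set F := freq (transfer A₁₁ B₁₁ C₁₁ J₁₁) ω with hF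
  refine posDef_iff_qf.2 ⟨?_, fun u hu => ?_⟩
  · refine (posSemidef_smul_one (by positivity)).1.sub ?_
    exact isHermitian_mul_mul_conjTranspose _ (hΥ.isHermitian_freq_Phi ω)
  set s : ℂ := (ω : ℂ) * Complex.I with hs
  have hd₁₁ := hA₁₁.det_ne_zero (s := s) (by simp [hs])
  have hdA := hRA.det_ne_zero (s := s) (by simp [hs])
  have hstar : star s = -s := by simp [hs]
  have hsolve : ∀ {k : ℕ} {A : Matrix (Fin k) (Fin k) ℂ}, (s • 1 - A).det ≠ 0 → ∀ b : Fin k → ℂ,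
      Aᴴ *ᵥ (((s • 1 - A)⁻¹)ᴴ *ᵥ b) + b = (-s) • (((s • 1 - A)⁻¹)ᴴ *ᵥ b) := by
    intro k A hA b
    have h1 : (s • 1 - A)ᴴ * ((s • 1 - A)⁻¹)ᴴ = 1 := by
      rw [← conjTranspose_mul, nonsing_inv_mul _ hA.isUnit, conjTranspose_one]
    have h2 : (s • 1 - A)ᴴ *ᵥ (((s • 1 - A)⁻¹)ᴴ *ᵥ b) = b := by
      rw [mulVec_mulVec, h1, one_mulVec]
    rw [conjTranspose_sub, conjTranspose_smul, conjTranspose_one, hstar, sub_mulVec, smul_mulVec,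
      one_mulVec] at h2
    rw [← sub_eq_iff_eq_add'.1 h2]
  set x₂ := ((s • 1 - A₁₁)⁻¹)ᴴ *ᵥ (C₁₁ᴴ *ᵥ u) with hx₂
  set g := Fᴴ *ᵥ u with hg
  have hgx : g = B₁₁ᴴ *ᵥ x₂ + J₁₁ᴴ *ᵥ u := by
    rw [hg, hF, hA₁₁.freq_transfer, hx₂, conjTranspose_add, add_mulVec, conjTranspose_mul,
      conjTranspose_mul, mulVec_mulVec, mulVec_mulVec, Matrix.mul_assoc]
  set x₁ := ((s • 1 - R.A)⁻¹)ᴴ *ᵥ (R.C₁ᴴ *ᵥ g + R.C₂ᴴ *ᵥ u) with hx₁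
  set v := R.Bᴴ *ᵥ x₁ + (R.D₁ᴴ *ᵥ g + R.D₂ᴴ *ᵥ u) with hv
  have hvY : v = (freq Υ ω)ᴴ *ᵥ Sum.elim g u := by
    rw [hΥR, hRA.freq_transfer, conjTranspose_add, add_mulVec, conjTranspose_mul, conjTranspose_mul,
      conjTranspose_fromRows_eq_fromCols_conjTranspose,
      conjTranspose_fromRows_eq_fromCols_conjTranspose, ← mulVec_mulVec, ← mulVec_mulVec,
      fromCols_mulVec_sumElim, fromCols_mulVec_sumElim]
  have hstate : R.closedA A₁₁ B₁₁ *ᵥ Sum.elim x₁ x₂ + R.closedB C₁₁ J₁₁ *ᵥ u =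
      (-s) • Sum.elim x₁ x₂ := by
    have e1 := hsolve hdA (R.C₁ᴴ *ᵥ g + R.C₂ᴴ *ᵥ u)
    have e2 := hsolve hd₁₁ (C₁₁ᴴ *ᵥ u)
    rw [← hx₁] at e1
    rw [← hx₂] at e2
    rw [FactorData.closedA, FactorData.closedB, fromBlocks_mulVec, fromRows_mulVec]
    simp only [Sum.elim_comp_inl, Sum.elim_comp_inr, zero_mulVec, zero_add]
    have e3 : (-s) • Sum.elim x₁ x₂ = Sum.elim ((-s) • x₁) ((-s) • x₂) := by
      ext (i | i) <;> rfl
    rw [e3, ← e1, ← e2, hgx]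
    simp only [mulVec_add, add_mulVec, mulVec_mulVec]
    ext (i | i)
    · simp only [Pi.add_apply, Sum.elim_inl]; ring
    · rfl
  have hout : R.closedC B₁₁ *ᵥ Sum.elim x₁ x₂ + R.closedD J₁₁ *ᵥ u = v := by
    rw [FactorData.closedC, FactorData.closedD, fromCols_mulVec_sumElim, hv, hgx]
    simp only [mulVec_add, add_mulVec, mulVec_mulVec]
    abel
  have hlt := qf_output_lt_of_bounded_real hX.1 h hu hstate
  rw [hout] at hlt
  have hw : (rowOne F)ᴴ *ᵥ u = Sum.elim g u := by
    rw [rowOne, conjTranspose_fromCols_eq_fromRows_conjTranspose, fromRows_mulVec]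
    simp [hg]
  have h3 : qf (rowOne F * freq S.Phi ω * (rowOne F)ᴴ) u = qf (freq S.Phi ω) (Sum.elim g u) := by
    have := qf_congr (freq S.Phi ω) (rowOne F)ᴴ u
    rwa [conjTranspose_conjTranspose, hw] at this
  have h4 : qf (fromBlocks 0 0 0 (-(((lam ^ 2 : ℝ) : ℂ) • 1)) : Matrix (Fin ny ⊕ Fin n) _ ℂ)
      (Sum.elim g u) = -(lam ^ 2 * qf 1 u) := by
    rw [← qf_smul, ← qf_neg]
    simp [qf, fromBlocks_mulVec, dotProduct, Fintype.sum_sum_type]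
  have h5 : qf (freq Υ ω * (freq Υ ω)ᴴ) (Sum.elim g u) = qf 1 v := by
    have := qf_gram (freq Υ ω)ᴴ (Sum.elim g u)
    rw [conjTranspose_conjTranspose, ← hvY] at this
    rw [this]
    simp [qf]
  rw [qf_sub, qf_smul, h3, hΥ.freq_Phi, qf_add, h4, h5, hγ]
  linarith

theorem IsSpectralFactor.mem_strictSet_of_synthesisLMI (hΥ : S.IsSpectralFactor lam Υ)
    (hR : R.Realizes Υ) (hRA : IsLyapStable R.A) (hγ : γ ^ 2 = γbar ^ 2 - lam ^ 2)
    (hfc : S.FreqCond γ) (hX : X.PosDef) (h : R.SynthesisLMI γbar A₁₁ B₁₁ C₁₁ J₁₁ X) :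
    ssTF A₁₁ B₁₁ C₁₁ J₁₁ ∈ S.strictSet γ := by
  have hA₁₁ := FactorData.isLyapStable_of_synthesisLMI hX h
  have hPe := hΥ.peBound_of_synthesisLMI hR hRA hγ hX h
  obtain ⟨θ, hθ, hfin, L, hL, hLP⟩ := hfc
  have hPe' : ∀ ω, (((γ ^ 2 : ℝ) : ℂ) • 1 - rowOne (freq (transfer A₁₁ B₁₁ C₁₁ J₁₁) ω) *
      freq S.Phi ω * (rowOne (freq (transfer A₁₁ B₁₁ C₁₁ J₁₁) ω))ᴴ).PosSemidef := by
    intro ω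
    have := hPe ω
    rw [ssTF_eq_transfer, hΥ.freq_Pe (hA₁₁.isStable_transfer.not_isPole_freq ω)] at this
    exact this.posSemidef
  rw [ssTF_eq_transfer] at hPe ⊢
  refine ⟨hA₁₁.isProper_transfer, hA₁₁.isStable_transfer, hPe, fun ω => ?_, J₁₁,
    tendsto_freq_transfer hA₁₁, ?_⟩
  · exact posDef_one_sub_of_freq_condition hθ (hfin ω) (hPe' ω)
  -- Only the nonstrict error bound passes to the limit; strictness at infinity comes from the
  -- frequency condition there.
  · refine posDef_one_sub_of_freq_condition hθ hLP ?_
    have hcont : Continuous fun z : Matrix (Fin n) (Fin ny) ℂ ×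
        Matrix (Fin ny ⊕ Fin n) (Fin ny ⊕ Fin n) ℂ =>
        ((γ ^ 2 : ℝ) : ℂ) • (1 : Matrix (Fin n) (Fin n) ℂ) - rowOne z.1 * z.2 * (rowOne z.1)ᴴ := by
      have hr : Continuous fun z : Matrix (Fin n) (Fin ny) ℂ ×
          Matrix (Fin ny ⊕ Fin n) (Fin ny ⊕ Fin n) ℂ => rowOne z.1 := by
        refine continuous_matrix fun i j => ?_
        rcases j with j | j
        · exact continuous_fst.matrix_elem i j
        · exact continuous_const
      exact continuous_const.sub ((hr.matrix_mul continuous_snd).matrix_mul hr.matrix_conjTranspose)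
    exact isClosed_posSemidef.mem_of_tendsto
      ((hcont.tendsto (J₁₁, L)).comp ((tendsto_freq_transfer hA₁₁).prodMk_nhds hL))
      (Filter.Eventually.of_forall hPe')

end Channel

/-! ### From a feasible point of the semidefinite program to a filter -/

namespace FactorData

variable {n ny p m m₁₁ q : ℕ} {R : FactorData n ny p m}

/-- The quadratic form of `Σ_X̂` on a vector `((x₁, x₂), (u, v))`, where `z₁` is the first component
of `X̂ (x₁, x₂)`. -/
theorem qf_SigmaX {γbar : ℝ} {X : Matrix (Fin m ⊕ Fin m₁₁) (Fin m ⊕ Fin m₁₁) ℂ}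
    (hX : X.IsHermitian) {x₁ z₁ : Fin m → ℂ} {x₂ z₂ : Fin m₁₁ → ℂ}
    (hz : X *ᵥ Sum.elim x₁ x₂ = Sum.elim z₁ z₂) (u : Fin n → ℂ) (v : Fin p → ℂ) :
    qf (R.SigmaX m₁₁ γbar X) (Sum.elim (Sum.elim x₁ x₂) (Sum.elim u v)) =
      2 * (star z₁ ⬝ᵥ (R.Aᴴ *ᵥ x₁ + R.C₂ᴴ *ᵥ u)).re + 2 * (star v ⬝ᵥ (R.Bᴴ *ᵥ x₁ + R.D₂ᴴ *ᵥ u)).re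
        - γbar ^ 2 * qf 1 u - qf 1 v := by
  rw [SigmaX, qf_boundedReal hX]
  have h1 : R.Abar m₁₁ *ᵥ Sum.elim x₁ x₂ + R.Bbar m₁₁ *ᵥ u =
      Sum.elim (R.Aᴴ *ᵥ x₁ + R.C₂ᴴ *ᵥ u) 0 := by
    rw [Abar, Bbar, fromBlocks_mulVec, fromRows_mulVec]
    ext (i | i) <;> simp
  have h2 : R.Cbar m₁₁ *ᵥ Sum.elim x₁ x₂ = R.Bᴴ *ᵥ x₁ := by
    rw [Cbar, fromCols_mulVec_sumElim, zero_mulVec, add_zero]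
  have h3 : star (Sum.elim x₁ x₂) ⬝ᵥ X *ᵥ Sum.elim (R.Aᴴ *ᵥ x₁ + R.C₂ᴴ *ᵥ u) 0 =
      star z₁ ⬝ᵥ (R.Aᴴ *ᵥ x₁ + R.C₂ᴴ *ᵥ u) := by
    rw [dotProduct_mulVec]
    nth_rewrite 1 [← hX.eq]
    rw [← star_mulVec, hz]
    simp [dotProduct, Fintype.sum_sum_type]
  rw [h1, h2, h3, Dbar]

/-- The quadratic form of the matrix inequality in `Y₁`. -/
theorem qf_lmiY {Nc : Matrix (Fin m ⊕ Fin p) (Fin q) ℂ} {ρ : ℝ} {Y : Matrix (Fin m) (Fin m) ℂ}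
    (hY : Y.IsHermitian) {w : Fin q → ℂ} {z : Fin m → ℂ} {v : Fin p → ℂ}
    (hw : Nc *ᵥ w = Sum.elim z v) (u : Fin n → ℂ) :
    qf (R.lmiY Nc ρ Y) (Sum.elim w u) =
      2 * (star z ⬝ᵥ (R.Aᴴ *ᵥ (Y *ᵥ z) + R.C₂ᴴ *ᵥ u)).re +
        2 * (star v ⬝ᵥ (R.Bᴴ *ᵥ (Y *ᵥ z) + R.D₂ᴴ *ᵥ u)).re - ρ * qf 1 u - qf 1 v := by
  have hT : (fromBlocks Nc 0 0 1 : Matrix ((Fin m ⊕ Fin p) ⊕ Fin n) (Fin q ⊕ Fin n) ℂ) *ᵥ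
      Sum.elim w u = Sum.elim (Sum.elim z v) u := by
    rw [fromBlocks_mulVec]
    simp [hw]
  rw [lmiY, qf_congr, hT]
  have hm : fromBlocks (fromBlocks (R.Aᴴ * Y + Y * R.A) (Y * R.B) (R.Bᴴ * Y) (-1))
      (fromRows R.C₂ᴴ R.D₂ᴴ) (fromCols R.C₂ R.D₂) (-((ρ : ℂ) • 1)) *ᵥ Sum.elim (Sum.elim z v) u =
      Sum.elim (Sum.elim ((R.Aᴴ * Y + Y * R.A) *ᵥ z + (Y * R.B) *ᵥ v + R.C₂ᴴ *ᵥ u)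
        ((R.Bᴴ * Y) *ᵥ z - v + R.D₂ᴴ *ᵥ u)) (R.C₂ *ᵥ z + R.D₂ *ᵥ v - (ρ : ℂ) • u) := by
    rw [fromBlocks_mulVec]
    simp only [Sum.elim_comp_inl, Sum.elim_comp_inr, fromCols_mulVec_sumElim, fromRows_mulVec,
      fromBlocks_mulVec]
    congr 1
    · ext (i | i) <;> simp [neg_mulVec, sub_eq_add_neg]
    · simp [neg_mulVec, smul_mulVec, sub_eq_add_neg]
  have e : ∀ (a : Fin m → ℂ) (b : Fin p → ℂ) (c : Fin n → ℂ), star (Sum.elim (Sum.elim z v) u) ⬝ᵥ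
      Sum.elim (Sum.elim a b) c = star z ⬝ᵥ a + star v ⬝ᵥ b + star u ⬝ᵥ c := by
    intro a b c
    simp [dotProduct, Fintype.sum_sum_type]
  have c1 : star z ⬝ᵥ Y *ᵥ (R.A *ᵥ z) = star (star z ⬝ᵥ R.Aᴴ *ᵥ (Y *ᵥ z)) := by
    rw [mulVec_mulVec, mulVec_mulVec, ← star_dotProduct_mulVec_conjTranspose, conjTranspose_mul,
      hY.eq, conjTranspose_conjTranspose]
  have c2 : star z ⬝ᵥ Y *ᵥ (R.B *ᵥ v) = star (star v ⬝ᵥ R.Bᴴ *ᵥ (Y *ᵥ z)) := by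
    rw [mulVec_mulVec, mulVec_mulVec, ← star_dotProduct_mulVec_conjTranspose, conjTranspose_mul,
      hY.eq, conjTranspose_conjTranspose]
  have c3 := star_dotProduct_mulVec_conjTranspose R.C₂ᴴ u z
  have c4 := star_dotProduct_mulVec_conjTranspose R.D₂ᴴ u v
  rw [conjTranspose_conjTranspose] at c3 c4
  rw [qf, hm, e]
  simp only [dotProduct_add, add_mulVec, c1, c2, c3, c4, dotProduct_smul, dotProduct_sub,
    ← mulVec_mulVec, qf, one_mulVec, Complex.add_re, Complex.sub_re, Complex.star_def,
    Complex.conj_re, smul_eq_mul, Complex.re_ofReal_mul]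
  ring

theorem piMat_mul_conjTranspose : PiMat n p m m₁₁ * (PiMat n p m m₁₁)ᴴ = 1 := by
  simp only [PiMat, Cund, Dund₂₁, conjTranspose_fromCols_eq_fromRows_conjTranspose,
    conjTranspose_fromRows_eq_fromCols_conjTranspose, fromCols_mul_fromRows,
    fromBlocks_conjTranspose, fromBlocks_multiply, fromRows_mul_fromCols]
  simp [fromBlocks_add]

/-- A block matrix whose Schur complements are the positive definite matrices `Z` and `E`. -/
theorem posDef_fromBlocks_of_add {Z E : Matrix (Fin m) (Fin m) ℂ} (hZ : Z.PosDef) (hE : E.PosDef) :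
    (fromBlocks (Z + E) E E E).PosDef := by
  refine posDef_iff_qf.2 ⟨?_, fun x hx => ?_⟩
  · rw [IsHermitian, fromBlocks_conjTranspose, conjTranspose_add, hZ.1.eq, hE.1.eq]
  obtain ⟨x₁, x₂, rfl⟩ : ∃ x₁ x₂, x = Sum.elim x₁ x₂ := ⟨_, _, (Sum.elim_comp_inl_inr x).symm⟩
  have h : qf (fromBlocks (Z + E) E E E) (Sum.elim x₁ x₂) = qf Z x₁ + qf E (x₁ + x₂) := by
    have e : ∀ a b : Fin m → ℂ, star (Sum.elim x₁ x₂) ⬝ᵥ Sum.elim a b =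
        star x₁ ⬝ᵥ a + star x₂ ⬝ᵥ b := by
      intro a b
      simp [dotProduct, Fintype.sum_sum_type]
    rw [qf, fromBlocks_mulVec, e]
    simp only [Sum.elim_comp_inl, Sum.elim_comp_inr, qf, add_mulVec, mulVec_add, dotProduct_add,
      star_add, add_dotProduct, Complex.add_re]
    ring
  rw [h]
  by_cases h1 : x₁ = 0
  · have h2 : x₁ + x₂ ≠ 0 := by
      rintro h2
      rw [h1, zero_add] at h2
      exact hx (by rw [h1, h2]; ext (i | i) <;> rfl)
    have := hE.qf_pos h2
    have := hZ.posSemidef.qf_nonneg x₁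
    linarith
  · have := hZ.qf_pos h1
    have := hE.posSemidef.qf_nonneg (x₁ + x₂)
    linarith

/-- A feasible point of the semidefinite program yields a filter of the order of the spectral factor
that satisfies the synthesis inequality. -/
theorem exists_synthesisLMI {Nc : Matrix (Fin m ⊕ Fin p) (Fin q) ℂ} (hNc : R.IsKernelMatrix Nc)
    {lam γbar : ℝ} {X₁ Y₁ : Matrix (Fin m) (Fin m) ℂ}
    (h : (γbar ^ 2, X₁, Y₁) ∈ R.sdpFeasible Nc lam) :
    ∃ (A₁₁ : Matrix (Fin m) (Fin m) ℂ) (B₁₁ : Matrix (Fin m) (Fin ny) ℂ)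
      (C₁₁ : Matrix (Fin n) (Fin m) ℂ) (J₁₁ : Matrix (Fin n) (Fin ny) ℂ)
      (X : Matrix (Fin m ⊕ Fin m) (Fin m ⊕ Fin m) ℂ),
      X.PosDef ∧ R.SynthesisLMI γbar A₁₁ B₁₁ C₁₁ J₁₁ X := by
  obtain ⟨-, -, hY, hL, hLY, hXY⟩ := h
  dsimp only at hY hL hLY hXY
  have hYu := (isUnit_iff_isUnit_det _).1 hY.isUnit
  -- The constraints give only `X₁ ≥ Y₁⁻¹`. The shift by `ε` makes `E` positive definite, so a
  -- filter of full order `m` is obtained even where the rank drops.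
  obtain ⟨ε, hε, hLε⟩ := exists_smul_add_posDef hL (E := -(R.A + R.Aᴴ)) (by
    simp [IsHermitian, add_comm])
  replace hLε := hLε ε hε.le le_rfl
  set X₀ := X₁ + (ε : ℂ) • (1 : Matrix (Fin m) (Fin m) ℂ) with hX₀
  replace hLε : (-(R.A * X₀ + X₀ * R.Aᴴ + R.B * R.Bᴴ)).PosDef := by
    convert hLε using 1
    rw [hX₀]
    simp only [Matrix.mul_add, Matrix.add_mul, Matrix.mul_smul, Matrix.smul_mul, Matrix.mul_one,
      Matrix.one_mul, smul_neg, smul_add]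
    abel
  have hS : (X₁ - Y₁⁻¹).PosSemidef := by
    have := hY.isUnit.invertible
    have := (PosDef.fromBlocks₂₂ X₁ (1 : Matrix (Fin m) (Fin m) ℂ) hY).1 (by
      rwa [conjTranspose_one])
    simpa using this
  set E := X₀ - Y₁⁻¹ with hE
  have hEpos : E.PosDef := by
    have := (posDef_smul_one (ι := Fin m) hε).add_posSemidef hS
    convert this using 1
    rw [hE, hX₀]; abel
  have hX₀E : X₀ = Y₁⁻¹ + E := by rw [hE]; abel
  -- The Schur complement of the lower right block is `X₀ - E = Y₁⁻¹`.
  set X := fromBlocks X₀ E E E with hXdef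
  have hX : X.PosDef := by
    rw [hXdef, hX₀E]
    exact posDef_fromBlocks_of_add hY.inv hEpos
  have hX₀h : X₀.IsHermitian := by rw [hX₀E]; exact hY.inv.1.add hEpos.1
  have hXmul : ∀ x₁ x₂, X *ᵥ Sum.elim x₁ x₂ = Sum.elim (X₀ *ᵥ x₁ + E *ᵥ x₂)
      (E *ᵥ x₁ + E *ᵥ x₂) := fun x₁ x₂ => by
    rw [hXdef, fromBlocks_mulVec]; rfl
  have hSig : (R.SigmaX m γbar X).IsHermitian := by
    rw [SigmaX, IsHermitian, fromBlocks_conjTranspose]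
    simp only [conjTranspose_add, conjTranspose_mul, hX.1.eq, conjTranspose_conjTranspose,
      conjTranspose_fromCols_eq_fromRows_conjTranspose,
      conjTranspose_fromRows_eq_fromCols_conjTranspose, fromBlocks_conjTranspose, conjTranspose_neg,
      conjTranspose_smul, conjTranspose_one, Complex.star_def, Complex.conj_ofReal]
    rw [add_comm]
  have hsplit : ∀ x : (Fin m ⊕ Fin m) ⊕ (Fin n ⊕ Fin p) → ℂ, ∃ x₁ x₂ u v,
      x = Sum.elim (Sum.elim x₁ x₂) (Sum.elim u v) := fun x =>
    ⟨fun i => x (.inl (.inl i)), fun i => x (.inl (.inr i)), fun i => x (.inr (.inl i)),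
      fun i => x (.inr (.inr i)), by ext ((i | i) | (i | i)) <;> rfl⟩
  -- Here `x₂ = 0` and `u = 0`; completing the square in `v` leaves the Lyapunov form of `X₀`.
  have hPM : ∀ x, x ≠ 0 → PiMat n p m m *ᵥ x = 0 → qf (R.SigmaX m γbar X) x < 0 := by
    intro x hx hP
    obtain ⟨x₁, x₂, u, v, rfl⟩ := hsplit x
    have hPx : PiMat n p m m *ᵥ Sum.elim (Sum.elim x₁ x₂) (Sum.elim u v) = Sum.elim x₂ u := by
      rw [PiMat, fromCols_mulVec_sumElim, fromCols_mulVec_sumElim, Cund, Dund₂₁, fromBlocks_mulVec,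
        fromRows_mulVec]
      ext (i | i) <;> simp
    rw [hPx] at hP
    obtain rfl : x₂ = 0 := funext fun i => congrFun hP (.inl i)
    obtain rfl : u = 0 := funext fun i => congrFun hP (.inr i)
    rw [qf_SigmaX hX.1 (hXmul x₁ 0)]
    simp only [mulVec_zero, add_zero]
    have h1 : (star (X₀ *ᵥ x₁) ⬝ᵥ R.Aᴴ *ᵥ x₁).re = (star x₁ ⬝ᵥ R.A *ᵥ (X₀ *ᵥ x₁)).re := by
      rw [star_dotProduct_mulVec_conjTranspose, Complex.star_def, Complex.conj_re]
    have h1' : (star (X₀ *ᵥ x₁) ⬝ᵥ R.Aᴴ *ᵥ x₁).re = (star x₁ ⬝ᵥ X₀ *ᵥ (R.Aᴴ *ᵥ x₁)).re := by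
      rw [star_mulVec, hX₀h.eq, ← dotProduct_mulVec]
    have h2 : qf (R.A * X₀ + X₀ * R.Aᴴ + R.B * R.Bᴴ) x₁ =
        2 * (star (X₀ *ᵥ x₁) ⬝ᵥ R.Aᴴ *ᵥ x₁).re + qf 1 (R.Bᴴ *ᵥ x₁) := by
      have := qf_gram R.Bᴴ x₁
      rw [conjTranspose_conjTranspose] at this
      rw [qf_add, qf_add, this]
      simp only [qf, ← mulVec_mulVec, one_mulVec, ← h1, ← h1']
      ring
    have h3 : qf 1 (R.Bᴴ *ᵥ x₁ - v) =
        qf 1 (R.Bᴴ *ᵥ x₁) + qf 1 v - 2 * (star v ⬝ᵥ R.Bᴴ *ᵥ x₁).re := by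
      have h4 : (star (R.Bᴴ *ᵥ x₁) ⬝ᵥ v).re = (star v ⬝ᵥ R.Bᴴ *ᵥ x₁).re := by
        rw [← Complex.conj_re, ← Complex.star_def, star_dotProduct, star_star]
      simp only [qf, one_mulVec, star_sub, sub_dotProduct, dotProduct_sub, Complex.sub_re, h4]
      ring
    have h5 := (PosSemidef.one (n := Fin p) (R := ℂ)).qf_nonneg (R.Bᴴ *ᵥ x₁ - v)
    by_cases hx₁ : x₁ = 0
    · subst hx₁
      have hv : v ≠ 0 := by
        rintro rfl
        exact hx (by ext ((i | i) | (i | i)) <;> rfl)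
      have := (PosDef.one (n := Fin p) (R := ℂ)).qf_pos hv
      simpa [qf] using this
    · have h6 := hLε.qf_pos hx₁
      rw [qf_neg, h2] at h6
      have h7 : qf (1 : Matrix (Fin n) (Fin n) ℂ) 0 = 0 := qf_zero_vec _
      rw [h7]
      linarith
  -- Here the second component of `X x` vanishes, so `x₂ = -x₁` and the first component is `z₁ =
  -- Y₁⁻¹ x₁`. Then `(z₁, v)` lies in the image of `Nc`, and the form is that of the inequality in
  -- `Y₁`.
  have hLM : ∀ x, x ≠ 0 → R.LambdaX m X *ᵥ x = 0 → qf (R.SigmaX m γbar X) x < 0 := by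
    intro x hx hΛ
    obtain ⟨x₁, x₂, u, v, rfl⟩ := hsplit x
    set z₁ := X₀ *ᵥ x₁ + E *ᵥ x₂ with hz₁
    set z₂ := E *ᵥ x₁ + E *ᵥ x₂ with hz₂
    have hΛx : R.LambdaX m X *ᵥ Sum.elim (Sum.elim x₁ x₂) (Sum.elim u v) =
        Sum.elim z₂ (R.C₁ *ᵥ z₁ + R.D₁ *ᵥ v) := by
      rw [LambdaX, fromCols_mulVec_sumElim, fromCols_mulVec_sumElim, ← mulVec_mulVec, hXmul, Bund,
        Dund₁₂, fromBlocks_conjTranspose, conjTranspose_fromCols_eq_fromRows_conjTranspose,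
        fromBlocks_mulVec, fromRows_mulVec]
      ext (i | i) <;> simp [hz₁, hz₂]
    rw [hΛx] at hΛ
    have hz₂0 : z₂ = 0 := funext fun i => congrFun hΛ (.inl i)
    have hker : R.C₁ *ᵥ z₁ + R.D₁ *ᵥ v = 0 := funext fun i => congrFun hΛ (.inr i)
    have hsum : x₁ + x₂ = 0 := by
      have hEu := (isUnit_iff_isUnit_det _).1 hEpos.isUnit
      rw [hz₂, ← mulVec_add] at hz₂0
      have := congrArg (fun y => E⁻¹ *ᵥ y) hz₂0
      simpa [mulVec_mulVec, nonsing_inv_mul _ hEu] using this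
    obtain rfl : x₂ = -x₁ := (neg_eq_of_add_eq_zero_right hsum).symm
    have hz₁Y : z₁ = Y₁⁻¹ *ᵥ x₁ := by
      rw [hz₁, hX₀E, add_mulVec, mulVec_neg, add_neg_cancel_right]
    have hx₁ : x₁ = Y₁ *ᵥ z₁ := by
      rw [hz₁Y, mulVec_mulVec, mul_nonsing_inv _ hYu, one_mulVec]
    obtain ⟨w, hw⟩ : Sum.elim z₁ v ∈ LinearMap.range Nc.mulVecLin := by
      rw [hNc.1, LinearMap.mem_ker, mulVecLin_apply, fromCols_mulVec_sumElim, hker]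
    rw [mulVecLin_apply] at hw
    have hne : Sum.elim w u ≠ 0 := by
      intro h0
      obtain rfl : w = 0 := funext fun i => congrFun h0 (.inl i)
      obtain rfl : u = 0 := funext fun i => congrFun h0 (.inr i)
      rw [mulVec_zero] at hw
      have hz0 : z₁ = 0 := funext fun i => (congrFun hw (.inl i)).symm
      obtain rfl : v = 0 := funext fun i => (congrFun hw (.inr i)).symm
      rw [hz0, mulVec_zero] at hx₁
      refine hx ?_
      rw [hx₁]
      ext ((i | i) | (i | i)) <;> simp
    have h1 := hLY.qf_pos hne
    rw [qf_neg, qf_lmiY hY.1 hw, ← hx₁] at h1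
    rw [qf_SigmaX hX.1 (hXmul x₁ (-x₁)), ← hz₁]
    linarith
  obtain ⟨K, hK⟩ := exists_elimination hSig (R.LambdaX m X) (PiMat n p m m) piMat_mul_conjTranspose
    hPM hLM
  refine ⟨K.toBlocks₁₁ᴴ, K.toBlocks₂₁ᴴ, K.toBlocks₁₂ᴴ, K.toBlocks₂₂ᴴ, X, hX, ?_⟩
  simpa only [SynthesisLMI, conjTranspose_conjTranspose, fromBlocks_toBlocks] using hK

end FactorData

/-! ### Convexity of the feasible set -/

namespace FactorData

variable {n ny p m q : ℕ} (R : FactorData n ny p m)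

/-- Each constraint asks an affine function of `(ρ, X₁, Y₁)` to lie in a convex cone or half-line;
the constant terms are rewritten with `a + b = 1`. -/
theorem convex_sdpFeasible (Nc : Matrix (Fin m ⊕ Fin p) (Fin q) ℂ) (lam : ℝ) :
    Convex ℝ (R.sdpFeasible Nc lam) := by
  rintro ⟨ρ, X, Y⟩ ⟨h1, h2, h3, h4, h5, h6⟩ ⟨ρ', X', Y'⟩ ⟨k1, k2, k3, k4, k5, k6⟩ a b ha hb hab
  dsimp only at h1 h2 h3 h4 h5 h6 k1 k2 k3 k4 k5 k6
  have hpd : ∀ {ι : Type} [Fintype ι] {M M' : Matrix ι ι ℂ}, M.PosDef → M'.PosDef →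
      (a • M + b • M').PosDef := by
    intro ι _ M M' hM hM'
    rcases ha.eq_or_lt with rfl | ha
    · obtain rfl : b = 1 := by linarith
      simpa using hM'
    · exact (hM.smul ha).add_posSemidef (hM'.posSemidef.smul hb)
  have hab' : (a : ℂ) + b = 1 := by exact_mod_cast hab
  have hsm : ∀ {ι κ : Type} (c : ℝ) (M : Matrix ι κ ℂ), c • M = (c : ℂ) • M := by
    intro ι κ c M
    ext i j
    simp
  refine ⟨?_, hpd h2 k2, hpd h3 k3, ?_, ?_, ?_⟩
  · exact (convex_Ioi (𝕜 := ℝ) (lam ^ 2)) h1 k1 ha hb hab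
  · convert hpd h4 k4 using 1
    have : R.B * R.Bᴴ = (a : ℂ) • (R.B * R.Bᴴ) + (b : ℂ) • (R.B * R.Bᴴ) := by
      rw [← add_smul, hab', one_smul]
    dsimp only [Prod.snd_add, Prod.fst_add, Prod.smul_snd, Prod.smul_fst]
    conv_lhs => rw [this]
    simp only [hsm, Matrix.mul_add, Matrix.add_mul, Matrix.mul_smul, Matrix.smul_mul, smul_neg,
      smul_add]
    abel
  · convert hpd h5 k5 using 1
    have hT : ∀ (T : Matrix ((Fin m ⊕ Fin p) ⊕ Fin n) (Fin q ⊕ Fin n) ℂ)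
        (M M' : Matrix ((Fin m ⊕ Fin p) ⊕ Fin n) ((Fin m ⊕ Fin p) ⊕ Fin n) ℂ),
        a • -(Tᴴ * M * T) + b • -(Tᴴ * M' * T) = -(Tᴴ * (a • M + b • M') * T) := by
      intro T M M'
      rw [Matrix.mul_add, Matrix.add_mul, Matrix.mul_smul, Matrix.mul_smul, Matrix.smul_mul,
        Matrix.smul_mul, smul_neg, smul_neg, neg_add]
    simp only [lmiY]
    rw [hT]
    congr 3
    dsimp only [Prod.snd_add, Prod.fst_add, Prod.smul_snd, Prod.smul_fst]
    have hone : ∀ c : ℂ, (a : ℂ) * c + b * c = c := fun c => by rw [← add_mul, hab', one_mul]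
    simp only [fromBlocks_smul, fromBlocks_add]
    congr 1
    · congr 1
      · simp only [hsm, Matrix.mul_add, Matrix.add_mul, Matrix.mul_smul, Matrix.smul_mul, smul_add]
        abel
      · simp only [hsm, Matrix.add_mul, Matrix.smul_mul]
      · simp only [hsm, Matrix.mul_add, Matrix.mul_smul]
      · ext i j; simp [hone, ← neg_add]
    · ext (i | i) j <;> simp [hone]
    · ext i (j | j) <;> simp [hone]
    · ext i j; simp; ring
  · convert (h6.smul ha).add (k6.smul hb) using 1
    rw [fromBlocks_smul, fromBlocks_smul, fromBlocks_add, ← add_smul, hab, one_smul]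
    rfl

end FactorData

end CoherentEq

end

theorem corollary1 {n nw ny nd N p m q : ℕ} (S : CoherentEq.Channel n nw ny nd N)
    (lam : ℝ) (hlam : 0 ≤ lam)
    (Υ : CoherentEq.TF (Fin ny ⊕ Fin n) (Fin p)) (hΥ : S.IsSpectralFactor lam Υ)
    (R : CoherentEq.FactorData n ny p m) (hR : R.Realizes Υ)
    (Nc : Matrix (Fin m ⊕ Fin p) (Fin q) ℂ) (hNc : R.IsKernelMatrix Nc)
    (m₁₁ : ℕ) (hm : m₁₁ = m) :
    (∀ X₁ Y₁ : Matrix (Fin m) (Fin m) ℂ, (Matrix.fromBlocks X₁ 1 1 Y₁).rank ≤ m + m₁₁) ∧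
    R.rankFeasible Nc lam m₁₁ = R.sdpFeasible Nc lam ∧
    Convex ℝ (R.sdpFeasible Nc lam) ∧
    ∀ γbar : ℝ, (∃ X₁ Y₁, (γbar ^ 2, X₁, Y₁) ∈ R.sdpFeasible Nc lam) →
      ∀ γ : ℝ, γ = Real.sqrt (γbar ^ 2 - lam ^ 2) → S.FreqCond γ →
        (S.strictSet γ).Nonempty ∧
        S.gammaStrict ≤ γ ∧
        S.gammaStrict = S.gammaOpt ∧
        (∃ (A₁₁ : Matrix (Fin m₁₁) (Fin m₁₁) ℂ) (B₁₁ : Matrix (Fin m₁₁) (Fin ny) ℂ)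
          (C₁₁ : Matrix (Fin n) (Fin m₁₁) ℂ) (J₁₁ : Matrix (Fin n) (Fin ny) ℂ)
          (Xhat : Matrix (Fin m ⊕ Fin m₁₁) (Fin m ⊕ Fin m₁₁) ℂ),
          Xhat.PosDef ∧ R.SynthesisLMI γbar A₁₁ B₁₁ C₁₁ J₁₁ Xhat) ∧
        (∀ (A₁₁ : Matrix (Fin m₁₁) (Fin m₁₁) ℂ) (B₁₁ : Matrix (Fin m₁₁) (Fin ny) ℂ)
          (C₁₁ : Matrix (Fin n) (Fin m₁₁) ℂ) (J₁₁ : Matrix (Fin n) (Fin ny) ℂ)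
          (Xhat : Matrix (Fin m ⊕ Fin m₁₁) (Fin m ⊕ Fin m₁₁) ℂ),
          Xhat.PosDef → R.SynthesisLMI γbar A₁₁ B₁₁ C₁₁ J₁₁ Xhat →
          0 < γ ∧ CoherentEq.ssTF A₁₁ B₁₁ C₁₁ J₁₁ ∈ S.strictSet γ) := by
  subst hm
  have hrank : ∀ X₁ Y₁ : Matrix (Fin m₁₁) (Fin m₁₁) ℂ,
      (Matrix.fromBlocks X₁ 1 1 Y₁).rank ≤ m₁₁ + m₁₁ := fun X₁ Y₁ => by
    simpa using Matrix.rank_le_card_width (Matrix.fromBlocks X₁ 1 1 Y₁)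
  refine ⟨hrank, Set.ext fun v => ⟨fun h => h.1, fun h => ⟨h, hrank _ _⟩⟩,
    R.convex_sdpFeasible Nc lam, ?_⟩
  rintro γbar ⟨X₁, Y₁, hXY⟩ γ hγ hfc
  have hlt : 0 < γbar ^ 2 - lam ^ 2 := sub_pos.2 hXY.1
  have hγpos : 0 < γ := by rw [hγ]; exact Real.sqrt_pos.2 hlt
  have hγsq : γ ^ 2 = γbar ^ 2 - lam ^ 2 := by rw [hγ, Real.sq_sqrt hlt.le]
  have hRA := CoherentEq.FactorData.isLyapStable_of_mem_sdpFeasible hXY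
  obtain ⟨A₁₁, B₁₁, C₁₁, J₁₁, X, hX, hLMI⟩ := CoherentEq.FactorData.exists_synthesisLMI hNc hXY
  have hne : (S.strictSet γ).Nonempty :=
    ⟨_, hΥ.mem_strictSet_of_synthesisLMI hR hRA hγsq hfc hX hLMI⟩
  exact ⟨hne, S.gammaStrict_le hγpos hne, hΥ.gammaStrict_eq_gammaOpt ⟨γ, hγpos, hne⟩,
    ⟨A₁₁, B₁₁, C₁₁, J₁₁, X, hX, hLMI⟩, fun _ _ _ _ _ hX' h' =>
      ⟨hγpos, hΥ.mem_strictSet_of_synthesisLMI hR hRA hγsq hfc hX' h'⟩⟩
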